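/- A \emph{signed tree model} is a triple $\mathcal T=(T,A,B)$, where $T$ is a finite rooted full binary tree (every internal node has exactly two children; $x \preceq y$ means that $x$ is an ancestor of $y$ or $x=y$) and $A$, $B$ are two disjoint sets of unordered pairs of nodes of $T$, called \emph{transversal pairs}, such that neither node of a transversal pair is an ancestor of, or equal to, the other, and no two transversal pairs $u_1v_1,u_2v_2$ in $A\cup B$ cross, i.e. it never happens that one of $u_1,v_1$ is a strict ancestor of one of $u_2,v_2$ and one of $u_2,v_2$ is a strict ancestor of one of $u_1,v_1$. A transversal pair $u'v'$ \emph{covers} a pair $u,v$ of nodes if $u'\preceq u$, $v'\preceq v$ and there is no other transversal pair $u''v''$ with $u'\preceq u''\preceq u$ and $v'\preceq v''\preceq v$. The model is a model of the graph $G$ if $V(G)$ is in bijection with the leaves of $T$ in such a way that two vertices are adjacent in $G$ if and only if the corresponding leaves are covered by a pair in $B$. A \emph{shortest-path tree} of $G$ rooted at $v$ is a subtree of $G$ that contains exactly the vertices reachable from $v$ and in which every vertex has the same distance to $v$ as in $G$. \textbf{Theorem.} There is an algorithm (a single program for a random access machine with words of $O(\log (n+1))$ bits and unit-cost arithmetic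 on words) that, given a signed tree model with $p$ transversal pairs of an $n$-vertex unweighted graph $G$, the tree $T$ being given by parent pointers, and given a vertex $v\in V(G)$, outputs (by parent pointers) a shortest-path tree of $G$ rooted at $v$ in time $O(n+p\log n)$; thus in time $O(p\log n)$ whenever $n=O(p\log n)$, in particular whenever $p\geq n$. -/

import Mathlib

/-! ### Signed tree models -/

/-- A rooted tree (ordered by the ancestor relation, the root being `⊥`) is a full binary tree if
every node is a leaf (has no descendant but itself) or has exactly two children. -/
def RootedTree.IsFullBinary (T : RootedTree) : Prop :=
  ∀ t : T, IsMax t ∨ {c : T | t ⋖ c}.ncard = 2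

/-- The leaves of a rooted tree. -/
abbrev RootedTree.Leaf (T : RootedTree) : Type _ := {t : T // IsMax t}

/-- Two unordered pairs of nodes cross if an element of the first is a strict ancestor of an element
of the second, and vice versa. -/
def RootedTree.Cross (T : RootedTree) (e f : Sym2 T) : Prop :=
  (∃ a ∈ e, ∃ b ∈ f, a < b) ∧ (∃ a ∈ e, ∃ b ∈ f, b < a)

/-- A signed tree model on the rooted tree `T`: the tree is a full binary tree, `neg` is the set of
transversal anti-edges, `pos` the set of transversal edges. -/
structure SignedTreeModel (T : RootedTree) where
  full : T.IsFullBinary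
  neg : Set (Sym2 T)
  pos : Set (Sym2 T)
  disjoint : Disjoint neg pos
  transversal : ∀ u v : T, s(u, v) ∈ neg ∪ pos → ¬ u ≤ v ∧ ¬ v ≤ u
  not_cross : ∀ e ∈ neg ∪ pos, ∀ f ∈ neg ∪ pos, ¬ T.Cross e f

namespace SignedTreeModel

variable {T : RootedTree}

/-- The transversal pair `s(u', v')` covers the pair `u, v`, with `u'` above `u` and `v'` above
`v`. -/
def Covers (M : SignedTreeModel T) (u' v' u v : T) : Prop :=
  s(u', v') ∈ M.neg ∪ M.pos ∧ u' ≤ u ∧ v' ≤ v ∧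
    ∀ u'' v'' : T, s(u'', v'') ∈ M.neg ∪ M.pos →
      u' ≤ u'' → u'' ≤ u → v' ≤ v'' → v'' ≤ v → s(u'', v'') = s(u', v')

/-- The graph of a signed tree model: its vertices are the leaves, two of them being adjacent when
they are covered by a transversal edge. -/
def graph (M : SignedTreeModel T) : SimpleGraph T.Leaf where
  Adj u v := ∃ u' v' : T, s(u', v') ∈ M.pos ∧ M.Covers u' v' u v
  symm := ⟨by
    rintro u v ⟨u', v', hp, hm, hu, hv, h⟩
    refine ⟨v', u', Sym2.eq_swap ▸ hp, Sym2.eq_swap ▸ hm, hv, hu, ?_⟩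
    intro a b hab h1 h2 h3 h4
    rw [Sym2.eq_swap, h b a (Sym2.eq_swap ▸ hab) h3 h4 h1 h2, Sym2.eq_swap]⟩
  loopless := ⟨by
    rintro u ⟨u', v', -, hm, hu, hv, -⟩
    rcases le_total_of_directed hu hv with h | h
    · exact (M.transversal _ _ hm).2 h
    · exact (M.transversal _ _ hm).1 h⟩

end SignedTreeModel

/-! ### Shortest-path trees -/

/-- `H` is a shortest-path tree of `G` rooted at `r`: a subtree of `G` that contains exactly the
vertices reachable from `r`, and in which every vertex is at the same distance from `r` as in `G`. -/
structure IsShortestPathTree {V : Type*} (G : SimpleGraph V) (r : V) (H : G.Subgraph) : Prop where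
  isTree : H.coe.IsTree
  verts_eq : H.verts = {u | G.Reachable r u}
  dist_eq : ∀ u ∈ H.verts, H.spanningCoe.dist r u = G.dist r u

/-- The array `par` stores the tree `H`, rooted at `r`, by parent pointers: the root points to
itself, every other vertex of `H` to its parent, and every vertex outside `H` carries the
mark `n`. -/
structure StoresRootedTree {n : ℕ} {G : SimpleGraph (Fin n)} (H : G.Subgraph) (r : Fin n)
    (par : ℕ → ℕ) : Prop where
  root : par r = r
  parent : ∀ u ∈ H.verts, u ≠ r → ∃ w : Fin n, par u = w ∧ H.Adj w u ∧
    H.spanningCoe.dist r w + 1 = H.spanningCoe.dist r u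
  outside : ∀ u ∉ H.verts, par u = n

/-! ### The machine model

A random access machine with words of `w` bits, programmed in a structured language. A program
uses finitely many registers and finitely many arrays, whose cells are addressed by words, and all
cells hold words. Operations on words take unit time. -/

namespace WordRAM

/-- The contents of the registers and of the arrays. -/
structure State where
  reg : ℕ → ℕ
  arr : ℕ → ℕ → ℕ

/-- Unit-cost operations on words. Subtraction is truncated, division rounds down, and comparisons
return `1` for true and `0` for false. -/
inductive BinOp
  | add | sub | mul | div | lt | eq

def BinOp.eval : BinOp → ℕ → ℕ → ℕ
  | add, x, y => x + y
  | sub, x, y => x - y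
  | mul, x, y => x * y
  | div, x, y => x / y
  | lt, x, y => if x < y then 1 else 0
  | eq, x, y => if x = y then 1 else 0

/-- Expressions: constants, registers, array cells, and operations. -/
inductive Expr
  | const (k : ℕ)
  | var (x : ℕ)
  | load (a : ℕ) (i : Expr)
  | bin (op : BinOp) (e f : Expr)

namespace Expr

/-- The value of an expression. -/
def eval (s : State) : Expr → ℕ
  | const k => k
  | var x => s.reg x
  | load a i => s.arr a (i.eval s)
  | bin op e f => op.eval (e.eval s) (f.eval s)

/-- Every value that occurs in the evaluation of the expression fits into a word of `w` bits. -/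
def Fits (w : ℕ) (s : State) : Expr → Prop
  | const k => k < 2 ^ w
  | var x => s.reg x < 2 ^ w
  | load a i => i.Fits w s ∧ s.arr a (i.eval s) < 2 ^ w
  | bin op e f => e.Fits w s ∧ f.Fits w s ∧ op.eval (e.eval s) (f.eval s) < 2 ^ w

/-- The time needed to evaluate an expression: one unit for each of its nodes. -/
def cost : Expr → ℕ
  | const _ => 1
  | var _ => 1
  | load _ i => i.cost + 1
  | bin _ e f => e.cost + f.cost + 1

end Expr

/-- Programs. -/
inductive Prog
  | skip
  | assign (x : ℕ) (e : Expr)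
  | store (a : ℕ) (i e : Expr)
  | seq (P Q : Prog)
  | ite (e : Expr) (P Q : Prog)
  | loop (e : Expr) (P : Prog)

/-- Write the value `v` to the register `x`. -/
def State.setReg (s : State) (x v : ℕ) : State :=
  { s with reg := Function.update s.reg x v }

/-- Write the value `v` to cell `i` of the array `a`. -/
def State.setArr (s : State) (a i v : ℕ) : State :=
  { s with arr := Function.update s.arr a (Function.update (s.arr a) i v) }

/-- `Exec w P s s' t`: on a machine with words of `w` bits, the program `P`, started in the state
`s`, halts in the state `s'` after `t` time units. The machine is stuck (there is no such `s'`)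
when a computed value does not fit into a word. `loop e P` repeats `P` while `e` is not `0`. -/
inductive Exec (w : ℕ) : Prog → State → State → ℕ → Prop
  | skip (s : State) : Exec w .skip s s 1
  | assign (s : State) (x : ℕ) (e : Expr) (he : e.Fits w s) :
      Exec w (.assign x e) s (s.setReg x (e.eval s)) (e.cost + 1)
  | store (s : State) (a : ℕ) (i e : Expr) (hi : i.Fits w s) (he : e.Fits w s) :
      Exec w (.store a i e) s (s.setArr a (i.eval s) (e.eval s)) (i.cost + e.cost + 1)
  | seq (s s' s'' : State) (P Q : Prog) (t t' : ℕ) (hP : Exec w P s s' t)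
      (hQ : Exec w Q s' s'' t') : Exec w (.seq P Q) s s'' (t + t')
  | iteTrue (s s' : State) (e : Expr) (P Q : Prog) (t : ℕ) (he : e.Fits w s)
      (h : e.eval s ≠ 0) (hP : Exec w P s s' t) : Exec w (.ite e P Q) s s' (e.cost + 1 + t)
  | iteFalse (s s' : State) (e : Expr) (P Q : Prog) (t : ℕ) (he : e.Fits w s)
      (h : e.eval s = 0) (hQ : Exec w Q s s' t) : Exec w (.ite e P Q) s s' (e.cost + 1 + t)
  | loopFalse (s : State) (e : Expr) (P : Prog) (he : e.Fits w s) (h : e.eval s = 0) :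
      Exec w (.loop e P) s s (e.cost + 1)
  | loopTrue (s s' s'' : State) (e : Expr) (P : Prog) (t t' : ℕ) (he : e.Fits w s)
      (h : e.eval s ≠ 0) (hP : Exec w P s s' t) (hL : Exec w (.loop e P) s' s'' t') :
      Exec w (.loop e P) s s'' (e.cost + 1 + t + t')

end WordRAM

/-! ### The input -/

/-- A presentation of a signed tree model of the graph `G` on the vertices `0, …, n - 1`, with `p`
transversal pairs: an arbitrary numbering of the `N` nodes of the tree, a bijection between the
vertices and the leaves under which `G` is the graph of the model, and a list of the transversal
pairs without repetition, in arbitrary order, with their signs (`true` for a transversal edge). -/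
structure SignedTreeModel.Presentation {T : RootedTree} (M : SignedTreeModel T) {n : ℕ}
    (G : SimpleGraph (Fin n)) (N p : ℕ) where
  node : T ≃ Fin N
  leaf : G ≃g M.graph
  fst : Fin p → T
  snd : Fin p → T
  sign : Fin p → Bool
  injective : Function.Injective fun i => s(fst i, snd i)
  mem_neg : ∀ e : Sym2 T, e ∈ M.neg ↔ ∃ i, sign i = false ∧ s(fst i, snd i) = e
  mem_pos : ∀ e : Sym2 T, e ∈ M.pos ↔ ∃ i, sign i = true ∧ s(fst i, snd i) = e

/-- The array with entries `f 0, …, f (m - 1)`, followed by zeros. -/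
def arrayOf {m : ℕ} (f : Fin m → ℕ) (i : ℕ) : ℕ :=
  if h : i < m then f ⟨i, h⟩ else 0

/-- The initial state of the machine. Registers `0` to `3` hold the number of vertices, the number
of nodes, the number of transversal pairs and the source. Array `0` holds the parent of every node
(the root points to itself), array `1` the leaf of every vertex, arrays `2` and `3` the two ends of
every transversal pair, and array `4` its sign. All other cells are `0`. -/
def SignedTreeModel.Presentation.input {T : RootedTree} {M : SignedTreeModel T} {n : ℕ}
    {G : SimpleGraph (Fin n)} {N p : ℕ} (D : M.Presentation G N p) (v : Fin n) :
    WordRAM.State where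
  reg
    | 0 => n
    | 1 => N
    | 2 => p
    | 3 => v
    | _ => 0
  arr
    | 0 => arrayOf fun i : Fin N => (D.node (Order.pred (D.node.symm i)) : ℕ)
    | 1 => arrayOf fun i : Fin n => (D.node (D.leaf i).1 : ℕ)
    | 2 => arrayOf fun i : Fin p => (D.node (D.fst i) : ℕ)
    | 3 => arrayOf fun i : Fin p => (D.node (D.snd i) : ℕ)
    | 4 => arrayOf fun i : Fin p => if D.sign i then 1 else 0
    | _ => fun _ => 0

namespace WordRAM

/-- Sequential composition of programs. -/
infixr:60 " ;; " => Prog.seq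

/-- The machine has words of `w` bits, and all cells hold values up to `B`, with enough room in a
word for small multiples of `B`. -/
structure Mach (w B : ℕ) (s : State) : Prop where
  one_le : 1 ≤ B
  room : 16 * B < 2 ^ w
  reg : ∀ x, s.reg x ≤ B
  arr : ∀ a i, s.arr a i ≤ B

namespace Expr

/-- A number `c` such that the value of the expression is at most `c * B` if all cells hold values
up to `B` (multiplications not being supported). -/
def coef : Expr → ℕ
  | const k => k
  | var _ => 1
  | load _ _ => 1
  | bin .add e f => e.coef + f.coef
  | bin .sub e _ => e.coef
  | bin .div e _ => e.coef
  | bin .mul _ _ => 17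
  | bin .lt _ _ => 1
  | bin .eq _ _ => 1

/-- All subexpressions have values up to `16 * B`. -/
def Small : Expr → Bool
  | const k => decide (k ≤ 16)
  | var _ => true
  | load _ i => i.Small
  | bin op e f => e.Small && f.Small && decide ((bin op e f).coef ≤ 16)

theorem eval_le {w B : ℕ} {s : State} (hs : Mach w B s) :
    ∀ e : Expr, e.Small = true → e.eval s ≤ e.coef * B
  | const k, _ => by
    simpa [eval, coef] using Nat.mul_le_mul_left k hs.one_le
  | var x, _ => by simpa [eval, coef] using hs.reg x
  | load a i, _ => by simpa [eval, coef] using hs.arr a _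
  | bin op e f, h => by
    simp only [Small, Bool.and_eq_true, decide_eq_true_eq] at h
    have he := eval_le hs e h.1.1
    have hf := eval_le hs f h.1.2
    have h1 := hs.one_le
    cases op <;> simp only [eval, coef, BinOp.eval] at h ⊢
    · rw [Nat.add_mul]; omega
    · omega
    · omega
    · exact (Nat.div_le_self _ _).trans he
    · split_ifs <;> omega
    · split_ifs <;> omega

theorem coef_le_of_small : ∀ e : Expr, e.Small = true → e.coef ≤ 16
  | const k, h => by simpa [Small, coef] using h
  | var x, _ => by simp [coef]
  | load a i, _ => by simp [coef]
  | bin op e f, h => by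
    simp only [Small, Bool.and_eq_true, decide_eq_true_eq] at h
    exact h.2

theorem eval_lt {w B : ℕ} {s : State} (hs : Mach w B s) (e : Expr) (h : e.Small = true) :
    e.eval s < 2 ^ w :=
  ((eval_le hs e h).trans (Nat.mul_le_mul_right B (coef_le_of_small e h))).trans_lt hs.room

theorem fits {w B : ℕ} {s : State} (hs : Mach w B s) :
    ∀ e : Expr, e.Small = true → e.Fits w s
  | const k, h => eval_lt hs (const k) h
  | var x, h => eval_lt hs (var x) h
  | load a i, h => ⟨fits hs i h, eval_lt hs (load a i) h⟩
  | bin op e f, h => by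
    have h' := h
    simp only [Small, Bool.and_eq_true, decide_eq_true_eq] at h'
    exact ⟨fits hs e h'.1.1, fits hs f h'.1.2, eval_lt hs (bin op e f) h⟩

end Expr

theorem Mach.setReg {w B : ℕ} {s : State} (hs : Mach w B s) (x : ℕ) {v : ℕ} (hv : v ≤ B) :
    Mach w B (s.setReg x v) where
  one_le := hs.one_le
  room := hs.room
  reg y := by
    simp only [State.setReg, Function.update_apply]
    split_ifs
    exacts [hv, hs.reg y]
  arr := hs.arr

theorem Mach.setArr {w B : ℕ} {s : State} (hs : Mach w B s) (a i : ℕ) {v : ℕ} (hv : v ≤ B) :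
    Mach w B (s.setArr a i v) where
  one_le := hs.one_le
  room := hs.room
  reg := hs.reg
  arr b j := by
    simp only [State.setArr, Function.update_apply]
    split_ifs
    · rw [Function.update_apply]
      split_ifs
      exacts [hv, hs.arr a j]
    · exact hs.arr b j

@[simp] theorem State.setReg_arr (s : State) (x v : ℕ) : (s.setReg x v).arr = s.arr := rfl

@[simp] theorem State.setArr_reg (s : State) (a i v : ℕ) : (s.setArr a i v).reg = s.reg := rfl

@[simp] theorem State.setReg_reg (s : State) (x v y : ℕ) :
    (s.setReg x v).reg y = if y = x then v else s.reg y := by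
  simp [State.setReg, Function.update_apply]

@[simp] theorem State.setArr_arr (s : State) (a i v b : ℕ) :
    (s.setArr a i v).arr b = if b = a then Function.update (s.arr a) i v else s.arr b := by
  simp [State.setArr, Function.update_apply]

namespace Prog

/-- The registers that a program writes to. -/
def regs : Prog → List ℕ
  | skip => []
  | assign x _ => [x]
  | store _ _ _ => []
  | seq P Q => P.regs ++ Q.regs
  | ite _ P Q => P.regs ++ Q.regs
  | loop _ P => P.regs

/-- The arrays that a program writes to. -/
def arrs : Prog → List ℕ
  | skip => []
  | assign _ _ => []
  | store a _ _ => [a]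
  | seq P Q => P.arrs ++ Q.arrs
  | ite _ P Q => P.arrs ++ Q.arrs
  | loop _ P => P.arrs

/-- All expressions in the program are small. -/
def Small : Prog → Bool
  | skip => true
  | assign _ e => e.Small
  | store _ i e => i.Small && e.Small
  | seq P Q => P.Small && Q.Small
  | ite e P Q => e.Small && P.Small && Q.Small
  | loop e P => e.Small && P.Small

/-- The worst-case running time of a program without loops. -/
def time : Prog → ℕ
  | skip => 1
  | assign _ e => e.cost + 1
  | store _ i e => i.cost + e.cost + 1
  | seq P Q => P.time + Q.time
  | ite e P Q => e.cost + 1 + max P.time Q.time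
  | loop _ _ => 0

/-- The weakest precondition of a program without loops, if values are to be bounded by `B`. -/
def wp (B : ℕ) : Prog → (State → Prop) → State → Prop
  | skip, R, s => R s
  | assign x e, R, s => (e.coef ≤ 1 ∨ e.eval s ≤ B) ∧ R (s.setReg x (e.eval s))
  | store a i e, R, s =>
    (e.coef ≤ 1 ∨ e.eval s ≤ B) ∧ R (s.setArr a (i.eval s) (e.eval s))
  | seq P Q, R, s => P.wp B (Q.wp B R) s
  | ite e P Q, R, s => (e.eval s ≠ 0 → P.wp B R s) ∧ (e.eval s = 0 → Q.wp B R s)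
  | loop _ _, _, _ => False

end Prog

/-- `s'` differs from `s` only in registers and arrays that `P` writes to. -/
structure Frame (P : Prog) (s s' : State) : Prop where
  reg : ∀ x, x ∉ P.regs → s'.reg x = s.reg x
  arr : ∀ a, a ∉ P.arrs → s'.arr a = s.arr a

theorem Exec.frame {w : ℕ} {P : Prog} {s s' : State} {t : ℕ} (h : Exec w P s s' t) :
    Frame P s s' := by
  induction h with
  | skip s => exact ⟨fun _ _ => rfl, fun _ _ => rfl⟩
  | assign s x e he =>
    refine ⟨fun y hy => ?_, fun _ _ => rfl⟩
    simp only [Prog.regs, List.mem_singleton] at hy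
    simp [hy]
  | store s a i e hi he =>
    refine ⟨fun _ _ => rfl, fun b hb => ?_⟩
    simp only [Prog.arrs, List.mem_singleton] at hb
    simp [hb]
  | seq s s' s'' P Q t t' hP hQ ihP ihQ =>
    refine ⟨fun y hy => ?_, fun b hb => ?_⟩
    · simp only [Prog.regs, List.mem_append, not_or] at hy
      rw [ihQ.reg y hy.2, ihP.reg y hy.1]
    · simp only [Prog.arrs, List.mem_append, not_or] at hb
      rw [ihQ.arr b hb.2, ihP.arr b hb.1]
  | iteTrue s s' e P Q t he h hP ih =>
    refine ⟨fun y hy => ?_, fun b hb => ?_⟩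
    · simp only [Prog.regs, List.mem_append, not_or] at hy
      rw [ih.reg y hy.1]
    · simp only [Prog.arrs, List.mem_append, not_or] at hb
      rw [ih.arr b hb.1]
  | iteFalse s s' e P Q t he h hP ih =>
    refine ⟨fun y hy => ?_, fun b hb => ?_⟩
    · simp only [Prog.regs, List.mem_append, not_or] at hy
      rw [ih.reg y hy.2]
    · simp only [Prog.arrs, List.mem_append, not_or] at hb
      rw [ih.arr b hb.2]
  | loopFalse s e P he h => exact ⟨fun _ _ => rfl, fun _ _ => rfl⟩
  | loopTrue s s' s'' e P t t' he h hP hL ih ihL =>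
    exact ⟨fun y hy => (ihL.reg y hy).trans (ih.reg y hy),
      fun b hb => (ihL.arr b hb).trans (ih.arr b hb)⟩

/-- Started in `s` with `k` units of time, the program halts in a state `s'` with `k'` units of time
left such that `Q s' k'`. All values are bounded by `B` throughout. -/
def Run (w B : ℕ) (P : Prog) (Q : State → ℕ → Prop) (s : State) (k : ℕ) : Prop :=
  Mach w B s → ∃ s' t k', Exec w P s s' t ∧ t + k' ≤ k ∧ Mach w B s' ∧ Q s' k'

namespace Run

variable {w B : ℕ} {P P' : Prog} {Q R : State → ℕ → Prop} {s : State} {k : ℕ}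

theorem mono (h : Run w B P Q s k) (hQ : ∀ s' k', Frame P s s' → Mach w B s' → Q s' k' → R s' k') :
    Run w B P R s k := by
  intro hs
  obtain ⟨s', t, k', he, hk, hm, hq⟩ := h hs
  exact ⟨s', t, k', he, hk, hm, hQ _ _ he.frame hm hq⟩

theorem seq (h : Run w B P (fun s' k' => Run w B P' Q s' k') s k) :
    Run w B (P ;; P') Q s k := by
  intro hs
  obtain ⟨s', t, k', he, hk, hm, hq⟩ := h hs
  obtain ⟨s'', t', k'', he', hk', hm', hq'⟩ := hq hm
  exact ⟨s'', t + t', k'', .seq _ _ _ _ _ _ _ he he', by omega, hm', hq'⟩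

theorem then_ (h : Run w B P R s k)
    (h' : ∀ s' k', Frame P s s' → Mach w B s' → R s' k' → Run w B P' Q s' k') :
    Run w B (P ;; P') Q s k :=
  seq (h.mono h')

theorem exec_of_wp (w B : ℕ) : ∀ (P : Prog) (R : State → Prop) (s : State), P.Small = true →
    Mach w B s → P.wp B R s → ∃ s' t, Exec w P s s' t ∧ t ≤ P.time ∧ Mach w B s' ∧ R s'
  | .skip, R, s, _, hm, h => ⟨s, 1, .skip s, le_rfl, hm, h⟩
  | .assign x e, R, s, hS, hm, h => by
    refine ⟨_, _, .assign s x e (e.fits hm hS), le_rfl, hm.setReg x ?_, h.2⟩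
    rcases h.1 with h1 | h1
    · exact (e.eval_le hm hS).trans (by nlinarith)
    · exact h1
  | .store a i e, R, s, hS, hm, h => by
    simp only [Prog.Small, Bool.and_eq_true] at hS
    refine ⟨_, _, .store s a i e (i.fits hm hS.1) (e.fits hm hS.2), le_rfl, hm.setArr a _ ?_, h.2⟩
    rcases h.1 with h1 | h1
    · exact (e.eval_le hm hS.2).trans (by nlinarith)
    · exact h1
  | .seq P P', R, s, hS, hm, h => by
    simp only [Prog.Small, Bool.and_eq_true] at hS
    obtain ⟨s', t, he, ht, hm', h'⟩ := exec_of_wp w B P _ s hS.1 hm h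
    obtain ⟨s'', t', he', ht', hm'', h''⟩ := exec_of_wp w B P' _ s' hS.2 hm' h'
    exact ⟨s'', _, .seq _ _ _ _ _ _ _ he he', Nat.add_le_add ht ht', hm'', h''⟩
  | .ite e P P', R, s, hS, hm, h => by
    simp only [Prog.Small, Bool.and_eq_true] at hS
    by_cases h0 : e.eval s = 0
    · obtain ⟨s', t, he, ht, hm', h'⟩ := exec_of_wp w B P' _ s hS.2 hm (h.2 h0)
      exact ⟨s', _, .iteFalse _ _ _ _ _ _ (e.fits hm hS.1.1) h0 he,
        Nat.add_le_add_left (ht.trans (le_max_right _ _)) _, hm', h'⟩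
    · obtain ⟨s', t, he, ht, hm', h'⟩ := exec_of_wp w B P _ s hS.1.2 hm (h.1 h0)
      exact ⟨s', _, .iteTrue _ _ _ _ _ _ (e.fits hm hS.1.1) h0 he,
        Nat.add_le_add_left (ht.trans (le_max_left _ _)) _, hm', h'⟩
  | .loop _ _, _, _, _, _, h => h.elim

theorem of_wp (hS : P.Small = true) (hk : P.time ≤ k)
    (h : Mach w B s → P.wp B (fun s' => Q s' (k - P.time)) s) : Run w B P Q s k := by
  intro hs
  obtain ⟨s', t, he, ht, hm, hq⟩ := exec_of_wp w B P _ s hS hs (h hs)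
  exact ⟨s', t, _, he, by omega, hm, hq⟩

theorem loop {e : Expr} (Φ : State → ℕ → Prop) (hS : e.Small = true)
    (h : ∀ s' k', Frame (.loop e P) s s' → Mach w B s' → Φ s' k' →
      e.cost + 1 ≤ k' ∧ (e.eval s' = 0 → Q s' (k' - (e.cost + 1))) ∧
        (e.eval s' ≠ 0 → Run w B P Φ s' (k' - (e.cost + 1)))) (h0 : Φ s k) :
    Run w B (.loop e P) Q s k := by
  have key : ∀ k s', Frame (.loop e P) s s' → Φ s' k → Run w B (.loop e P) Q s' k := by
    intro k
    induction k using Nat.strong_induction_on with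
    | _ k ih =>
      intro s' hf hΦ hs
      obtain ⟨h1, h2, h3⟩ := h s' k hf hs hΦ
      by_cases h0 : e.eval s' = 0
      · exact ⟨s', _, _, .loopFalse _ _ _ (e.fits hs hS) h0, by omega, hs, h2 h0⟩
      · obtain ⟨s'', t, k'', he, hk, hm, hq⟩ := h3 h0 hs
        have hf' := he.frame
        obtain ⟨s3, t', k3, he3, hk3, hm3, hq3⟩ := ih k'' (by omega) s''
          ⟨fun x hx => (hf'.reg x hx).trans (hf.reg x hx),
            fun x hx => (hf'.arr x hx).trans (hf.arr x hx)⟩ hq hm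
        exact ⟨s3, _, k3, .loopTrue _ _ _ _ _ _ _ (e.fits hs hS) h0 he he3, by omega, hm3, hq3⟩
  exact key k s ⟨fun _ _ => rfl, fun _ _ => rfl⟩ h0

/-- A loop whose body has no loops and is repeated `m` times. -/
theorem iterate {e : Expr} (m : ℕ) (I : ℕ → State → Prop) (hS : e.Small = true)
    (hP : P.Small = true) (h0 : I 0 s)
    (hk : m * (P.time + e.cost + 1) + (e.cost + 1) ≤ k)
    (hI : ∀ j s', j ≤ m → Frame (.loop e P) s s' → Mach w B s' → I j s' →
      (e.eval s' ≠ 0 ↔ j < m) ∧ (j < m → P.wp B (I (j + 1)) s'))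
    (hQ : ∀ s', I m s' → Q s' (k - (m * (P.time + e.cost + 1) + (e.cost + 1)))) :
    Run w B (.loop e P) Q s k := by
  set c := P.time + e.cost + 1 with hc
  refine loop (fun s' k' => ∃ j ≤ m, I j s' ∧
    k' = k - (m * c + (e.cost + 1)) + (m - j) * c + (e.cost + 1)) hS ?_ ?_
  · rintro s' k' hf hm ⟨j, hj, hIj, rfl⟩
    obtain ⟨h1, h2⟩ := hI j s' hj hf hm hIj
    refine ⟨by omega, fun h => ?_, fun h => ?_⟩
    · have : j = m := by
        by_contra hne
        exact (h1.2 (by omega)) h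
      subst this
      simpa using hQ s' hIj
    · have hlt := h1.1 h
      have e1 : (m - j) * c = (m - (j + 1)) * c + c := by
        rw [← Nat.succ_mul]; congr 1; omega
      refine Run.of_wp hP (by omega) fun hm => ?_
      have := h2 hlt
      refine wp_mono B P _ _ (fun s'' h'' => ⟨j + 1, hlt, h'', by omega⟩) s' this
  · exact ⟨0, Nat.zero_le _, h0, by simp only [Nat.sub_zero]; omega⟩
where
  wp_mono (B : ℕ) : ∀ (P : Prog) (R R' : State → Prop), (∀ s, R s → R' s) → ∀ s, P.wp B R s →
      P.wp B R' s
  | .skip, _, _, h, s => h s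
  | .assign _ _, _, _, h, _ => fun h' => ⟨h'.1, h _ h'.2⟩
  | .store _ _ _, _, _, h, _ => fun h' => ⟨h'.1, h _ h'.2⟩
  | .seq P P', _, _, h, s => wp_mono B P _ _ (wp_mono B P' _ _ h) s
  | .ite _ P P', _, _, h, s => fun h' =>
    ⟨fun h1 => wp_mono B P _ _ h s (h'.1 h1), fun h1 => wp_mono B P' _ _ h s (h'.2 h1)⟩
  | .loop _ _, _, _, _, _ => id

end Run

end WordRAM

/-! ### Linked lists and buckets -/

/-- The array `next` stores the list `l`, whose head is given by `h`; pointers are shifted by one,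
and `0` marks the end of the list. -/
def IsLinkedList (next : ℕ → ℕ) : ℕ → List ℕ → Prop
  | h, [] => h = 0
  | h, e :: l => h = e + 1 ∧ IsLinkedList next (next e) l

theorem IsLinkedList.update {next : ℕ → ℕ} {e x : ℕ} :
    ∀ {l : List ℕ} {h : ℕ}, e ∉ l → IsLinkedList next h l →
      IsLinkedList (Function.update next e x) h l
  | [], _, _, hl => hl
  | a :: l, _, he, hl => by
    simp only [List.mem_cons, not_or] at he
    refine ⟨hl.1, ?_⟩
    rw [Function.update_of_ne (Ne.symm he.1)]
    exact hl.2.update he.2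

/-- The elements of `D` are distributed to linked lists according to their keys, with decreasing
ranks in every list. -/
def Buckets (key rk : ℕ → ℕ) (D : Finset ℕ) (next head : ℕ → ℕ) : Prop :=
  ∀ u, ∃ l : List ℕ, IsLinkedList next (head u) l ∧ l.Nodup ∧ (∀ e, e ∈ l ↔ e ∈ D ∧ key e = u) ∧
    l.Pairwise fun e e' => rk e' ≤ rk e

theorem Buckets.empty {key rk next head : ℕ → ℕ} (h : ∀ u, head u = 0) :
    Buckets key rk ∅ next head :=
  fun u => ⟨[], h u, List.nodup_nil, by simp, List.Pairwise.nil⟩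

theorem Buckets.insert {key rk next head : ℕ → ℕ} {D : Finset ℕ} (h : Buckets key rk D next head)
    {e : ℕ} (he : e ∉ D) (hr : ∀ e' ∈ D, rk e' ≤ rk e) :
    Buckets key rk (insert e D) (Function.update next e (head (key e)))
      (Function.update head (key e) (e + 1)) := by
  intro u
  obtain ⟨l, h1, h2, h3, h4⟩ := h u
  have hel : e ∉ l := fun h => he ((h3 e).1 h).1
  by_cases hu : u = key e
  · subst hu
    refine ⟨e :: l, ⟨by simp, ?_⟩, List.nodup_cons.2 ⟨hel, h2⟩, fun a => ?_,
      List.pairwise_cons.2 ⟨fun a ha => hr a ((h3 a).1 ha).1, h4⟩⟩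
    · rw [Function.update_self]
      exact h1.update hel
    · rw [List.mem_cons, h3, Finset.mem_insert]
      constructor
      · rintro (rfl | h)
        exacts [⟨.inl rfl, rfl⟩, ⟨.inr h.1, h.2⟩]
      · rintro ⟨rfl | h, h'⟩
        exacts [.inl rfl, .inr ⟨h, h'⟩]
  · refine ⟨l, ?_, h2, fun a => ?_, h4⟩
    · rw [Function.update_of_ne hu]
      exact h1.update hel
    · rw [h3, Finset.mem_insert]
      constructor
      · exact fun h => ⟨.inr h.1, h.2⟩
      · rintro ⟨rfl | h, h'⟩
        exacts [(hu h'.symm).elim, ⟨h, h'⟩]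

/-! ### Segment trees with sharing -/

/-- The node `id` of a directed acyclic graph of segment tree nodes represents the set `S` on the
interval `[a, a + 2 ^ l)`. The children of a node are found in the slots `2 * id` and `2 * id + 1`
of the array `c`, the node `W + i` is the leaf at position `i`, and `0` is the empty tree. -/
def SegTree (c : ℕ → ℕ) (W m : ℕ) : ℕ → ℕ → ℕ → Set ℕ → Prop
  | 0, a, id, S => id = 0 ∧ a ∉ S ∨ id = W + a ∧ id < m ∧ a ∈ S
  | l + 1, a, id, S => (id = 0 ∧ ∀ y, a ≤ y → y < a + 2 ^ (l + 1) → y ∉ S) ∨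
    (0 < id ∧ id < m ∧ (id < W ∨ 2 * W ≤ id) ∧ SegTree c W m l a (c (2 * id)) S ∧
      SegTree c W m l (a + 2 ^ l) (c (2 * id + 1)) S)

namespace SegTree

variable {c c' : ℕ → ℕ} {W m m' : ℕ}

theorem congr : ∀ {l a id : ℕ} {S S' : Set ℕ}, SegTree c W m l a id S →
    (∀ y, a ≤ y → y < a + 2 ^ l → (y ∈ S ↔ y ∈ S')) → SegTree c W m l a id S'
  | 0, a, id, S, S', h, hS => by
    have := hS a le_rfl (by simp)
    simpa only [SegTree, this] using h
  | l + 1, a, id, S, S', h, hS => by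
    rw [pow_succ] at hS
    rcases h with ⟨h, h'⟩ | ⟨h1, h2, h3, h4, h5⟩
    · refine .inl ⟨h, fun y hy hy' => ?_⟩
      rw [← hS y hy (by rw [pow_succ] at hy'; exact hy')]
      exact h' y hy hy'
    · exact .inr ⟨h1, h2, h3, h4.congr fun y hy hy' => hS y hy (by omega),
        h5.congr fun y hy hy' => hS y (by omega) (by omega)⟩

theorem mono (hc : ∀ j < 2 * m, c' j = c j) (hm : m ≤ m') :
    ∀ {l a id : ℕ} {S : Set ℕ}, SegTree c W m l a id S → SegTree c' W m' l a id S
  | 0, a, id, S, h => by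
    rcases h with h | h
    exacts [.inl h, .inr ⟨h.1, by omega, h.2.2⟩]
  | l + 1, a, id, S, h => by
    rcases h with h | ⟨h1, h2, h3, h4, h5⟩
    · exact .inl h
    · refine .inr ⟨h1, by omega, h3, ?_, ?_⟩
      · rw [hc _ (by omega)]; exact h4.mono hc hm
      · rw [hc _ (by omega)]; exact h5.mono hc hm

theorem lt (hm : 0 < m) : ∀ {l a id : ℕ} {S : Set ℕ}, SegTree c W m l a id S → id < m
  | 0, a, id, S, h => by rcases h with h | h <;> omega
  | l + 1, a, id, S, h => by rcases h with h | h <;> omega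

theorem zero : ∀ {l a : ℕ} {S : Set ℕ}, (∀ y, a ≤ y → y < a + 2 ^ l → y ∉ S) →
    SegTree c W m l a 0 S
  | 0, a, S, h => .inl ⟨rfl, h a le_rfl (by simp)⟩
  | l + 1, a, S, h => .inl ⟨rfl, h⟩

theorem left (h0 : c 0 = 0) {l a id : ℕ} {S : Set ℕ} (h : SegTree c W m (l + 1) a id S) :
    SegTree c W m l a (c (2 * id)) S := by
  rcases h with ⟨rfl, h⟩ | ⟨h1, h2, h3, h4, h5⟩
  · rw [mul_zero, h0]
    exact zero fun y hy hy' => h y hy (by rw [pow_succ]; omega)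
  · exact h4

theorem right (h1 : c 1 = 0) {l a id : ℕ} {S : Set ℕ} (h : SegTree c W m (l + 1) a id S) :
    SegTree c W m l (a + 2 ^ l) (c (2 * id + 1)) S := by
  rcases h with ⟨rfl, h⟩ | ⟨h1, h2, h3, h4, h5⟩
  · rw [mul_zero, zero_add, h1]
    exact zero fun y hy hy' => h y (by omega) (by rw [pow_succ]; omega)
  · exact h5

/-- The perfect binary tree, stored as a heap. -/
theorem heap {L : ℕ} (hW : W = 2 ^ L) (hm : 2 * W ≤ m) (hc : ∀ j, 2 ≤ j → j < 2 * W → c j = j) :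
    ∀ l ≤ L, ∀ i < 2 ^ (L - l), SegTree c W m l (i * 2 ^ l) (2 ^ (L - l) + i) Set.univ
  | 0, _, i, hi => by
    refine .inr ⟨by simp [hW], ?_, trivial⟩
    simp only [Nat.sub_zero] at hi ⊢
    omega
  | l + 1, hl, i, hi => by
    have e1 : 2 ^ (L - l) = 2 * 2 ^ (L - (l + 1)) := by rw [← pow_succ']; congr 1; omega
    have e2 : W = 2 ^ (L - (l + 1)) * 2 ^ l * 2 := by
      rw [hW, ← pow_add, ← pow_succ]; congr 1; omega
    have h1 := heap hW hm hc l (by omega) (2 * i) (by omega)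
    have h2 := heap hW hm hc l (by omega) (2 * i + 1) (by omega)
    have hp : 0 < 2 ^ (L - (l + 1)) := by positivity
    have hp' : 0 < 2 ^ l := by positivity
    have hle : 2 ^ (L - (l + 1)) * 2 ≤ W := by
      rw [e2]; exact Nat.mul_le_mul_right 2 (Nat.le_mul_of_pos_right _ hp')
    refine .inr ⟨by omega, by omega, .inl (by omega), ?_, ?_⟩
    · rw [hc _ (by omega) (by omega)]
      convert h1 using 1
      · ring
      · rw [e1]; ring
    · rw [hc _ (by omega) (by omega)]
      convert h2 using 1
      · ring
      · rw [e1]; ring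

theorem heap_root {L : ℕ} (hW : W = 2 ^ L) (hm : 2 * W ≤ m)
    (hc : ∀ j, 2 ≤ j → j < 2 * W → c j = j) : SegTree c W m L 0 1 Set.univ := by
  simpa using heap hW hm hc L le_rfl 0 (by simp)

/-- In a set of nodes that is closed under taking children, the leaves below a node of the set
belong to the set, too. -/
theorem leaf_mem {X : Set ℕ}
    (hX : ∀ id ∈ X, 0 < id → (id < W ∨ 2 * W ≤ id) → c (2 * id) ∈ X ∧ c (2 * id + 1) ∈ X) :
    ∀ {l a id : ℕ} {S : Set ℕ}, SegTree c W m l a id S → id ∈ X →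
      ∀ y ∈ S, a ≤ y → y < a + 2 ^ l → W + y ∈ X
  | 0, a, id, S, h, hid, y, hy, hay, hya => by
    have : y = a := by simp at hya; omega
    subst this
    rcases h with h | h
    exacts [(h.2 hy).elim, h.1 ▸ hid]
  | l + 1, a, id, S, h, hid, y, hy, hay, hya => by
    rw [pow_succ] at hya
    rcases h with h | ⟨h1, h2, h3, h4, h5⟩
    · exact (h.2 y hay (by rw [pow_succ]; omega) hy).elim
    · by_cases hlt : y < a + 2 ^ l
      · exact h4.leaf_mem hX (hX id hid h1 h3).1 y hy hay hlt
      · exact h5.leaf_mem hX (hX id hid h1 h3).2 y hy (by omega) (by omega)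

end SegTree

/-! ### Leaf intervals in rooted trees -/

namespace RootedTree

variable {T : RootedTree}

theorem covBy_iff_pred {t c : T} : t ⋖ c ↔ c ≠ ⊥ ∧ Order.pred c = t := by
  constructor
  · intro h
    refine ⟨fun h0 => not_lt_bot (h0 ▸ h.lt), ?_⟩
    have h1 := Order.le_pred_of_lt h.lt
    have h2 : Order.pred c < c := Order.pred_lt_of_not_isMin (fun hm => hm.not_lt h.lt)
    exact (eq_of_le_of_not_lt h1 fun h3 => h.2 h3 h2).symm
  · rintro ⟨h, rfl⟩
    exact Order.pred_covBy_of_not_isMin (by simpa using h)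

theorem pred_covBy {c : T} (h : c ≠ ⊥) : Order.pred c ⋖ c := covBy_iff_pred.2 ⟨h, rfl⟩

theorem covBy_unique {t t' c : T} (h : t ⋖ c) (h' : t' ⋖ c) : t = t' :=
  (covBy_iff_pred.1 h).2.symm.trans (covBy_iff_pred.1 h').2

/-- Induction from a node towards the leaves. -/
theorem le_induction {p : T → Prop} {a : T} (h0 : p a)
    (h1 : ∀ t c, a ≤ t → t ⋖ c → p t → p c) {y : T} (hy : a ≤ y) : p y := by
  obtain ⟨n, hn⟩ := exists_pred_iterate_of_le hy
  induction n generalizing y with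
  | zero => exact (show y = a from hn) ▸ h0
  | succ n ih =>
    rw [Function.iterate_succ_apply] at hn
    have hle : a ≤ Order.pred y := hn ▸ Order.pred_iterate_le n _
    have := ih hle hn
    by_cases hb : y = ⊥
    · subst hb; simpa using this
    · exact h1 _ _ hle (pred_covBy hb) this

theorem exists_covBy_le {t u : T} (h : t < u) : ∃ c, t ⋖ c ∧ c ≤ u := by
  have : t = u ∨ ∃ c, t ⋖ c ∧ c ≤ u := by
    refine le_induction (p := fun u => t = u ∨ ∃ c, t ⋖ c ∧ c ≤ u) (.inl rfl) ?_ h.le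
    rintro x y - hxy (rfl | ⟨c, hc, hcx⟩)
    · exact .inr ⟨y, hxy, le_rfl⟩
    · exact .inr ⟨c, hc, hcx.trans hxy.le⟩
  exact this.resolve_left h.ne

/-- A layout assigns to every node the interval `[lo t, lo t + size t)`, such that the leaves
receive distinct positions and every node receives the interval of the leaves below it. -/
structure IsLayout (T : RootedTree) (n : ℕ) (lo size : T → ℕ) : Prop where
  leaf : ∀ t : T, IsMax t → size t = 1
  child : ∀ t c : T, t ⋖ c → lo t ≤ lo c ∧ lo c + size c ≤ lo t + size t
  sibling : ∀ t c c' : T, t ⋖ c → t ⋖ c' → c ≠ c' →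
    lo c + size c ≤ lo c' ∨ lo c' + size c' ≤ lo c
  root : lo ⊥ + size ⊥ ≤ n

namespace IsLayout

variable {n : ℕ} {lo size : T → ℕ}

theorem nested (h : IsLayout T n lo size) {t u : T} (htu : t ≤ u) :
    lo t ≤ lo u ∧ lo u + size u ≤ lo t + size t := by
  refine le_induction (p := fun u => lo t ≤ lo u ∧ lo u + size u ≤ lo t + size t)
    ⟨le_rfl, le_rfl⟩ (fun x c _ hxc ih => ?_) htu
  have := h.child x c hxc
  omega

theorem le_bound (h : IsLayout T n lo size) (t : T) : lo t + size t ≤ n :=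
  (h.nested bot_le).2.trans h.root

theorem lo_lt (h : IsLayout T n lo size) {y : T} (hy : IsMax y) : lo y < n := by
  have := h.le_bound y
  rw [h.leaf y hy] at this
  omega

theorem le_leaf_iff (h : IsLayout T n lo size) {u y : T} (hy : IsMax y) :
    u ≤ y ↔ lo u ≤ lo y ∧ lo y < lo u + size u := by
  have h1 := h.leaf y hy
  constructor
  · intro huy
    have := h.nested huy
    omega
  · rintro ⟨h2, h3⟩
    by_contra huy
    have hyu : ¬ y ≤ u := fun hyu => huy (hy hyu)
    obtain ⟨c, hc, hcu⟩ := exists_covBy_le (lt_of_le_of_ne (inf_le_left : u ⊓ y ≤ u)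
      fun he => huy (inf_eq_left.1 he))
    obtain ⟨d, hd, hdy⟩ := exists_covBy_le (lt_of_le_of_ne (inf_le_right : u ⊓ y ≤ y)
      fun he => hyu (inf_eq_right.1 he))
    have hne : c ≠ d := by
      rintro rfl
      exact hc.lt.not_ge (le_inf hcu hdy)
    have h4 := h.nested hcu
    have h5 := h.nested hdy
    have := h.sibling _ c d hc hd hne
    omega

theorem lo_inj (h : IsLayout T n lo size) {x y : T} (hx : IsMax x) (hy : IsMax y)
    (hxy : lo x = lo y) : x = y :=
  hx.eq_of_le ((h.le_leaf_iff hy).2 (by rw [hxy, h.leaf x hx]; omega))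

end IsLayout

theorem card_add_one_of_full {N n : ℕ} (hT : T.IsFullBinary) (node : T ≃ Fin N)
    (leaf : Fin n ≃ T.Leaf) : N + 1 = 2 * n := by
  classical
  let : Fintype T := Fintype.ofEquiv _ node.symm
  have hN : Fintype.card T = N := by simpa using Fintype.card_congr node
  have hn : (Finset.univ.filter fun t : T => IsMax t).card = n := by
    rw [← Fintype.card_subtype]
    simpa using (Fintype.card_congr leaf).symm
  have h1 : (Finset.univ.erase (⊥ : T)).card =
      ∑ t : T, ((Finset.univ.erase (⊥ : T)).filter fun c => Order.pred c = t).card :=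
    Finset.card_eq_sum_card_fiberwise (fun _ _ => by simp)
  have h2 : ∀ t : T, ((Finset.univ.erase (⊥ : T)).filter fun c => Order.pred c = t).card =
      if IsMax t then 0 else 2 := by
    intro t
    have e : (((Finset.univ.erase (⊥ : T)).filter fun c => Order.pred c = t : Finset T) : Set T) =
        {c : T | t ⋖ c} := by
      ext c; simp [covBy_iff_pred]
    rw [← Set.ncard_coe_finset, e]
    split_ifs with ht
    · have : {c : T | t ⋖ c} = ∅ := by
        ext c
        simpa using fun hc : t ⋖ c => ht.not_lt hc.lt
      simp [this]
    · exact (hT t).resolve_left ht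
  rw [Finset.card_erase_of_mem (Finset.mem_univ _), Finset.card_univ, hN] at h1
  simp only [h2] at h1
  rw [Finset.sum_ite] at h1
  simp only [Finset.sum_const_zero, zero_add, Finset.sum_const, smul_eq_mul] at h1
  have h3 := Finset.card_filter_add_card_filter_not (s := (Finset.univ : Finset T))
    (fun t : T => IsMax t)
  rw [hn, Finset.card_univ, hN] at h3
  have hpos : 0 < N := by
    rw [← hN]; exact Fintype.card_pos_iff.2 ⟨⊥⟩
  omega

/-! ### Peeling a full binary tree from the leaves -/

open Classical in
/-- The queue `q` lists the nodes of a full binary tree from the leaves to the root. Its first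
`h` nodes have been processed, `tail` nodes have been enqueued; `cnt` counts the children that have
been processed, `size` the leaves below them, `off` those below the first of two siblings. -/
structure Peel [Fintype T] (ix : T → ℕ) (n h tail : ℕ) (q cnt size off : ℕ → ℕ) : Prop where
  le : h ≤ tail
  queue : ∀ j < tail, ∃ t, q j = ix t
  inj : ∀ i < tail, ∀ j < tail, q i = q j → i = j
  queued : ∀ t, (∃ j < tail, q j = ix t) ↔ ∀ c, t ⋖ c → ∃ j < h, q j = ix c
  topo : ∀ j < tail, ∀ t c, q j = ix t → t ⋖ c → ∃ i < j, q i = ix c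
  cnt : ∀ t, cnt (ix t) = {c | t ⋖ c ∧ ∃ j < h, q j = ix c}.ncard
  sum : ∑ t : T, (if t = ⊥ ∨ ¬ ∃ j < h, q j = ix t then size (ix t) else 0) = n
  leaf : ∀ t, IsMax t → size (ix t) = 1
  bound : ∀ t c, t ⋖ c → (∃ j < h, q j = ix c) → off (ix c) + size (ix c) ≤ size (ix t)
  sibling : ∀ t c c', t ⋖ c → t ⋖ c' → c ≠ c' → (∃ j < h, q j = ix c) → (∃ j < h, q j = ix c') →
    off (ix c) + size (ix c) ≤ off (ix c') ∨ off (ix c') + size (ix c') ≤ off (ix c)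

namespace Peel

variable [Fintype T] {ix : T → ℕ} {n h tail : ℕ} {q cnt size off : ℕ → ℕ}

theorem size_le (P : Peel ix n h tail q cnt size off) {t : T}
    (ht : t = ⊥ ∨ ¬ ∃ j < h, q j = ix t) : size (ix t) ≤ n := by
  classical
  rw [← P.sum]
  refine le_trans ?_ (Finset.single_le_sum (fun _ _ => Nat.zero_le _) (Finset.mem_univ t))
  rw [if_pos ht]

theorem lt_tail (hix : Function.Injective ix) (P : Peel ix n h tail q cnt size off)
    (hh : h < Fintype.card T) : h < tail := by
  by_contra hle
  have he : h = tail := le_antisymm P.le (not_lt.1 hle)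
  subst he
  have all : ∀ t : T, ∃ j < h, q j = ix t := by
    intro t
    induction t using WellFoundedGT.induction with
    | _ t ih => exact (P.queued t).2 fun c hc => ih c hc.lt
  choose f hf hq using all
  have : Fintype.card T ≤ Fintype.card (Fin h) :=
    Fintype.card_le_of_injective (fun t => (⟨f t, hf t⟩ : Fin h)) fun a b hab => hix (by
      rw [← hq a, ← hq b]; simp only [Fin.mk.injEq] at hab; rw [hab])
  simp at this
  omega

theorem tail_le (P : Peel ix n h tail q cnt size off) :
    tail ≤ Fintype.card T := by
  have hq := P.queue
  choose f hf using hq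
  have : Fintype.card (Fin tail) ≤ Fintype.card T :=
    Fintype.card_le_of_injective (fun j : Fin tail => f j j.2) fun i j hij => by
      have : q i = q j := by rw [hf i i.2, hf j j.2]; exact congrArg ix hij
      exact Fin.ext (P.inj i i.2 j j.2 this)
  simpa using this

open Classical in
/-- The leaves form the initial queue. -/
theorem initial (hix : Function.Injective ix) (leaf : Fin n ≃ T.Leaf)
    (hq : ∀ i : Fin n, q i = ix (leaf i).1)
    (hcnt : ∀ t, cnt (ix t) = 0) (hs : ∀ t : T, size (ix t) = if IsMax t then 1 else 0) :
    Peel ix n 0 n q cnt size off where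
  le := Nat.zero_le _
  queue j hj := ⟨_, hq ⟨j, hj⟩⟩
  inj i hi j hj hij := by
    rw [hq ⟨i, hi⟩, hq ⟨j, hj⟩] at hij
    simpa using leaf.injective (Subtype.ext (hix hij))
  queued t := by
    constructor
    · rintro ⟨j, hj, he⟩ c hc
      rw [hq ⟨j, hj⟩] at he
      have := (leaf ⟨j, hj⟩).2
      rw [hix he] at this
      exact (this.not_lt hc.lt).elim
    · intro hc
      have ht : IsMax t := by
        by_contra hm
        obtain ⟨u, hu⟩ := not_isMax_iff.1 hm
        obtain ⟨c, hc', -⟩ := exists_covBy_le hu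
        obtain ⟨j, hj, -⟩ := hc c hc'
        omega
      refine ⟨leaf.symm ⟨t, ht⟩, Fin.is_lt _, ?_⟩
      rw [hq, Equiv.apply_symm_apply]
  topo j hj t c he hc := by
    rw [hq ⟨j, hj⟩] at he
    have := (leaf ⟨j, hj⟩).2
    rw [hix he] at this
    exact (this.not_lt hc.lt).elim
  cnt t := by simp [hcnt]
  sum := by
    classical
    have hn : (Finset.univ.filter fun t : T => IsMax t).card = n := by
      rw [← Fintype.card_subtype]
      simpa using (Fintype.card_congr leaf).symm
    simp only [not_lt_zero, false_and, exists_false, not_false_eq_true, or_true, if_true, hs]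
    rw [Finset.sum_ite, Finset.sum_const_zero, add_zero, Finset.sum_const, hn, smul_eq_mul, mul_one]
  leaf t ht := by rw [hs, if_pos ht]
  bound t c _ := by simp
  sibling t c c' _ _ _ := by simp

/-- Processing the root. -/
theorem step_root (hix : Function.Injective ix) (P : Peel ix n h tail q cnt size off)
    (hh : h < tail) (hq : q h = ix ⊥) : Peel ix n (h + 1) tail q cnt size off := by
  classical
  have key : ∀ c : T, c ≠ ⊥ → ((∃ j < h + 1, q j = ix c) ↔ ∃ j < h, q j = ix c) := by
    intro c hc
    constructor
    · rintro ⟨j, hj, he⟩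
      refine ⟨j, lt_of_le_of_ne (Nat.lt_succ_iff.1 hj) ?_, he⟩
      rintro rfl
      exact hc (hix (he.symm.trans hq))
    · rintro ⟨j, hj, he⟩
      exact ⟨j, by omega, he⟩
  have key' : ∀ t c : T, t ⋖ c → ((∃ j < h + 1, q j = ix c) ↔ ∃ j < h, q j = ix c) :=
    fun t c hc => key c (covBy_iff_pred.1 hc).1
  refine ⟨hh, P.queue, P.inj, fun t => ?_, P.topo, fun t => ?_, ?_, P.leaf, fun t c hc => ?_,
    fun t c c' hc hc' hne => ?_⟩
  · rw [P.queued]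
    exact forall₂_congr fun c hc => (key' t c hc).symm
  · rw [P.cnt]
    congr 1
    ext c
    exact and_congr_right fun hc => (key' t c hc).symm
  · rw [← P.sum]
    refine Finset.sum_congr rfl fun t _ => ?_
    by_cases ht : t = ⊥
    · simp [ht]
    · exact if_congr (or_congr_right (not_congr (key t ht))) rfl rfl
  · rw [key' t c hc]; exact P.bound t c hc
  · rw [key' t c hc, key' t c' hc']; exact P.sibling t c c' hc hc' hne

theorem not_processed (P : Peel ix n h tail q cnt size off) (hh : h < tail) {u : T}
    (hq : q h = ix u) : ¬ ∃ j < h, q j = ix u := by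
  rintro ⟨j, hj, he⟩
  have := P.inj j (by omega) h hh (he.trans hq.symm)
  omega

theorem parent_not_queued (P : Peel ix n h tail q cnt size off) (hh : h < tail) {u w : T}
    (hq : q h = ix u) (hwu : w ⋖ u) : ¬ ∃ j < tail, q j = ix w :=
  fun hw => P.not_processed hh hq ((P.queued w).1 hw u hwu)

theorem size_add_le (P : Peel ix n h tail q cnt size off) (hh : h < tail) {u w : T}
    (hq : q h = ix u) (hwu : w ⋖ u) : size (ix w) + size (ix u) ≤ n := by
  classical
  have hu := P.not_processed hh hq
  have hw := P.parent_not_queued hh hq hwu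
  have hw' : ¬ ∃ j < h, q j = ix w := fun ⟨j, hj, he⟩ => hw ⟨j, by have := P.le; omega, he⟩
  rw [← P.sum]
  refine le_trans ?_ (Finset.sum_le_sum_of_subset (Finset.subset_univ {w, u}))
  rw [Finset.sum_pair hwu.lt.ne, if_pos (.inr hw'), if_pos (.inr hu)]

theorem cnt_lt (hT : T.IsFullBinary) (P : Peel ix n h tail q cnt size off) (hh : h < tail) {u w : T}
    (hq : q h = ix u) (hwu : w ⋖ u) : cnt (ix w) < 2 := by
  have h2 : {c : T | w ⋖ c}.ncard = 2 := (hT w).resolve_left fun hm => hm.not_lt hwu.lt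
  rw [P.cnt, ← h2]
  refine Set.ncard_lt_ncard ⟨fun c hc => hc.1, fun hs => ?_⟩ (Set.toFinite _)
  exact P.not_processed hh hq (hs (show u ∈ {c : T | w ⋖ c} from hwu)).2

theorem exists_index (P : Peel ix n h tail q cnt size off) (hh : h = tail) (t : T) :
    ∃ j < tail, q j = ix t := by
  subst hh
  induction t using WellFoundedGT.induction with
  | _ t ih => exact (P.queued t).2 fun c hc => ih c hc.lt

theorem parent_index (P : Peel ix n h tail q cnt size off) (hh : h = tail) {i : ℕ} (hi : i < tail)
    {u w : T} (hq : q i = ix u) (hwu : w ⋖ u) : ∃ j, i < j ∧ j < tail ∧ q j = ix w := by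
  obtain ⟨j, hj, he⟩ := P.exists_index hh w
  obtain ⟨i', hi', he'⟩ := P.topo j hj w u he hwu
  have := P.inj i hi i' (by omega) (hq.trans he'.symm)
  exact ⟨j, by omega, hj, he⟩

theorem index_lt (P : Peel ix n h tail q cnt size off) (hh : h = tail) {i j : ℕ}
    (hi : i < tail) (hj : j < tail) {u t : T} (hqi : q i = ix u) (hqj : q j = ix t) (htu : t < u) :
    i < j := by
  have : ∀ u, t ≤ u → ∀ i < tail, q i = ix u → i ≤ j := by
    intro u htu
    refine le_induction (p := fun u => ∀ i < tail, q i = ix u → i ≤ j) ?_ ?_ htu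
    · exact fun i hi he => (P.inj i hi j hj (he.trans hqj.symm)).le
    · intro x c _ hxc ih i hi he
      obtain ⟨i', h1, h2, h3⟩ := P.parent_index hh hi he hxc
      exact h1.le.trans (ih i' h2 h3)
  have hne : u ≠ ⊥ := fun hb => not_lt_bot (hb ▸ htu)
  obtain ⟨i', h1, h2, h3⟩ := P.parent_index hh hi hqi (pred_covBy hne)
  exact h1.trans_le (this _ (Order.le_pred_of_lt htu) i' h2 h3)

theorem isLayout (P : Peel ix n h tail q cnt size off) (hh : h = tail) {lo : ℕ → ℕ}
    (h0 : lo (ix ⊥) = 0) (h1 : ∀ t c, t ⋖ c → lo (ix c) = lo (ix t) + off (ix c)) :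
    T.IsLayout n (fun t => lo (ix t)) fun t => size (ix t) := by
  subst hh
  refine ⟨P.leaf, fun t c hc => ?_, fun t c c' hc hc' hne => ?_, ?_⟩
  · have := P.bound t c hc (P.exists_index rfl c)
    rw [h1 t c hc]
    omega
  · have := P.sibling t c c' hc hc' hne (P.exists_index rfl c) (P.exists_index rfl c')
    rw [h1 t c hc, h1 t c' hc']
    omega
  · rw [h0, zero_add]
    exact P.size_le (.inl rfl)

/-- Processing a node other than the root. -/
theorem step (hT : T.IsFullBinary) (hix : Function.Injective ix)
    (P : Peel ix n h tail q cnt size off) (hh : h < tail) {u w : T} (hq : q h = ix u)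
    (hwu : w ⋖ u) {q' : ℕ → ℕ} {tail' : ℕ} (hq' : ∀ j < tail, q' j = q j)
    (ht : cnt (ix w) + 1 ≠ 2 ∧ tail' = tail ∨
      cnt (ix w) + 1 = 2 ∧ tail' = tail + 1 ∧ q' tail = ix w) :
    Peel ix n (h + 1) tail' q' (Function.update cnt (ix w) (cnt (ix w) + 1))
      (Function.update size (ix w) (size (ix w) + size (ix u)))
      (Function.update off (ix u) (size (ix w))) := by
  classical
  have hwne : w ≠ u := hwu.lt.ne
  have hpop : ∀ c : T, (∃ j < h + 1, q' j = ix c) ↔ (c = u ∨ ∃ j < h, q j = ix c) := by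
    intro c
    constructor
    · rintro ⟨j, hj, he⟩
      rw [hq' j (by omega)] at he
      rcases Nat.lt_succ_iff_lt_or_eq.1 hj with hj | rfl
      · exact .inr ⟨j, hj, he⟩
      · exact .inl (hix (he.symm.trans hq))
    · rintro (rfl | ⟨j, hj, he⟩)
      · exact ⟨h, by omega, by rw [hq' h hh, hq]⟩
      · exact ⟨j, by omega, by rw [hq' j (by omega), he]⟩
  have hu : ¬ ∃ j < h, q j = ix u := P.not_processed hh hq
  have hw : ¬ ∃ j < tail, q j = ix w := P.parent_not_queued hh hq hwu
  have hw' : ¬ ∃ j < h, q j = ix w := fun ⟨j, hj, he⟩ => hw ⟨j, by have := P.le; omega, he⟩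
  have hcs : {c : T | w ⋖ c ∧ ∃ j < h + 1, q' j = ix c} =
      insert u {c : T | w ⋖ c ∧ ∃ j < h, q j = ix c} := by
    ext c
    simp only [hpop, Set.mem_ofPred_eq, Set.mem_insert_iff]
    constructor
    · rintro ⟨h1, rfl | h2⟩
      exacts [.inl rfl, .inr ⟨h1, h2⟩]
    · rintro (rfl | ⟨h1, h2⟩)
      exacts [⟨hwu, .inl rfl⟩, ⟨h1, .inr h2⟩]
  have hcard : {c : T | w ⋖ c ∧ ∃ j < h + 1, q' j = ix c}.ncard = cnt (ix w) + 1 := by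
    rw [hcs, Set.ncard_insert_of_notMem (fun hm => hu hm.2) (Set.toFinite _), P.cnt]
  have hall : (∀ c, w ⋖ c → ∃ j < h + 1, q' j = ix c) ↔ cnt (ix w) + 1 = 2 := by
    have h2 : {c : T | w ⋖ c}.ncard = 2 := (hT w).resolve_left fun hm => hm.not_lt hwu.lt
    rw [← hcard, ← h2]
    constructor
    · intro hc
      congr 1
      ext c
      exact ⟨fun h => h.1, fun h => ⟨h, hc c h⟩⟩
    · intro he c hc
      have := Set.eq_of_subset_of_ncard_le (s := {c : T | w ⋖ c ∧ ∃ j < h + 1, q' j = ix c})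
        (t := {c : T | w ⋖ c}) (fun c hc => hc.1) he.ge (Set.toFinite _)
      exact (this.symm ▸ hc : c ∈ {c : T | w ⋖ c ∧ ∃ j < h + 1, q' j = ix c}).2
  have hothers : ∀ t c : T, t ≠ w → t ⋖ c →
      ((∃ j < h + 1, q' j = ix c) ↔ ∃ j < h, q j = ix c) := by
    intro t c htw hc
    rw [hpop]
    exact or_iff_right fun hcu => htw (covBy_unique (hcu ▸ hc) hwu)
  have hle : tail ≤ tail' := by omega
  have hcase : ∀ j < tail', j < tail ∨ j = tail ∧ q' j = ix w ∧ cnt (ix w) + 1 = 2 := by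
    rintro j hj
    rcases ht with h1 | h1
    · exact .inl (by omega)
    · rcases Nat.lt_or_ge j tail with h2 | h2
      · exact .inl h2
      · have : j = tail := by omega
        exact .inr ⟨this, this ▸ h1.2.2, h1.1⟩
  have hsz : ∀ t, t ≠ w → Function.update size (ix w) (size (ix w) + size (ix u)) (ix t) =
      size (ix t) := fun t htw => Function.update_of_ne (fun he => htw (hix he)) _ _
  have hof : ∀ t, t ≠ u → Function.update off (ix u) (size (ix w)) (ix t) = off (ix t) :=
    fun t htw => Function.update_of_ne (fun he => htw (hix he)) _ _
  refine ⟨by omega, fun j hj => ?_, fun i hi j hj hij => ?_, fun t => ?_, fun j hj t c he hc => ?_,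
    fun t => ?_, ?_, fun t hm => ?_, fun t c hc hp => ?_, fun t c c' hc hc' hne hp hp' => ?_⟩
  · rcases hcase j hj with h1 | h1
    · rw [hq' j h1]; exact P.queue j h1
    · exact ⟨w, h1.2.1⟩
  · rcases hcase i hi with h1 | h1 <;> rcases hcase j hj with h2 | h2
    · rw [hq' i h1, hq' j h2] at hij
      exact P.inj i h1 j h2 hij
    · rw [hq' i h1, h2.2.1] at hij
      exact (hw ⟨i, h1, hij⟩).elim
    · rw [hq' j h2, h1.2.1] at hij
      exact (hw ⟨j, h2, hij.symm⟩).elim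
    · omega
  · by_cases htw : t = w
    · subst htw
      rw [hall]
      constructor
      · rintro ⟨j, hj, he⟩
        rcases hcase j hj with h1 | h1
        · rw [hq' j h1] at he
          exact (hw ⟨j, h1, he⟩).elim
        · exact h1.2.2
      · intro h2
        have h3 := (ht.resolve_left fun h3 => h3.1 h2).2
        exact ⟨tail, by omega, h3.2⟩
    · rw [forall₂_congr fun c hc => hothers t c htw hc, ← P.queued]
      constructor
      · rintro ⟨j, hj, he⟩
        rcases hcase j hj with h1 | h1
        · exact ⟨j, h1, by rw [← hq' j h1, he]⟩
        · exact (htw (hix (he.symm.trans h1.2.1))).elim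
      · rintro ⟨j, hj, he⟩
        exact ⟨j, by omega, by rw [hq' j hj, he]⟩
  · rcases hcase j hj with h1 | h1
    · rw [hq' j h1] at he
      obtain ⟨i, hi, he'⟩ := P.topo j h1 t c he hc
      exact ⟨i, hi, by rw [hq' i (by omega), he']⟩
    · have : t = w := hix (he.symm.trans h1.2.1)
      subst this
      obtain ⟨i, hi, he'⟩ := hall.2 h1.2.2 c hc
      exact ⟨i, by omega, he'⟩
  · by_cases htw : t = w
    · subst htw
      rw [Function.update_self, hcard]
    · rw [Function.update_of_ne (fun he => htw (hix he)), P.cnt]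
      congr 1
      ext c
      exact and_congr_right fun hc => (hothers t c htw hc).symm
  · have hune : u ≠ ⊥ := (covBy_iff_pred.1 hwu).1
    have e1 : ∀ t : T, (if t = ⊥ ∨ ¬ ∃ j < h + 1, q' j = ix t then
        Function.update size (ix w) (size (ix w) + size (ix u)) (ix t) else 0) +
          (if t = u then size (ix u) else 0) =
        (if t = ⊥ ∨ ¬ ∃ j < h, q j = ix t then size (ix t) else 0) +
          (if t = w then size (ix u) else 0) := by
      intro t
      simp only [hpop]
      by_cases htu : t = u
      · subst htu
        simp [hu, hune, hwne.symm]
      · by_cases htw : t = w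
        · subst htw
          simp [hw', hwne]
        · simp [htu, htw, hsz t htw]
    have e2 := Finset.sum_congr (rfl : (Finset.univ : Finset T) = Finset.univ) fun t _ => e1 t
    rw [Finset.sum_add_distrib, Finset.sum_add_distrib, Finset.sum_ite_eq', Finset.sum_ite_eq',
      if_pos (Finset.mem_univ _), if_pos (Finset.mem_univ _), P.sum] at e2
    omega
  · have : t ≠ w := fun he => hm.not_lt (he ▸ hwu.lt)
    rw [hsz t this, P.leaf t hm]
  · have hsc : Function.update size (ix w) (size (ix w) + size (ix u)) (ix c) = size (ix c) := by
      apply hsz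
      rintro rfl
      rcases (hpop c).1 hp with h1 | h1
      exacts [hwne h1, hw' h1]
    rw [hsc]
    rcases (hpop c).1 hp with h1 | h1
    · subst h1
      have : t = w := covBy_unique hc hwu
      subst this
      simp
    · rw [hof c (fun he => hu (he ▸ h1))]
      have h3 := P.bound t c hc h1
      by_cases htw : t = w
      · subst htw
        rw [Function.update_self]
        omega
      · rwa [hsz t htw]
  · have hsc : ∀ c, (∃ j < h + 1, q' j = ix c) →
        Function.update size (ix w) (size (ix w) + size (ix u)) (ix c) = size (ix c) := by
      intro c hp
      apply hsz
      rintro rfl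
      rcases (hpop c).1 hp with h1 | h1
      exacts [hwne h1, hw' h1]
    rw [hsc c hp, hsc c' hp']
    rcases (hpop c).1 hp with h1 | h1 <;> rcases (hpop c').1 hp' with h2 | h2
    · exact (hne (h1.trans h2.symm)).elim
    · subst h1
      have : t = w := covBy_unique hc hwu
      subst this
      rw [hof c' hne.symm, Function.update_self]
      exact .inr (P.bound t c' hc' h2)
    · subst h2
      have : t = w := covBy_unique hc' hwu
      subst this
      rw [hof c hne, Function.update_self]
      exact .inl (P.bound t c hc h1)
    · rw [hof c (fun he => hu (he ▸ h1)), hof c' (fun he => hu (he ▸ h2))]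
      exact P.sibling t c c' hc hc' hne h1 h2

end Peel

end RootedTree

/-! ### Shortest-path trees from parent pointers -/

theorem exists_isShortestPathTree {n : ℕ} {G : SimpleGraph (Fin n)} {r : Fin n} {par : ℕ → ℕ}
    (h0 : par r = r)
    (h1 : ∀ u, G.Reachable r u → u ≠ r → ∃ w : Fin n, par u = w ∧ G.Adj w u ∧
      G.dist r w + 1 = G.dist r u)
    (h2 : ∀ u, ¬ G.Reachable r u → par u = n) :
    ∃ H : G.Subgraph, IsShortestPathTree G r H ∧ StoresRootedTree H r par := by
  classical
  have hex : ∀ u : {u : {u // G.Reachable r u} // u.1 ≠ r}, ∃ w : Fin n, par u.1.1 = w ∧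
      G.Adj w u.1.1 ∧ G.dist r w + 1 = G.dist r u.1.1 := fun u => h1 _ u.1.2 u.2
  choose f hf hadj hdist using hex
  let H : G.Subgraph :=
    { verts := {u | G.Reachable r u}
      Adj := fun a b => G.Adj a b ∧ G.Reachable r a ∧ G.Reachable r b ∧
        (b ≠ r ∧ par b = a ∨ a ≠ r ∧ par a = b)
      adj_sub := fun h => h.1
      edge_vert := fun h => h.2.1
      symm := ⟨fun a b h => ⟨h.1.symm, h.2.2.1, h.2.1, h.2.2.2.symm⟩⟩ }
  have hHadj : ∀ u (hu : G.Reachable r u) (hur : u ≠ r) (w : Fin n), par u = w → G.Adj w u →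
      H.Adj w u := fun u hu hur w hw ha => ⟨ha, hu.trans ha.symm.reachable, hu, .inl ⟨hur, hw⟩⟩
  have hwalk : ∀ d u, G.Reachable r u → G.dist r u = d →
      (∃ p : H.spanningCoe.Walk r u, p.length = d) ∧
      ∀ hu : u ∈ H.verts, H.coe.Reachable ⟨r, SimpleGraph.Reachable.refl r⟩ ⟨u, hu⟩ := by
    intro d
    induction d with
    | zero =>
      intro u hu hd
      have : r = u := (hu.dist_eq_zero_iff).1 hd
      subst this
      exact ⟨⟨.nil, rfl⟩, fun _ => SimpleGraph.Reachable.refl _⟩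
    | succ d ih =>
      intro u hu hd
      have hur : u ≠ r := by
        rintro rfl
        simp at hd
      obtain ⟨w, hw, ha, hdw⟩ := h1 u hu hur
      have hwr : G.Reachable r w := hu.trans ha.symm.reachable
      obtain ⟨⟨p, hp⟩, hc⟩ := ih w hwr (by omega)
      have hH := hHadj u hu hur w hw ha
      refine ⟨⟨p.concat (by simpa using hH), by simp [hp]⟩, fun hu' => ?_⟩
      refine (hc hwr).trans (SimpleGraph.Adj.reachable ?_)
      simpa using hH
  have hdistH : ∀ u, G.Reachable r u → H.spanningCoe.dist r u = G.dist r u := by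
    intro u hu
    obtain ⟨⟨p, hp⟩, -⟩ := hwalk _ u hu rfl
    refine le_antisymm ((SimpleGraph.dist_le p).trans hp.le) ?_
    obtain ⟨p', hp'⟩ := p.reachable.exists_walk_length_eq_dist
    rw [← hp', ← SimpleGraph.Walk.length_map (SimpleGraph.Hom.ofLE H.spanningCoe_le) p']
    exact SimpleGraph.dist_le _
  have hconn : H.coe.Connected := by
    rw [SimpleGraph.connected_iff_exists_forall_reachable]
    exact ⟨⟨r, SimpleGraph.Reachable.refl r⟩, fun u => (hwalk _ u.1 u.2 rfl).2 u.2⟩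
  refine ⟨H, ⟨?_, rfl, fun u hu => hdistH u hu⟩, ⟨h0, fun u hu hur => ?_, fun u hu => h2 u hu⟩⟩
  · rw [SimpleGraph.isTree_iff_connected_and_card]
    refine ⟨hconn, le_antisymm ?_ hconn.card_vert_le_card_edgeSet_add_one⟩
    let g : {u : {u // G.Reachable r u} // u.1 ≠ r} → H.coe.edgeSet := fun u =>
      ⟨s(⟨f u, u.1.2.trans (hadj u).symm.reachable⟩, ⟨u.1.1, u.1.2⟩), by
        have := hHadj u.1.1 u.1.2 u.2 _ (hf u) (hadj u)
        simpa using this⟩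
    have hg : Function.Surjective g := by
      rintro ⟨e, he⟩
      induction e with
      | _ a b =>
        have hab : H.Adj a b := by simpa using he
        obtain ⟨-, hra, hrb, h | h⟩ := hab
        · refine ⟨⟨⟨b.1, hrb⟩, h.1⟩, ?_⟩
          have : f ⟨⟨b.1, hrb⟩, h.1⟩ = a.1 := Fin.ext ((hf _).symm.trans h.2)
          apply Subtype.ext
          simp only [g, this]
        · refine ⟨⟨⟨a.1, hra⟩, h.1⟩, ?_⟩
          have : f ⟨⟨a.1, hra⟩, h.1⟩ = b.1 := Fin.ext ((hf _).symm.trans h.2)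
          apply Subtype.ext
          simp only [g, this]
          exact Sym2.eq_swap
    have h3 := Nat.card_le_card_of_surjective g hg
    have h4 : Nat.card {u : {u // G.Reachable r u} // u.1 ≠ r} + 1 = Nat.card H.verts := by
      have : Nat.card {u : {u // G.Reachable r u} // u.1 ≠ r} =
          Nat.card {u : {u // G.Reachable r u} // u ≠ ⟨r, SimpleGraph.Reachable.refl r⟩} :=
        Nat.card_congr (Equiv.subtypeEquivRight fun u => by simp [Subtype.ext_iff])
      rw [this]
      rw [Nat.card_eq_fintype_card, Fintype.card_subtype_compl, Fintype.card_subtype_eq]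
      change _ = Nat.card {u // G.Reachable r u}
      rw [Nat.card_eq_fintype_card]
      have : 0 < Fintype.card {u // G.Reachable r u} :=
        Fintype.card_pos_iff.2 ⟨⟨r, SimpleGraph.Reachable.refl r⟩⟩
      omega
    omega
  · obtain ⟨w, hw, ha, hdw⟩ := h1 u hu hur
    refine ⟨w, hw, hHadj u hu hur w hw ha, ?_⟩
    rw [hdistH u hu, hdistH w (SimpleGraph.Reachable.trans hu ha.symm.reachable), hdw]

/-! ### Neighbourhoods in a signed tree model -/

namespace SignedTreeModel

variable {T : RootedTree} (M : SignedTreeModel T)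

/-- The pair `u, y` of nodes is covered by a transversal edge. -/
def CoveredPos (u y : T) : Prop := ∃ u' v' : T, s(u', v') ∈ M.pos ∧ M.Covers u' v' u y

variable {M}

theorem not_coveredPos_bot {y : T} : ¬ M.CoveredPos ⊥ y := by
  rintro ⟨u', v', -, hm, hu, -⟩
  exact (M.transversal _ _ hm).1 ((le_bot_iff.1 hu).le.trans bot_le)

theorem coveredPos_iff_pred {u y : T} (hu : u ≠ ⊥)
    (h : ∀ v, s(u, v) ∈ M.neg ∪ M.pos → ¬ v ≤ y) :
    M.CoveredPos u y ↔ M.CoveredPos (Order.pred u) y := by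
  have hlt : ∀ u', u' ≤ u → u' ≠ u → u' ≤ Order.pred u :=
    fun u' hle hne => Order.le_pred_of_lt (lt_of_le_of_ne hle hne)
  constructor
  · rintro ⟨u', v', hp, hm, hu', hv', hc⟩
    have hne : u' ≠ u := by rintro rfl; exact h v' hm hv'
    exact ⟨u', v', hp, hm, hlt u' hu' hne, hv', fun a b hab h1 h2 h3 h4 =>
      hc a b hab h1 (h2.trans (Order.pred_le u)) h3 h4⟩
  · rintro ⟨u', v', hp, hm, hu', hv', hc⟩
    refine ⟨u', v', hp, hm, hu'.trans (Order.pred_le u), hv', fun a b hab h1 h2 h3 h4 => ?_⟩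
    have hne : a ≠ u := by rintro rfl; exact h b hab h4
    exact hc a b hab h1 (hlt a h2 hne) h3 h4

theorem coveredPos_iff_mem {u v y : T} (hm : s(u, v) ∈ M.neg ∪ M.pos) (hv : v ≤ y)
    (hmax : ∀ v', s(u, v') ∈ M.neg ∪ M.pos → v ≤ v' → v' ≤ y → v' = v) :
    M.CoveredPos u y ↔ s(u, v) ∈ M.pos := by
  constructor
  · rintro ⟨u', v', hp, hm', hu', hv', hc⟩
    rcases le_total_of_directed hv' hv with h1 | h1
    · rcases hu'.eq_or_lt with rfl | h2
      · rw [hmax v' hm' h1 hv'] at hp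
        exact hp
      · rcases h1.eq_or_lt with rfl | h3
        · rw [hc u v hm hu' le_rfl le_rfl hv']; exact hp
        · exact (M.not_cross _ hm' _ hm ⟨⟨u', by simp, u, by simp, h2⟩,
            ⟨v', by simp, v, by simp, h3⟩⟩).elim
    · rw [hc u v hm hu' le_rfl h1 hv]; exact hp
  · intro hp
    refine ⟨u, v, hp, hm, le_rfl, hv, fun a b hab h1 h2 h3 h4 => ?_⟩
    obtain rfl := le_antisymm h1 h2
    rw [hmax b hab h3 h4]

end SignedTreeModel

/-- The set `S`, with the interval `[a, b)` added (if `z` holds) or removed (otherwise). -/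
def overwrite (a b : ℕ) (z : Prop) (S : Set ℕ) : Set ℕ :=
  {y | (a ≤ y ∧ y < b) ∧ z ∨ ¬ (a ≤ y ∧ y < b) ∧ y ∈ S}

theorem mem_foldl_overwrite (a b : ℕ → ℕ) (z : ℕ → Prop) (y : ℕ) (l : List ℕ) (S : Set ℕ) :
    ((∀ e ∈ l, ¬ (a e ≤ y ∧ y < b e)) ∧
      (y ∈ l.foldl (fun S e => overwrite (a e) (b e) (z e) S) S ↔ y ∈ S)) ∨
    ∃ l₁ e l₂, l = l₁ ++ e :: l₂ ∧ (a e ≤ y ∧ y < b e) ∧ (∀ e' ∈ l₂, ¬ (a e' ≤ y ∧ y < b e')) ∧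
      (y ∈ l.foldl (fun S e => overwrite (a e) (b e) (z e) S) S ↔ z e) := by
  induction l generalizing S with
  | nil => exact .inl ⟨by simp, Iff.rfl⟩
  | cons e l ih =>
    rcases ih (overwrite (a e) (b e) (z e) S) with ⟨h1, h2⟩ | ⟨l₁, e', l₂, rfl, h1, h2, h3⟩
    · by_cases he : a e ≤ y ∧ y < b e
      · refine .inr ⟨[], e, l, rfl, he, h1, ?_⟩
        rw [List.foldl_cons, h2]
        simp only [overwrite, Set.mem_ofPred_eq, he, and_self, true_and, not_true, false_and,
          or_false]
      · refine .inl ⟨List.forall_mem_cons.2 ⟨he, h1⟩, ?_⟩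
        rw [List.foldl_cons, h2]
        simp only [overwrite, Set.mem_ofPred_eq, he, false_and, not_false_eq_true, true_and,
          false_or]
    · exact .inr ⟨e :: l₁, e', l₂, rfl, h1, h2, by rw [List.foldl_cons, h3]⟩

namespace SignedTreeModel

variable {T : RootedTree} {M : SignedTreeModel T} {n m : ℕ} {lo size : T → ℕ}
  {row col : ℕ → T} {sign : ℕ → Prop}

/-- If the positions of the leaves in `S` are those that are positively covered together with the
parent of `u`, then after the transversal pairs at `u` have been applied from the root downwards,
they are those positively covered together with `u`. -/
theorem mem_foldl_iff_coveredPos (hlay : T.IsLayout n lo size)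
    (hmem : ∀ u v, s(u, v) ∈ M.neg ∪ M.pos ↔ ∃ e < m, row e = u ∧ col e = v)
    (hpos : ∀ e < m, s(row e, col e) ∈ M.pos ↔ sign e) {u : T} {l : List ℕ}
    (hl : ∀ e, e ∈ l ↔ e < m ∧ row e = u) (hsort : l.Pairwise fun e e' => ¬ col e' < col e)
    {S : Set ℕ}
    (hS : ∀ y : T, IsMax y → (lo y ∈ S ↔ u ≠ ⊥ ∧ M.CoveredPos (Order.pred u) y)) (y : T)
    (hy : IsMax y) :
    lo y ∈ l.foldl (fun S e => overwrite (lo (col e)) (lo (col e) + size (col e)) (sign e) S) S ↔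
      M.CoveredPos u y := by
  rcases mem_foldl_overwrite (fun e => lo (col e)) (fun e => lo (col e) + size (col e)) sign (lo y)
    l S with ⟨h1, h2⟩ | ⟨l₁, e, l₂, rfl, h1, h2, h3⟩
  · rw [h2, hS y hy]
    by_cases hu : u = ⊥
    · subst hu
      simpa using not_coveredPos_bot
    · rw [coveredPos_iff_pred hu]
      · simp [hu]
      · intro v hv hvy
        obtain ⟨e, he, hr, rfl⟩ := (hmem u v).1 hv
        exact h1 e ((hl e).2 ⟨he, hr⟩) ((hlay.le_leaf_iff hy).1 hvy)
  · obtain ⟨he, rfl⟩ := (hl e).1 (by simp)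
    rw [h3, ← hpos e he, coveredPos_iff_mem ((hmem _ _).2 ⟨e, he, rfl, rfl⟩)
      ((hlay.le_leaf_iff hy).2 h1)]
    intro v' hv' hle hvy
    obtain ⟨e', he', hr', rfl⟩ := (hmem _ _).1 hv'
    have hmem' : e' ∈ l₁ ++ e :: l₂ := (hl e').2 ⟨he', hr'⟩
    rw [List.mem_append, List.mem_cons] at hmem'
    rcases hmem' with h4 | rfl | h4
    · have := (List.pairwise_append.1 hsort).2.2 e' h4 e (by simp)
      exact (eq_of_le_of_not_lt hle this).symm
    · rfl
    · exact (h2 e' h4 ((hlay.le_leaf_iff hy).1 hvy)).elim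

end SignedTreeModel

namespace WordRAM

open WordRAM.Expr RootedTree

attribute [simp] Prog.wp Expr.eval BinOp.eval Expr.coef Prog.time Expr.cost

variable {w B k : ℕ} {s : State}

/-- Every leaf has size `1`, and every vertex is marked as unreached in the output. -/
def initProg : Prog :=
  .assign 4 (const 0) ;;
  .loop (bin .lt (var 4) (var 0)) (
    .store 7 (load 1 (var 4)) (const 1) ;;
    .store 5 (var 4) (var 0) ;;
    .assign 4 (bin .add (var 4) (const 1)))

theorem run_initProg (h7 : ∀ x, s.arr 7 x = 0) (hk : 20 * s.reg 0 + 10 ≤ k) :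
    Run w B initProg (fun s' k' => k ≤ k' + (20 * s.reg 0 + 10) ∧
      (∀ x, (∃ i < s.reg 0, s.arr 1 i = x) → s'.arr 7 x = 1) ∧
      (∀ x, (¬ ∃ i < s.reg 0, s.arr 1 i = x) → s'.arr 7 x = 0) ∧
      ∀ i < s.reg 0, s'.arr 5 i = s.reg 0) s k := by
  refine Run.seq (Run.of_wp rfl (by simp only [Prog.time, Expr.cost]; omega) fun hs => ?_)
  simp only [Prog.wp, Expr.eval, Expr.coef, Prog.time, Expr.cost]
  refine ⟨by simp, ?_⟩
  refine Run.iterate (s.reg 0) (fun j s' => s'.reg 4 = j ∧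
    (∀ x, (∃ i < j, s.arr 1 i = x) → s'.arr 7 x = 1) ∧
      (∀ x, (¬ ∃ i < j, s.arr 1 i = x) → s'.arr 7 x = 0) ∧
      ∀ i < j, s'.arr 5 i = s.reg 0) rfl rfl ?_ ?_ ?_ ?_
  · simp [h7]
  · simp only [Prog.time, Expr.cost]; omega
  · rintro j s' hj hf hm ⟨h1, h2, h3, h4⟩
    have r0 : s'.reg 0 = s.reg 0 := by simpa using hf.reg 0 (by decide)
    have a1 : s'.arr 1 = s.arr 1 := by simpa using hf.arr 1 (by decide)
    have hB := hm.reg 0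
    refine ⟨by simp [Expr.eval, BinOp.eval, h1, r0], fun hlt => ?_⟩
    simp [Function.update_apply, h1, r0, a1]
    grind
  · rintro s' ⟨h1, h2, h3, h4⟩
    refine ⟨?_, h2, h3, h4⟩
    simp only [Prog.time, Expr.cost]; omega

/-- The nodes are listed from the leaves to the root, and the leaves below every node and below its
preceding sibling are counted. -/
def peelProg : Prog :=
  .assign 5 (var 0) ;;
  .assign 4 (const 0) ;;
  .loop (bin .lt (var 4) (var 1)) (
    .assign 6 (load 1 (var 4)) ;;
    .assign 7 (load 0 (var 6)) ;;
    .ite (bin .eq (var 6) (var 7)) .skip (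
      .store 8 (var 6) (load 7 (var 7)) ;;
      .store 7 (var 7) (bin .add (load 7 (var 7)) (load 7 (var 6))) ;;
      .store 6 (var 7) (bin .add (load 6 (var 7)) (const 1)) ;;
      .ite (bin .eq (load 6 (var 7)) (const 2))
        (.store 1 (var 5) (var 7) ;; .assign 5 (bin .add (var 5) (const 1)))
        .skip) ;;
    .assign 4 (bin .add (var 4) (const 1)))

theorem run_peelProg {T : RootedTree} [Fintype T] (hT : T.IsFullBinary) {ix : T → ℕ}
    (hix : Function.Injective ix) (hpar : ∀ t, s.arr 0 (ix t) = ix (Order.pred t))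
    (hN : s.reg 1 = Fintype.card T) (hB : 2 ≤ B)
    (hP : Peel ix (s.reg 0) 0 (s.reg 0) (s.arr 1) (s.arr 6) (s.arr 7) (s.arr 8))
    (hk : 100 * s.reg 1 + 10 ≤ k) :
    Run w B peelProg (fun s' k' => k ≤ k' + (100 * s.reg 1 + 10) ∧
      Peel ix (s.reg 0) (s.reg 1) (s.reg 1) (s'.arr 1) (s'.arr 6) (s'.arr 7) (s'.arr 8) ∧
      ∀ i < s.reg 0, s'.arr 1 i = s.arr 1 i) s k := by
  refine Run.seq (Run.of_wp rfl (by simp; omega) fun hs => ?_)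
  simp only [Prog.wp, Expr.eval, Expr.coef, Prog.time, Expr.cost]
  refine ⟨by simp, ?_⟩
  refine Run.seq (Run.of_wp rfl (by simp; omega) fun hs => ?_)
  simp only [Prog.wp, Expr.eval, Expr.coef, Prog.time, Expr.cost]
  refine ⟨by simp, ?_⟩
  refine Run.iterate (s.reg 1) (fun j s' => s'.reg 4 = j ∧ s.reg 0 ≤ s'.reg 5 ∧
    Peel ix (s.reg 0) j (s'.reg 5) (s'.arr 1) (s'.arr 6) (s'.arr 7) (s'.arr 8) ∧
      ∀ i < s.reg 0, s'.arr 1 i = s.arr 1 i) rfl rfl ?_ ?_ ?_ ?_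
  · simpa using hP
  · simp; omega
  · rintro j s' hj hf hm ⟨h1, h2, h3, h4⟩
    have r0 : s'.reg 0 = s.reg 0 := by simpa using hf.reg 0 (by decide)
    have r1 : s'.reg 1 = s.reg 1 := by simpa using hf.reg 1 (by decide)
    have a0 : s'.arr 0 = s.arr 0 := by simpa using hf.arr 0 (by decide)
    have hB0 := hm.reg 0
    have hB1 := hm.reg 1
    refine ⟨by simp [h1, r1], fun hlt => ?_⟩
    have hjt := h3.lt_tail hix (hN ▸ hlt)
    obtain ⟨u, hu⟩ := h3.queue j hjt
    by_cases hb : u = ⊥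
    · subst hb
      have := h3.step_root hix hjt hu
      simp [h1, a0, hu, hpar]
      exact ⟨by omega, h2, this, h4⟩
    · have hwu := pred_covBy hb
      have hne : ix u ≠ ix (Order.pred u) := fun he => hwu.lt.ne' (hix he)
      simp [h1, a0, hu, hpar, hne, Function.update_apply]
      have hs1 := h3.size_add_le hjt hu hwu
      have hs2 := h3.cnt_lt hT hjt hu hwu
      have hs3 := h3.tail_le
      rw [← hN] at hs3
      refine ⟨by omega, by omega, fun hc => ?_, fun hc => ?_⟩
      · have P' := h3.step hT hix hjt hu hwu (tail' := s'.reg 5 + 1)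
          (q' := Function.update (s'.arr 1) (s'.reg 5) (ix (Order.pred u)))
          (fun i hi => Function.update_of_ne hi.ne _ _) (.inr ⟨by omega, rfl, by simp⟩)
        have := hN ▸ P'.tail_le
        refine ⟨by omega, by omega, by omega, P', fun i hi => ?_⟩
        rw [if_neg (by omega), h4 i hi]
      · exact ⟨by omega, h2, h3.step hT hix hjt hu hwu (fun i hi => rfl) (.inl ⟨by omega, rfl⟩), h4⟩
  · rintro s' ⟨h1, h2, h3, h4⟩
    have h5 : s'.reg 5 = s.reg 1 := le_antisymm (hN ▸ h3.tail_le) h3.le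
    refine ⟨?_, h5 ▸ h3, h4⟩
    simp; omega

/-- The intervals of all nodes are computed from the root to the leaves. -/
def layoutProg : Prog :=
  .assign 4 (var 1) ;;
  .loop (bin .lt (const 0) (var 4)) (
    .assign 4 (bin .sub (var 4) (const 1)) ;;
    .assign 6 (load 1 (var 4)) ;;
    .assign 7 (load 0 (var 6)) ;;
    .ite (bin .eq (var 6) (var 7)) (.store 9 (var 6) (const 0))
      (.store 9 (var 6) (bin .add (load 9 (var 7)) (load 8 (var 6)))))

theorem run_layoutProg {T : RootedTree} [Fintype T] {ix : T → ℕ} {n : ℕ}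
    (hix : Function.Injective ix) (hpar : ∀ t, s.arr 0 (ix t) = ix (Order.pred t))
    (hB : n ≤ B)
    (hP : Peel ix n (s.reg 1) (s.reg 1) (s.arr 1) (s.arr 6) (s.arr 7) (s.arr 8))
    (hk : 100 * s.reg 1 + 10 ≤ k) :
    Run w B layoutProg (fun s' k' => k ≤ k' + (100 * s.reg 1 + 10) ∧
      T.IsLayout n (fun t => s'.arr 9 (ix t)) fun t => s.arr 7 (ix t)) s k := by
  classical
  refine Run.seq (Run.of_wp rfl (by simp; omega) fun hs => ?_)
  simp only [Prog.wp, Expr.eval, Expr.coef, Prog.time, Expr.cost]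
  refine ⟨by simp, ?_⟩
  refine Run.iterate (s.reg 1) (fun j s' => s'.reg 4 = s.reg 1 - j ∧
    ∀ i, s.reg 1 - j ≤ i → i < s.reg 1 → ∀ u, s.arr 1 i = ix u →
      (u = ⊥ → s'.arr 9 (ix u) = 0) ∧
      (u ≠ ⊥ → s'.arr 9 (ix u) = s'.arr 9 (ix (Order.pred u)) + s.arr 8 (ix u)) ∧
      s'.arr 9 (ix u) + s.arr 7 (ix u) ≤ n) rfl rfl ?_ ?_ ?_ ?_
  · simp; omega
  · simp; omega
  · rintro j s' hj hf hm ⟨h1, h2⟩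
    have a0 : s'.arr 0 = s.arr 0 := by simpa using hf.arr 0 (by decide)
    have a1 : s'.arr 1 = s.arr 1 := by simpa using hf.arr 1 (by decide)
    have a8 : s'.arr 8 = s.arr 8 := by simpa using hf.arr 8 (by decide)
    refine ⟨by simp [h1], fun hlt => ?_⟩
    obtain ⟨u, hu⟩ := hP.queue (s.reg 1 - j - 1) (by omega)
    have hixe : ∀ a b, ix a = ix b ↔ a = b := fun a b => hix.eq_iff
    have key : ∀ i, s.reg 1 - (j + 1) ≤ i → i < s.reg 1 → ∀ u', s.arr 1 i = ix u' →
        s.reg 1 - j ≤ i ∧ u' ≠ u ∨ u' = u := by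
      intro i hi hi' u' hu'
      by_cases he : i = s.reg 1 - j - 1
      · subst he
        exact .inr (hix (hu'.symm.trans hu))
      · refine .inl ⟨by omega, ?_⟩
        rintro rfl
        have := hP.inj i hi' _ (by omega) (hu'.trans hu.symm)
        omega
    have keyp : ∀ i, s.reg 1 - j ≤ i → i < s.reg 1 → ∀ u', s.arr 1 i = ix u' → u' ≠ ⊥ →
        Order.pred u' ≠ u := by
      rintro i hi hi' u' hu' hne rfl
      obtain ⟨j', h3, h4, h5⟩ := hP.parent_index rfl hi' hu' (pred_covBy hne)
      have := hP.inj j' h4 _ (by omega) (h5.trans hu.symm)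
      omega
    by_cases hb : u = ⊥
    · subst hb
      simp [h1, a0, a1, hu, hpar, Function.update_apply, hixe]
      refine ⟨by omega, fun i hi hi' u' hu' => ?_⟩
      have h3 := hP.size_le (t := ⊥) (.inl rfl)
      rcases key i (by omega) hi' u' hu' with ⟨h4, h5⟩ | rfl
      · have := h2 i h4 hi' u' hu'
        simp only [h5, if_false, keyp i h4 hi' u' hu' h5]
        refine ⟨fun h => ?_, fun h => this.2.1 ?_, this.2.2⟩
        · exact h.elim
        · exact h5
      · simpa using h3
    · have hwu := pred_covBy hb
      have hne : ix u ≠ ix (Order.pred u) := fun he => hwu.lt.ne' (hix he)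
      obtain ⟨jw, h3, h4, h5⟩ := hP.parent_index rfl (by omega) hu hwu
      have h6 := (h2 jw (by omega) h4 _ h5).2.2
      have h7 := hP.bound _ u hwu (hP.exists_index rfl u)
      simp [h1, a0, a1, a8, hu, hpar, hne, Function.update_apply, hixe]
      refine ⟨by omega, by omega, fun i hi hi' u' hu' => ?_⟩
      rcases key i (by omega) hi' u' hu' with ⟨h8, h9⟩ | rfl
      · have := h2 i h8 hi' u' hu'
        simp only [h9, if_false]
        refine ⟨this.1, fun h => ?_, this.2.2⟩
        rw [if_neg (keyp i h8 hi' u' hu' h)]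
        exact this.2.1 h
      · simp only [hb, if_true, hwu.lt.ne, if_false]
        exact ⟨fun h => h.elim, fun _ => trivial, by omega⟩
  · rintro s' ⟨h1, h2⟩
    refine ⟨by simp; omega, hP.isLayout rfl ?_ fun t c hc => ?_⟩
    · obtain ⟨i, hi, he⟩ := hP.exists_index rfl ⊥
      exact (h2 i (by omega) hi _ he).1 rfl
    · obtain ⟨i, hi, he⟩ := hP.exists_index rfl c
      have := (h2 i (by omega) hi _ he).2.1 (covBy_iff_pred.1 hc).1
      rwa [(covBy_iff_pred.1 hc).2] at this

/-- The vertices are stored by the positions of their leaves. -/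
def vertexProg : Prog :=
  .assign 4 (const 0) ;;
  .loop (bin .lt (var 4) (var 0)) (
    .store 10 (load 9 (load 1 (var 4))) (var 4) ;;
    .assign 4 (bin .add (var 4) (const 1)))

theorem run_vertexProg
    (hinj : ∀ i < s.reg 0, ∀ j < s.reg 0, s.arr 9 (s.arr 1 i) = s.arr 9 (s.arr 1 j) → i = j)
    (hk : 20 * s.reg 0 + 10 ≤ k) :
    Run w B vertexProg (fun s' k' => k ≤ k' + (20 * s.reg 0 + 10) ∧
      ∀ i < s.reg 0, s'.arr 10 (s.arr 9 (s.arr 1 i)) = i) s k := by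
  refine Run.seq (Run.of_wp rfl (by simp; omega) fun hs => ?_)
  simp only [Prog.wp, Expr.eval, Expr.coef, Prog.time, Expr.cost]
  refine ⟨by simp, ?_⟩
  refine Run.iterate (s.reg 0) (fun j s' => s'.reg 4 = j ∧
    ∀ i < j, s'.arr 10 (s.arr 9 (s.arr 1 i)) = i) rfl rfl ?_ ?_ ?_ ?_
  · simp
  · simp; omega
  · rintro j s' hj hf hm ⟨h1, h2⟩
    have r0 : s'.reg 0 = s.reg 0 := by simpa using hf.reg 0 (by decide)
    have a1 : s'.arr 1 = s.arr 1 := by simpa using hf.arr 1 (by decide)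
    have a9 : s'.arr 9 = s.arr 9 := by simpa using hf.arr 9 (by decide)
    have hB := hm.reg 0
    refine ⟨by simp [h1, r0], fun hlt => ?_⟩
    simp [Function.update_apply, h1, a1, a9]
    refine ⟨by omega, fun i hi => ?_⟩
    split_ifs with he
    · exact (hinj i (by omega) j hlt he).symm
    · refine h2 i (lt_of_le_of_ne (by omega) ?_)
      rintro rfl
      exact he rfl
  · rintro s' ⟨h1, h2⟩
    exact ⟨by simp; omega, h2⟩

/-- Every transversal pair is stored in both orders. -/
def mirrorProg : Prog :=
  .assign 4 (const 0) ;;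
  .loop (bin .lt (var 4) (var 2)) (
    .store 2 (bin .add (var 2) (var 4)) (load 3 (var 4)) ;;
    .store 3 (bin .add (var 2) (var 4)) (load 2 (var 4)) ;;
    .store 4 (bin .add (var 2) (var 4)) (load 4 (var 4)) ;;
    .assign 4 (bin .add (var 4) (const 1)))

theorem run_mirrorProg (hk : 40 * s.reg 2 + 10 ≤ k) :
    Run w B mirrorProg (fun s' k' => k ≤ k' + (40 * s.reg 2 + 10) ∧
      ∀ i < s.reg 2, s'.arr 2 i = s.arr 2 i ∧ s'.arr 3 i = s.arr 3 i ∧ s'.arr 4 i = s.arr 4 i ∧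
        s'.arr 2 (s.reg 2 + i) = s.arr 3 i ∧ s'.arr 3 (s.reg 2 + i) = s.arr 2 i ∧
        s'.arr 4 (s.reg 2 + i) = s.arr 4 i) s k := by
  refine Run.seq (Run.of_wp rfl (by simp; omega) fun hs => ?_)
  simp only [Prog.wp, Expr.eval, Expr.coef, Prog.time, Expr.cost]
  refine ⟨by simp, ?_⟩
  refine Run.iterate (s.reg 2) (fun j s' => s'.reg 4 = j ∧
    (∀ i < s.reg 2, s'.arr 2 i = s.arr 2 i ∧ s'.arr 3 i = s.arr 3 i ∧ s'.arr 4 i = s.arr 4 i) ∧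
    ∀ i < j, s'.arr 2 (s.reg 2 + i) = s.arr 3 i ∧ s'.arr 3 (s.reg 2 + i) = s.arr 2 i ∧
        s'.arr 4 (s.reg 2 + i) = s.arr 4 i) rfl rfl ?_ ?_ ?_ ?_
  · simp
  · simp; omega
  · rintro j s' hj hf hm ⟨h1, h2, h3⟩
    have r2 : s'.reg 2 = s.reg 2 := by simpa using hf.reg 2 (by decide)
    have hB := hm.reg 2
    refine ⟨by simp [h1, r2], fun hlt => ?_⟩
    have h4 := h2 j hlt
    have hp : s.reg 2 ≠ 0 := by omega
    simp [hp, Function.update_apply, h1, r2, h4]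
    refine ⟨by omega, fun i hi => ?_, fun i hi => ?_⟩
    · rw [if_neg (by omega), if_neg (by omega), if_neg (by omega)]
      exact h2 i hi
    · by_cases he : i = j
      · simp [he]
      · simp only [he, if_false]
        exact h3 i (by omega)
  · rintro s' ⟨h1, h2, h3⟩
    exact ⟨by simp; omega, fun i hi => ⟨(h2 i hi).1, (h2 i hi).2.1, (h2 i hi).2.2, h3 i hi⟩⟩

/-- The ordered transversal pairs are distributed to lists according to their second nodes. -/
def columnProg : Prog :=
  .assign 4 (const 0) ;;
  .loop (bin .lt (var 4) (bin .add (var 2) (var 2))) (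
    .store 12 (var 4) (load 11 (load 3 (var 4))) ;;
    .store 11 (load 3 (var 4)) (bin .add (var 4) (const 1)) ;;
    .assign 4 (bin .add (var 4) (const 1)))

theorem run_columnProg (h11 : ∀ x, s.arr 11 x = 0) (hB : 2 * s.reg 2 ≤ B)
    (hk : 60 * s.reg 2 + 10 ≤ k) :
    Run w B columnProg (fun s' k' => k ≤ k' + (60 * s.reg 2 + 10) ∧
      Buckets (s.arr 3) (fun _ => 0) (Finset.range (2 * s.reg 2)) (s'.arr 12) (s'.arr 11)) s k := by
  refine Run.seq (Run.of_wp rfl (by simp; omega) fun hs => ?_)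
  simp only [Prog.wp, Expr.eval, Expr.coef, Prog.time, Expr.cost]
  refine ⟨by simp, ?_⟩
  refine Run.iterate (2 * s.reg 2) (fun j s' => s'.reg 4 = j ∧
    Buckets (s.arr 3) (fun _ => 0) (Finset.range j) (s'.arr 12) (s'.arr 11)) rfl rfl ?_ ?_ ?_ ?_
  · simpa using Buckets.empty h11
  · simp; omega
  · rintro j s' hj hf hm ⟨h1, h2⟩
    have r2 : s'.reg 2 = s.reg 2 := by simpa using hf.reg 2 (by decide)
    have a3 : s'.arr 3 = s.arr 3 := by simpa using hf.arr 3 (by decide)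
    refine ⟨by simp [h1, r2]; omega, fun hlt => ?_⟩
    simp [h1, a3]
    refine ⟨by omega, ?_⟩
    rw [Finset.range_add_one]
    exact h2.insert (by simp) (by simp)
  · rintro s' ⟨h1, h2⟩
    exact ⟨by simp; omega, h2⟩

end WordRAM

namespace WordRAM

open WordRAM.Expr RootedTree

variable {w B k : ℕ} {s : State}

/-- The lists of ordered transversal pairs with a given first node are built, the second nodes being
taken from the leaves to the root. -/
def rowProg : Prog :=
  .assign 4 (const 0) ;;
  .loop (bin .lt (var 4) (var 1)) (
    .assign 5 (load 11 (load 1 (var 4))) ;;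
    .loop (var 5) (
      .assign 6 (bin .sub (var 5) (const 1)) ;;
      .store 14 (var 6) (load 13 (load 2 (var 6))) ;;
      .store 13 (load 2 (var 6)) (var 5) ;;
      .assign 5 (load 12 (var 6))) ;;
    .assign 4 (bin .add (var 4) (const 1)))

theorem run_rowProg {rank rk : ℕ → ℕ} (h13 : ∀ x, s.arr 13 x = 0)
    (hrank : ∀ j < s.reg 1, rank (s.arr 1 j) = j)
    (hcol : ∀ e < 2 * s.reg 2, ∃ j < s.reg 1, s.arr 1 j = s.arr 3 e)
    (hb : Buckets (s.arr 3) rk (Finset.range (2 * s.reg 2)) (s.arr 12) (s.arr 11))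
    (hk : 50 * s.reg 1 + 100 * s.reg 2 + 20 ≤ k) :
    Run w B rowProg (fun s' k' => k ≤ k' + (50 * s.reg 1 + 100 * s.reg 2 + 20) ∧
      Buckets (s.arr 2) (fun e => rank (s.arr 3 e)) (Finset.range (2 * s.reg 2))
        (s'.arr 14) (s'.arr 13)) s k := by
  obtain ⟨D, hD⟩ : ∃ D : ℕ → Finset ℕ, ∀ h e, e ∈ D h ↔
      e < 2 * s.reg 2 ∧ rank (s.arr 3 e) < h :=
    ⟨fun h => (Finset.range (2 * s.reg 2)).filter fun e => rank (s.arr 3 e) < h, by simp⟩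
  have hcard : ∀ h, (D h).card ≤ 2 * s.reg 2 := fun h => by
    simpa using Finset.card_le_card
      (show D h ⊆ Finset.range (2 * s.reg 2) from fun e he => by simpa using ((hD h e).1 he).1)
  have hD0 : D 0 = ∅ := by
    ext e; simp [hD]
  have hDN : D (s.reg 1) = Finset.range (2 * s.reg 2) := by
    ext e
    simp only [hD, Finset.mem_range, and_iff_left_iff_imp]
    intro he
    obtain ⟨j, hj, hq⟩ := hcol e he
    rw [← hq, hrank j hj]
    exact hj
  refine Run.seq (Run.of_wp rfl (by simp; omega) fun hs => ?_)
  simp only [Prog.wp, Expr.eval, Expr.coef, Prog.time, Expr.cost]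
  refine ⟨by simp, ?_⟩
  refine Run.loop (fun s' k' => ∃ h ≤ s.reg 1, s'.reg 4 = h ∧
    Buckets (s.arr 2) (fun e => rank (s.arr 3 e)) (D h) (s'.arr 14) (s'.arr 13) ∧
    k ≤ k' + (50 * h + 50 * (D h).card + 10)) rfl ?_ ?_
  · rintro s' k' hf hm ⟨h, hh, h1, h2, h3⟩
    have r1 : s'.reg 1 = s.reg 1 := by simpa using hf.reg 1 (by decide)
    have a1 : s'.arr 1 = s.arr 1 := by simpa using hf.arr 1 (by decide)
    have a11 : s'.arr 11 = s.arr 11 := by simpa using hf.arr 11 (by decide)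
    have hB1 := hm.reg 1
    have hc := hcard h
    refine ⟨by simp; omega, fun he => ?_, fun he => ?_⟩
    · simp [h1, r1] at he
      have : h = s.reg 1 := by omega
      subst this
      exact ⟨by simp; omega, hDN ▸ h2⟩
    · simp [h1, r1] at he
      refine Run.seq (Run.of_wp rfl (by simp; omega) fun hs => ?_)
      simp only [Prog.wp, Expr.eval, Expr.coef, Prog.time, Expr.cost]
      refine ⟨by simp, ?_⟩
      obtain ⟨l, hl1, hl2, hl3, -⟩ := hb (s.arr 1 h)
      have hsucc : ∀ e, e ∈ D (h + 1) ↔ e ∈ D h ∨ e ∈ l := by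
        intro e
        rw [hl3]
        simp only [hD, Finset.mem_range, ← and_or_left]
        refine and_congr_right fun he' => ?_
        rw [Nat.lt_succ_iff_lt_or_eq]
        refine or_congr_right ⟨fun h4 => ?_, fun h4 => by rw [h4, hrank h he]⟩
        obtain ⟨j, hj, hq⟩ := hcol e he'
        rw [← hq, hrank j hj] at h4
        rw [← hq, h4]
      refine Run.seq (Run.loop (fun s'' k'' => ∃ (E : Finset ℕ) (l : List ℕ),
        IsLinkedList (s.arr 12) (s''.reg 5) l ∧ l.Nodup ∧
        (∀ e, e ∈ D (h + 1) ↔ e ∈ E ∨ e ∈ l) ∧ (∀ e ∈ E, e ∉ l) ∧ (∀ e ∈ l, rank (s.arr 3 e) = h) ∧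
        Buckets (s.arr 2) (fun e => rank (s.arr 3 e)) E (s''.arr 14) (s''.arr 13) ∧
        k ≤ k'' + (50 * h + 50 * E.card + 30)) rfl ?_ ?_)
      · rintro s'' k'' hf' hm' ⟨E, l, g1, g2, g3, g4, g5, g6, g7⟩
        have r4 : s''.reg 4 = h := by
          have := hf'.reg 4 (by decide)
          simpa [h1] using this
        have a2 : s''.arr 2 = s.arr 2 := by
          have := hf'.arr 2 (by decide)
          have := hf.arr 2 (by decide)
          simp_all
        have a12 : s''.arr 12 = s.arr 12 := by
          have := hf'.arr 12 (by decide)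
          have := hf.arr 12 (by decide)
          simp_all
        have hsub : E ∪ l.toFinset ⊆ Finset.range (2 * s.reg 2) := by
          intro e he
          have := (g3 e).2 (by simpa using he)
          simpa using ((hD _ _).1 this).1
        have hdisj : Disjoint E l.toFinset := by
          rw [Finset.disjoint_left]
          intro e he
          simpa using g4 e he
        have hle := Finset.card_le_card hsub
        rw [Finset.card_union_of_disjoint hdisj, List.toFinset_card_of_nodup g2,
          Finset.card_range] at hle
        refine ⟨by simp; omega, fun he' => ?_, fun he' => ?_⟩
        · cases l with
          | cons e l =>
            have := g1.1
            simp at he'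
            omega
          | nil =>
            have hE : D (h + 1) = E := by
              ext e
              simpa using g3 e
            refine Run.of_wp rfl (by simp; omega) fun _ => ?_
            simp [r4]
            exact ⟨by omega, he, hE ▸ g6, by rw [hE]; omega⟩
        · cases l with
          | nil => exact (he' g1).elim
          | cons e l =>
            obtain ⟨g8, g9⟩ := g1
            have heD : e ∉ E := fun h => g4 e h (by simp)
            have hel : e ∉ l := (List.nodup_cons.1 g2).1
            have hrk := g5 e (by simp)
            refine Run.of_wp rfl (by simp at hle ⊢; omega) fun _ => ?_
            simp [g8, a2, a12]
            refine ⟨insert e E, l, g9, (List.nodup_cons.1 g2).2, ?_, ?_, ?_, ?_, ?_⟩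
            · intro e'
              rw [g3]
              simp only [List.mem_cons, Finset.mem_insert]
              tauto
            · intro e' he'
              rcases Finset.mem_insert.1 he' with rfl | he'
              · exact hel
              · exact fun h => g4 e' he' (by simp [h])
            · exact fun e' he' => g5 e' (by simp [he'])
            · refine g6.insert heD fun e' he' => ?_
              rw [hrk]
              have := ((hD _ _).1 ((g3 e').2 (.inl he'))).2
              omega
            · rw [Finset.card_insert_of_notMem heD]
              simp at hle
              omega
      · refine ⟨_, l, ?_, hl2, hsucc, ?_, ?_, h2, ?_⟩
        · simpa [h1, a1, a11] using hl1
        · intro e he' hel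
          have h4 := ((hD _ _).1 he').2
          rw [((hl3 e).1 hel).2, hrank h he] at h4
          omega
        · intro e hel
          rw [((hl3 e).1 hel).2, hrank h he]
        · simp; omega
  · refine ⟨0, Nat.zero_le _, by simp, ?_, ?_⟩
    · simpa [hD0] using Buckets.empty h13
    · simp; omega

/-- The size `2 ^ L` of a perfect binary tree is computed, and the tree is stored as a heap. -/
def heapProg : Prog :=
  .assign 8 (const 1) ;;
  .loop (bin .eq (bin .lt (var 0) (var 8)) (const 0)) (
    .assign 8 (bin .add (var 8) (var 8))) ;;
  .assign 4 (const 2) ;;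
  .loop (bin .lt (var 4) (bin .add (var 8) (var 8))) (
    .store 15 (var 4) (var 4) ;;
    .assign 4 (bin .add (var 4) (const 1))) ;;
  .assign 9 (bin .add (var 8) (var 8))

theorem run_heapProg {W : ℕ} (hW : W = 2 ^ (s.reg 0).size) (h15 : ∀ x, s.arr 15 x = 0)
    (hB : 4 * W ≤ B) (hk : 100 * W + 100 ≤ k) :
    Run w B heapProg (fun s' k' => k ≤ k' + (100 * W + 100) ∧
      s'.reg 8 = W ∧ s'.reg 9 = 2 * W ∧ s'.arr 15 0 = 0 ∧ s'.arr 15 1 = 0 ∧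
      ∀ j, 2 ≤ j → j < 2 * W → s'.arr 15 j = j) s k := by
  have hL : (s.reg 0).size ≤ W := hW ▸ Nat.lt_two_pow_self.le
  have hWpos : 0 < W := hW ▸ Nat.two_pow_pos _
  refine Run.seq (Run.of_wp rfl (by simp; omega) fun hs => ?_)
  simp only [Prog.wp, Expr.eval, Expr.coef, Prog.time, Expr.cost]
  refine ⟨by simp, ?_⟩
  refine Run.then_ (R := fun s' k' => s'.reg 8 = W ∧ k ≤ k' + (10 * W + 10))
    (Run.iterate (s.reg 0).size (fun j s' => s'.reg 8 = 2 ^ j) rfl rfl ?_ ?_ ?_ ?_) ?_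
  · simp
  · simp; omega
  · rintro j s' hj hf hm h1
    have r0 : s'.reg 0 = s.reg 0 := by simpa using hf.reg 0 (by decide)
    refine ⟨?_, fun hlt => ?_⟩
    · rw [Nat.lt_size]
      simp [h1, r0]
    · have : 2 ^ (j + 1) ≤ W := hW ▸ Nat.pow_le_pow_right (by decide) hlt
      rw [pow_succ] at this ⊢
      simp [h1]
      omega
  · intro s' h1
    refine ⟨h1.trans hW.symm, ?_⟩
    simp; omega
  rintro s1 k1 hf1 hm1 ⟨h1, hk1⟩
  have a15 : ∀ x, s1.arr 15 x = 0 := by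
    have : s1.arr 15 = s.arr 15 := by simpa using hf1.arr 15 (by decide)
    simpa [this] using h15
  refine Run.seq (Run.of_wp rfl (by simp; omega) fun hs => ?_)
  simp only [Prog.wp, Expr.eval, Expr.coef, Prog.time, Expr.cost]
  refine ⟨by simp; omega, ?_⟩
  refine Run.then_ (R := fun s' k' => s'.reg 8 = W ∧ s'.arr 15 0 = 0 ∧ s'.arr 15 1 = 0 ∧
      (∀ j, 2 ≤ j → j < 2 * W → s'.arr 15 j = j) ∧ k1 ≤ k' + (60 * W + 20))
    (Run.iterate (2 * W - 2) (fun j s' => s'.reg 4 = 2 + j ∧ s'.reg 8 = W ∧ s'.arr 15 0 = 0 ∧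
      s'.arr 15 1 = 0 ∧ ∀ i, 2 ≤ i → i < 2 + j → s'.arr 15 i = i) rfl rfl ?_ ?_ ?_ ?_) ?_
  · simp [h1, a15]
    omega
  · simp; omega
  · rintro j s' hj hf hm ⟨g1, g2, g3, g4, g5⟩
    refine ⟨by simp [g1, g2]; omega, fun hlt => ?_⟩
    simp [Function.update_apply, g1, g2, g3, g4]
    refine ⟨by omega, by omega, by omega, by omega, fun i hi hi' => ?_⟩
    split_ifs with he
    exacts [he.symm, g5 i hi (by omega)]
  · rintro s' ⟨g1, g2, g3, g4, g5⟩
    refine ⟨g2, g3, g4, fun j hj hj' => g5 j hj (by omega), ?_⟩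
    simp; omega
  rintro s2 k2 hf2 hm2 ⟨g1, g2, g3, g4, hk2⟩
  refine Run.of_wp rfl (by simp; omega) fun hs => ?_
  simp [g1, g2, g3]
  exact ⟨by omega, by omega, by omega, g4⟩

end WordRAM

/-- The set that agrees with `S` before `a` and with `S'` from `a` on. -/
def splice (a : ℕ) (S S' : Set ℕ) : Set ℕ := {y | y < a ∧ y ∈ S ∨ a ≤ y ∧ y ∈ S'}

theorem splice_splice {a b : ℕ} (hab : a ≤ b) (z : Prop) (S : Set ℕ) :
    splice b (splice a S {_y | z}) S = overwrite a b z S := by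
  ext y
  simp only [splice, overwrite, Set.mem_ofPred_eq]
  by_cases h1 : a ≤ y <;> by_cases h2 : y < b
  · have : ¬ b ≤ y := by omega
    have : ¬ y < a := by omega
    simp [*]
  · have : b ≤ y := by omega
    simp [*]
  · have : ¬ b ≤ y := by omega
    have : y < a := by omega
    simp [*]
  · omega

/-- The array `c` stores segment tree nodes below `m`, including the perfect binary tree with
`W = 2 ^ L` leaves. -/
structure SegStore (c : ℕ → ℕ) (W m : ℕ) : Prop where
  zero : c 0 = 0
  one : c 1 = 0
  two_mul_le : 2 * W ≤ m
  heap : ∀ j, 2 ≤ j → j < 2 * W → c j = j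

namespace SegStore

variable {c c' : ℕ → ℕ} {W m m' L : ℕ}

theorem mono (h : SegStore c W m) (hW : 0 < W) (hc : ∀ j < 2 * m, c' j = c j) (hm : m ≤ m') :
    SegStore c' W m' where
  zero := by rw [hc _ (by have := h.two_mul_le; omega), h.zero]
  one := by rw [hc _ (by have := h.two_mul_le; omega), h.one]
  two_mul_le := h.two_mul_le.trans hm
  heap j h2 hj := by rw [hc _ (by have := h.two_mul_le; omega), h.heap j h2 hj]

theorem const (h : SegStore c W m) (hW : W = 2 ^ L) {x : ℕ} (hx : x ≤ 1) :
    SegTree c W m L 0 x {_y | x = 1} := by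
  rcases Nat.le_one_iff_eq_zero_or_eq_one.1 hx with rfl | rfl
  · exact SegTree.zero (by simp)
  · exact (SegTree.heap_root hW h.two_mul_le h.heap).congr (by simp)

end SegStore

namespace WordRAM

open WordRAM.Expr RootedTree

variable {w B k : ℕ} {s : State}

/-- From the trees in registers `10` and `11`, a new tree is built that agrees with the first one
before the position in register `13` and with the second one from there on. -/
def spliceProg : Prog :=
  .assign 15 (bin .add (var 9) (var 9)) ;;
  .assign 16 (var 15) ;;
  .assign 9 (bin .add (var 9) (const 1)) ;;
  .assign 14 (var 8) ;;
  .loop (bin .lt (const 1) (var 14)) (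
    .assign 14 (bin .div (var 14) (const 2)) ;;
    .store 15 (var 15) (var 9) ;;
    .ite (bin .lt (var 13) (var 14)) (
      .assign 15 (bin .add (var 9) (var 9)) ;;
      .store 15 (bin .add (var 15) (const 1))
        (load 15 (bin .add (bin .add (var 11) (var 11)) (const 1))) ;;
      .assign 10 (load 15 (bin .add (var 10) (var 10))) ;;
      .assign 11 (load 15 (bin .add (var 11) (var 11)))) (
      .assign 13 (bin .sub (var 13) (var 14)) ;;
      .store 15 (bin .add (var 9) (var 9)) (load 15 (bin .add (var 10) (var 10))) ;;
      .assign 15 (bin .add (bin .add (var 9) (var 9)) (const 1)) ;;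
      .assign 10 (load 15 (bin .add (bin .add (var 10) (var 10)) (const 1))) ;;
      .assign 11 (load 15 (bin .add (bin .add (var 11) (var 11)) (const 1)))) ;;
    .assign 9 (bin .add (var 9) (const 1))) ;;
  .store 15 (var 15) (var 11) ;;
  .assign 10 (load 15 (var 16))

theorem run_spliceProg {L W m a : ℕ} {c : ℕ → ℕ} {S S' : Set ℕ} (hW : W = 2 ^ L)
    (h8 : s.reg 8 = W) (hm0 : s.reg 9 = m) (ha0 : s.reg 13 = a) (hc0 : s.arr 15 = c)
    (hc : SegStore c W m) (hS : SegTree c W m L 0 (s.reg 10) S)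
    (hS' : SegTree c W m L 0 (s.reg 11) S') (ha : a < W)
    (hB : 2 * (m + L + 2) ≤ B) (hk : 100 * L + 40 ≤ k) :
    Run w B spliceProg (fun s' k' => k ≤ k' + (100 * L + 40) ∧ s'.reg 9 = m + L + 1 ∧
      (∀ j < 2 * m, s'.arr 15 j = c j) ∧
      SegTree (s'.arr 15) W (s'.reg 9) L 0 (s'.reg 10) (splice a S S')) s k := by
  have hWm := hc.two_mul_le
  have hmpos : 0 < m := by have := Nat.two_pow_pos L; omega
  refine Run.seq (Run.of_wp rfl (by simp; omega) fun hs => ?_)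
  simp only [Prog.wp, Expr.eval, Expr.coef, Prog.time, Expr.cost, BinOp.eval]
  refine ⟨by simp; omega, ?_⟩
  refine Run.seq (Run.of_wp rfl (by simp; omega) fun hs => ?_)
  simp only [Prog.wp, Expr.eval, Expr.coef, Prog.time, Expr.cost]
  refine ⟨by simp, ?_⟩
  refine Run.seq (Run.of_wp rfl (by simp; omega) fun hs => ?_)
  simp only [Prog.wp, Expr.eval, Expr.coef, Prog.time, Expr.cost, BinOp.eval]
  refine ⟨by simp; omega, ?_⟩
  refine Run.seq (Run.of_wp rfl (by simp; omega) fun hs => ?_)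
  simp only [Prog.wp, Expr.eval, Expr.coef, Prog.time, Expr.cost]
  refine ⟨by simp, ?_⟩
  refine Run.then_ (R := fun s' k' => k ≤ k' + (100 * L + 25) ∧ s'.reg 9 = m + L + 1 ∧
    (∀ i < 2 * m, s'.arr 15 i = c i) ∧ 2 * m ≤ s'.reg 15 ∧ s'.reg 15 < 2 * (m + L + 1) ∧
    SegTree c W m 0 a (s'.reg 11) S' ∧
    ∀ c' m', (∀ i < 2 * (m + L + 1), i ≠ s'.reg 15 → c' i = s'.arr 15 i) → m + L + 1 ≤ m' →
      SegTree c' W m' 0 a (c' (s'.reg 15)) (splice a S S') →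
      SegTree c' W m' L 0 (c' (2 * m)) (splice a S S'))
    (Run.iterate L (fun j s' => ∃ l b, j + l = L ∧ s'.reg 14 = 2 ^ l ∧ s'.reg 9 = m + 1 + j ∧
      b ≤ a ∧ a < b + 2 ^ l ∧ s'.reg 13 = a - b ∧ SegTree c W m l b (s'.reg 10) S ∧
      SegTree c W m l b (s'.reg 11) S' ∧ (∀ i < 2 * m, s'.arr 15 i = c i) ∧
      2 * m ≤ s'.reg 15 ∧ s'.reg 15 < 2 * (m + 1 + j) ∧
      ∀ c' m', (∀ i < 2 * (m + 1 + j), i ≠ s'.reg 15 → c' i = s'.arr 15 i) → m + 1 + j ≤ m' →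
        SegTree c' W m' l b (c' (s'.reg 15)) (splice a S S') →
        SegTree c' W m' L 0 (c' (2 * m)) (splice a S S')) rfl rfl ?_ ?_ ?_ ?_) ?_
  · refine ⟨L, 0, ?_⟩
    simp [hm0, ha0, hc0, h8, hW]
    simp only [← two_mul]
    refine ⟨hW ▸ ha, hW ▸ hS, hW ▸ hS', le_rfl, by omega, fun c' m' _ _ h => h⟩
  · simp; omega
  · rintro j s' hj hf hm ⟨l, b, h1, h2, h3, h4, h5, h6, h7, h8, h9, h10, h11, h12⟩
    refine ⟨?_, fun hlt => ?_⟩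
    · simp only [Expr.eval, BinOp.eval, h2]
      rw [ne_eq, ite_eq_right_iff, Classical.not_imp]
      simp
      omega
    · obtain ⟨l, rfl⟩ : ∃ l', l = l' + 1 := ⟨l - 1, by omega⟩
      have hd : 2 ^ (l + 1) / 2 = 2 ^ l := by rw [pow_succ]; simp
      rw [pow_succ] at h5
      have hX := h7.lt hmpos
      have hY := h8.lt hmpos
      have e1 := h9 (2 * s'.reg 10) (by omega)
      have e2 := h9 (2 * s'.reg 10 + 1) (by omega)
      have e3 := h9 (2 * s'.reg 11) (by omega)
      have e4 := h9 (2 * s'.reg 11 + 1) (by omega)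
      have n1 : 2 * s'.reg 10 ≠ s'.reg 15 := by omega
      have n2 : 2 * s'.reg 10 + 1 ≠ s'.reg 15 := by omega
      have n3 : 2 * s'.reg 11 ≠ s'.reg 15 := by omega
      have n4 : 2 * s'.reg 11 + 1 ≠ s'.reg 15 := by omega
      have n5 : 2 * s'.reg 10 ≠ 2 * (m + 1 + j) + 1 := by omega
      have n6 : 2 * s'.reg 11 ≠ 2 * (m + 1 + j) + 1 := by omega
      have n7 : 2 * s'.reg 10 + 1 ≠ 2 * (m + 1 + j) := by omega
      have n8 : 2 * s'.reg 11 + 1 ≠ 2 * (m + 1 + j) := by omega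
      simp [Function.update_apply, h2, hd, h3, h6, ← two_mul, e1, e2, e3, e4, n1, n2, n3, n4, n5,
        n6, n7, n8]
      refine ⟨fun hlt' => ⟨by omega, by omega, by omega, by omega, b, h4, by omega, rfl,
        h7.left hc.zero, h8.left hc.zero, fun i hi => ?_, by omega, fun c' m' hc' hm' hT => ?_⟩,
        fun hle => ⟨by omega, by omega, by omega, by omega, b + 2 ^ l, by omega, by omega, by omega,
        h7.right hc.one, h8.right hc.one, fun i hi => ?_, by omega, by omega,
        fun c' m' hc' hm' hT => ?_⟩⟩
      · rw [if_neg (by omega), if_neg (by omega), h9 i hi]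
      · have hold : ∀ i < 2 * m, c' i = c i := fun i hi => by
          rw [hc' i (by omega) (by omega), if_neg (by omega), if_neg (by omega), h9 i hi]
        refine h12 c' m' (fun i hi hne => ?_) (by omega) ?_
        · rw [hc' i (by omega) (by omega), if_neg (by omega), if_neg hne]
        · have e5 : c' (s'.reg 15) = m + 1 + j := by
            rw [hc' _ (by omega) (by omega), if_neg (by omega), if_pos rfl]
          have e6 : c' (2 * (m + 1 + j) + 1) = c (2 * s'.reg 11 + 1) := by
            rw [hc' _ (by omega) (by omega), if_pos rfl]
          rw [e5]
          refine .inr ⟨by omega, by omega, .inr (by omega), hT, ?_⟩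
          rw [e6]
          refine ((h8.right hc.one).mono hold (by omega)).congr fun y hy hy' => ?_
          simp only [splice, Set.mem_ofPred_eq, show ¬ y < a by omega, show a ≤ y by omega,
            false_and, true_and, false_or]
      · rw [if_neg (by omega), if_neg (by omega), h9 i hi]
      · have hold : ∀ i < 2 * m, c' i = c i := fun i hi => by
          rw [hc' i (by omega) (by omega), if_neg (by omega), if_neg (by omega), h9 i hi]
        refine h12 c' m' (fun i hi hne => ?_) (by omega) ?_
        · rw [hc' i (by omega) (by omega), if_neg (by omega), if_neg hne]
        · have e5 : c' (s'.reg 15) = m + 1 + j := by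
            rw [hc' _ (by omega) (by omega), if_neg (by omega), if_pos rfl]
          have e6 : c' (2 * (m + 1 + j)) = c (2 * s'.reg 10) := by
            rw [hc' _ (by omega) (by omega), if_pos rfl]
          rw [e5]
          refine .inr ⟨by omega, by omega, .inr (by omega), ?_, hT⟩
          rw [e6]
          refine ((h7.left hc.zero).mono hold (by omega)).congr fun y hy hy' => ?_
          simp only [splice, Set.mem_ofPred_eq, show y < a by omega, show ¬ a ≤ y by omega,
            false_and, true_and, or_false]
  · rintro s' ⟨l, b, h1, h2, h3, h4, h5, h6, h7, h8, h9, h10, h11, h12⟩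
    obtain rfl : l = 0 := by omega
    obtain rfl : b = a := by simp at h5; omega
    rw [show m + 1 + L = m + L + 1 by omega] at *
    exact ⟨by simp; omega, h3, h9, h10, h11, h8, h12⟩
  · rintro s' k' hf hm ⟨h1, h2, h3, h4, h5, h6, h7⟩
    have r16 : s'.reg 16 = 2 * m := by
      have := hf.reg 16 (by decide)
      simpa [hm0, ← two_mul] using this
    refine Run.of_wp rfl (by simp; omega) fun hs => ?_
    simp [r16, h2]
    refine ⟨by omega, fun j hj => ?_, h7 _ _ (fun i hi hne => ?_) le_rfl ?_⟩
    · rw [Function.update_of_ne (by omega), h3 j hj]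
    · rw [Function.update_of_ne hne]
    · rw [Function.update_self]
      refine (h6.mono (fun i hi => ?_) (by omega)).congr fun y hy hy' => ?_
      · rw [Function.update_of_ne (by omega), h3 i hi]
      · simp at hy'
        obtain rfl : y = a := by omega
        simp [splice]

end WordRAM

namespace WordRAM

open WordRAM.Expr RootedTree SignedTreeModel

variable {w B k : ℕ} {s : State}

/-- The interval of the second node of the transversal pair in register `5` is added to the set
represented by register `10` or removed from it, depending on the sign of the pair. -/
def overwriteProg : Prog :=
  .assign 12 (var 10) ;;
  .assign 13 (load 9 (load 3 (var 5))) ;;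
  .assign 11 (load 4 (var 5)) ;;
  spliceProg ;;
  .assign 11 (var 12) ;;
  .assign 13 (bin .add (load 9 (load 3 (var 5))) (load 7 (load 3 (var 5)))) ;;
  spliceProg

theorem run_overwriteProg {L W m e a b : ℕ} {c : ℕ → ℕ} {S : Set ℕ} (hW : W = 2 ^ L)
    (h8 : s.reg 8 = W) (hm0 : s.reg 9 = m) (he0 : s.reg 5 = e) (hc0 : s.arr 15 = c)
    (ha : s.arr 9 (s.arr 3 e) = a) (hb : a + s.arr 7 (s.arr 3 e) = b)
    (hc : SegStore c W m) (hS : SegTree c W m L 0 (s.reg 10) S) (hbW : b < W)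
    (hz : s.arr 4 e ≤ 1)
    (hB : 2 * (m + (2 * L + 2) + 1) ≤ B) (hk : 200 * L + 150 ≤ k) :
    Run w B overwriteProg (fun s' k' => k ≤ k' + (200 * L + 150) ∧ s'.reg 9 = m + (2 * L + 2) ∧
      (∀ j < 2 * m, s'.arr 15 j = c j) ∧
      SegTree (s'.arr 15) W (s'.reg 9) L 0 (s'.reg 10) (overwrite a b (s.arr 4 e = 1) S)) s k := by
  have hWm := hc.two_mul_le
  have hWpos : 0 < W := hW ▸ Nat.two_pow_pos L
  refine Run.seq (Run.of_wp rfl (by simp; omega) fun hs => ?_)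
  simp only [Prog.wp, Expr.eval, Expr.coef, Prog.time, Expr.cost]
  refine ⟨by simp, ?_⟩
  refine Run.seq (Run.of_wp rfl (by simp; omega) fun hs => ?_)
  simp only [Prog.wp, Expr.eval, Expr.coef, Prog.time, Expr.cost]
  refine ⟨by simp, ?_⟩
  refine Run.seq (Run.of_wp rfl (by simp; omega) fun hs => ?_)
  simp only [Prog.wp, Expr.eval, Expr.coef, Prog.time, Expr.cost]
  refine ⟨by simp, ?_⟩
  refine Run.then_ (run_spliceProg (m := m) (a := a) (c := c) (S := S)
    (S' := {_y | s.arr 4 e = 1}) hW (by simp [h8]) (by simp [hm0]) (by simp [he0, ha])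
    (by simp [hc0]) hc (by simpa using hS) (by simpa [he0] using hc.const hW hz) (by omega)
    (by omega) (by omega)) ?_
  rintro s1 k1 hf1 hm1 ⟨g1, g2, g3, g4⟩
  have r5 : s1.reg 5 = e := by simpa [he0] using hf1.reg 5 (by decide)
  have r8 : s1.reg 8 = W := by simpa [h8] using hf1.reg 8 (by decide)
  have r12 : s1.reg 12 = s.reg 10 := by simpa using hf1.reg 12 (by decide)
  have a3 : s1.arr 3 = s.arr 3 := by simpa using hf1.arr 3 (by decide)
  have a7 : s1.arr 7 = s.arr 7 := by simpa using hf1.arr 7 (by decide)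
  have a9 : s1.arr 9 = s.arr 9 := by simpa using hf1.arr 9 (by decide)
  refine Run.seq (Run.of_wp rfl (by simp; omega) fun hs => ?_)
  simp only [Prog.wp, Expr.eval, Expr.coef, Prog.time, Expr.cost]
  refine ⟨by simp, ?_⟩
  refine Run.seq (Run.of_wp rfl (by simp; omega) fun hs => ?_)
  simp only [Prog.wp, Expr.eval, Expr.coef, Prog.time, Expr.cost, BinOp.eval]
  refine ⟨by simp [r5, a3, a7, a9, ha, hb]; omega, ?_⟩
  refine Run.mono (run_spliceProg (m := m + L + 1) (a := b) (c := s1.arr 15)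
    (S := splice a S {_y | s.arr 4 e = 1}) (S' := S) hW (by simp [r8]) (by simp [g2])
    (by simp [r5, a3, a7, a9, ha, hb]) rfl
    (hc.mono hWpos g3 (by omega)) (by simpa [g2] using g4)
    (by simpa [r12] using hS.mono g3 (by omega)) hbW (by omega) (by omega)) ?_
  rintro s2 k2 - - ⟨f1, f2, f3, f4⟩
  refine ⟨by omega, by omega, fun j hj => ?_, ?_⟩
  · rw [f3 j (by omega), g3 j hj]
  · rwa [splice_splice (by omega)] at f4

/-- All transversal pairs of the list that starts in register `5` are applied to the set represented
by register `10`. -/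
def applyProg : Prog :=
  .loop (var 5) (
    .assign 5 (bin .sub (var 5) (const 1)) ;;
    overwriteProg ;;
    .assign 5 (load 14 (var 5)))

theorem run_applyProg {L W m : ℕ} {c : ℕ → ℕ} {S : Set ℕ} {l : List ℕ} (hW : W = 2 ^ L)
    (h8 : s.reg 8 = W) (hm0 : s.reg 9 = m) (hc0 : s.arr 15 = c)
    (hl : IsLinkedList (s.arr 14) (s.reg 5) l)
    (hbW : ∀ e ∈ l, s.arr 9 (s.arr 3 e) + s.arr 7 (s.arr 3 e) < W) (hz : ∀ e ∈ l, s.arr 4 e ≤ 1)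
    (hc : SegStore c W m) (hS : SegTree c W m L 0 (s.reg 10) S)
    (hB : 2 * (m + (2 * L + 2) * l.length + 1) ≤ B) (hk : (200 * L + 170) * l.length + 5 ≤ k) :
    Run w B applyProg (fun s' k' => k ≤ k' + ((200 * L + 170) * l.length + 5) ∧
      s'.reg 9 = m + (2 * L + 2) * l.length ∧ (∀ j < 2 * m, s'.arr 15 j = c j) ∧
      SegTree (s'.arr 15) W (s'.reg 9) L 0 (s'.reg 10) (l.foldl (fun S e => overwrite
        (s.arr 9 (s.arr 3 e)) (s.arr 9 (s.arr 3 e) + s.arr 7 (s.arr 3 e)) (s.arr 4 e = 1) S) S))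
      s k := by
  have hWpos : 0 < W := hW ▸ Nat.two_pow_pos L
  obtain ⟨f, hf0⟩ : ∃ f, f = fun (S : Set ℕ) e => overwrite
    (s.arr 9 (s.arr 3 e)) (s.arr 9 (s.arr 3 e) + s.arr 7 (s.arr 3 e)) (s.arr 4 e = 1) S := ⟨_, rfl⟩
  rw [← hf0]
  refine Run.loop (fun s' k' => ∃ l₁ l₂, l = l₁ ++ l₂ ∧ IsLinkedList (s.arr 14) (s'.reg 5) l₂ ∧
    s'.reg 9 = m + (2 * L + 2) * l₁.length ∧ (∀ j < 2 * m, s'.arr 15 j = c j) ∧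
    k ≤ k' + (200 * L + 170) * l₁.length ∧
    SegTree (s'.arr 15) W (s'.reg 9) L 0 (s'.reg 10) (l₁.foldl f S)) rfl ?_ ?_
  · rintro s' k' hf hm ⟨l₁, l₂, rfl, h1, h2, h3, h4, h5⟩
    have e1 : ∀ x y, (2 * L + 2) * (x + y) = (2 * L + 2) * x + (2 * L + 2) * y :=
      fun _ _ => Nat.mul_add _ _ _
    have e2 : ∀ x y, (200 * L + 170) * (x + y) = (200 * L + 170) * x + (200 * L + 170) * y :=
      fun _ _ => Nat.mul_add _ _ _
    simp only [List.length_append, e1, e2] at hk hB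
    refine ⟨by simp; omega, fun he => ?_, fun he => ?_⟩
    · cases l₂ with
      | cons e l =>
        have := h1.1
        simp at he
        omega
      | nil =>
        simp only [List.append_nil]
        exact ⟨by simp; omega, h2, h3, h5⟩
    · cases l₂ with
      | nil => exact (he h1).elim
      | cons e l =>
        have r8 : s'.reg 8 = W := by simpa [h8] using hf.reg 8 (by decide)
        have a3 : s'.arr 3 = s.arr 3 := by simpa using hf.arr 3 (by decide)
        have a4 : s'.arr 4 = s.arr 4 := by simpa using hf.arr 4 (by decide)
        have a7 : s'.arr 7 = s.arr 7 := by simpa using hf.arr 7 (by decide)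
        have a9 : s'.arr 9 = s.arr 9 := by simpa using hf.arr 9 (by decide)
        have a14 : s'.arr 14 = s.arr 14 := by simpa using hf.arr 14 (by decide)
        obtain ⟨h6, h7⟩ := h1
        simp only [List.length_cons, e1, e2, mul_one] at hk hB
        refine Run.seq (Run.of_wp rfl (by simp; omega) fun hs => ?_)
        simp only [Prog.wp, Expr.eval, Expr.coef, Prog.time, Expr.cost, BinOp.eval]
        refine ⟨by simp, ?_⟩
        refine Run.then_ (run_overwriteProg (e := e) hW (by simp [r8]) rfl (by simp [h6])
          rfl rfl rfl
          (by simpa [h2] using hc.mono hWpos h3 (by omega)) (by simpa using h5)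
          (by simpa [a3, a7, a9] using hbW e (by simp)) (by simpa [a4] using hz e (by simp))
          (by simp [h2]; omega) (by omega)) ?_
        rintro s1 k1 hf1 hm1 ⟨g1, g2, g3, g4⟩
        have r5 : s1.reg 5 = e := by
          have := hf1.reg 5 (by decide)
          simpa [h6] using this
        have b14 : s1.arr 14 = s.arr 14 := by
          have := hf1.arr 14 (by decide)
          simpa [a14] using this
        refine Run.of_wp rfl (by simp; omega) fun hs => ?_
        simp [r5, b14]
        simp [h2] at g2 g3
        refine ⟨l₁ ++ [e], l, by simp, h7, ?_, ?_, ?_, ?_⟩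
        · simp only [List.length_append, List.length_singleton, e1, mul_one]; omega
        · intro j hj
          rw [g3 j (by have := Nat.zero_le ((2 * L + 2) * l₁.length); omega), h3 j hj]
        · simp only [List.length_append, List.length_singleton, e2, mul_one]; omega
        · rw [List.foldl_append, List.foldl_cons, List.foldl_nil]
          simpa [hf0, a3, a4, a7, a9] using g4
  · exact ⟨[], l, rfl, hl, by simp [hm0], fun j _ => by rw [hc0], Nat.le_add_right _ _,
      by simpa [hm0, hc0] using hS⟩

/-- For every node, a segment tree for the leaves that are positively covered together with it is
built from that of its parent. -/
def versionProg : Prog :=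
  .assign 4 (var 1) ;;
  .loop (bin .lt (const 0) (var 4)) (
    .assign 4 (bin .sub (var 4) (const 1)) ;;
    .assign 6 (load 1 (var 4)) ;;
    .assign 10 (load 16 (load 0 (var 6))) ;;
    .assign 5 (load 13 (var 6)) ;;
    applyProg ;;
    .store 16 (var 6) (var 10))

theorem run_versionProg {T : RootedTree} [Fintype T] {M : SignedTreeModel T} {ix : T → ℕ}
    {n L W m : ℕ} {rank f₁ f₂ f₃ : ℕ → ℕ} {row col : ℕ → T} (hix : Function.Injective ix)
    (hpar : ∀ t, s.arr 0 (ix t) = ix (Order.pred t))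
    (hP : Peel ix n (s.reg 1) (s.reg 1) (s.arr 1) f₁ f₂ f₃)
    (hlay : T.IsLayout n (fun t => s.arr 9 (ix t)) fun t => s.arr 7 (ix t))
    (hrow : ∀ e < 2 * s.reg 2, s.arr 2 e = ix (row e))
    (hcol : ∀ e < 2 * s.reg 2, s.arr 3 e = ix (col e))
    (hsign : ∀ e < 2 * s.reg 2, s.arr 4 e ≤ 1)
    (hmem : ∀ u v, s(u, v) ∈ M.neg ∪ M.pos ↔ ∃ e < 2 * s.reg 2, row e = u ∧ col e = v)
    (hpos : ∀ e < 2 * s.reg 2, s(row e, col e) ∈ M.pos ↔ s.arr 4 e = 1)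
    (hrank : ∀ j < s.reg 1, rank (s.arr 1 j) = j)
    (hbu : Buckets (s.arr 2) (fun e => rank (s.arr 3 e)) (Finset.range (2 * s.reg 2)) (s.arr 14)
      (s.arr 13))
    (hW : W = 2 ^ L) (h8 : s.reg 8 = W) (hnW : n < W) (h9 : s.reg 9 = m)
    (hc : SegStore (s.arr 15) W m) (h16 : ∀ x, s.arr 16 x = 0)
    (hB : 2 * (m + (2 * L + 2) * (2 * s.reg 2) + 1) ≤ B)
    (hk : 50 * s.reg 1 + (200 * L + 170) * (2 * s.reg 2) + 20 ≤ k) :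
    Run w B versionProg (fun s' k' =>
      k ≤ k' + (50 * s.reg 1 + (200 * L + 170) * (2 * s.reg 2) + 20) ∧
      s'.reg 9 ≤ m + (2 * L + 2) * (2 * s.reg 2) ∧ SegStore (s'.arr 15) W (s'.reg 9) ∧
      ∀ t, ∃ S, SegTree (s'.arr 15) W (s'.reg 9) L 0 (s'.arr 16 (ix t)) S ∧ (∀ q ∈ S, q < n) ∧
        ∀ y, IsMax y → (s.arr 9 (ix y) ∈ S ↔ M.CoveredPos t y)) s k := by
  have hWpos : 0 < W := hW ▸ Nat.two_pow_pos L
  have e1 : ∀ x y, (2 * L + 2) * (x + y) = (2 * L + 2) * x + (2 * L + 2) * y :=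
    fun _ _ => Nat.mul_add _ _ _
  have e2 : ∀ x y, (200 * L + 170) * (x + y) = (200 * L + 170) * x + (200 * L + 170) * y :=
    fun _ _ => Nat.mul_add _ _ _
  obtain ⟨Done, hDone⟩ : ∃ Done : ℕ → T → Prop, ∀ j t, Done j t ↔
    ∃ i, s.reg 1 - j ≤ i ∧ i < s.reg 1 ∧ s.arr 1 i = ix t := ⟨_, fun _ _ => Iff.rfl⟩
  refine Run.seq (Run.of_wp rfl (by simp; omega) fun hs => ?_)
  simp only [Prog.wp, Expr.eval, Expr.coef, Prog.time, Expr.cost]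
  refine ⟨by simp, ?_⟩
  refine Run.loop (fun s' k' => ∃ j ≤ s.reg 1, s'.reg 4 = s.reg 1 - j ∧
    SegStore (s'.arr 15) W (s'.reg 9) ∧
    (∃ D : Finset ℕ, D ⊆ Finset.range (2 * s.reg 2) ∧
      (∀ e ∈ D, Done j (row e)) ∧
      s'.reg 9 = m + (2 * L + 2) * D.card ∧
      k ≤ k' + (50 * j + (200 * L + 170) * D.card + 5)) ∧
    (∀ t, ¬ Done j t → s'.arr 16 (ix t) = 0) ∧
    ∀ t, Done j t →
      ∃ S, SegTree (s'.arr 15) W (s'.reg 9) L 0 (s'.arr 16 (ix t)) S ∧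
        (∀ q ∈ S, q < n) ∧ ∀ y, IsMax y → (s.arr 9 (ix y) ∈ S ↔ M.CoveredPos t y)) rfl ?_ ?_
  · rintro s' k' hf hm ⟨j, hj, h1, h2, ⟨D, h3, h4, h5, h6⟩, h7, h8'⟩
    have hD := Finset.card_le_card h3
    rw [Finset.card_range] at hD
    have hD1 := Nat.mul_le_mul_left (2 * L + 2) hD
    have hD2 := Nat.mul_le_mul_left (200 * L + 170) hD
    refine ⟨by simp; omega, fun he => ?_, fun he => ?_⟩
    · simp [h1] at he
      refine ⟨by simp; omega, by omega, h2, fun t => h8' t ?_⟩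
      obtain ⟨i, hi, hq⟩ := hP.exists_index rfl t
      exact (hDone _ _).2 ⟨i, by omega, hi, hq⟩
    · simp [h1] at he
      obtain ⟨i, hi0⟩ : ∃ i, s.reg 1 - j - 1 = i := ⟨_, rfl⟩
      have hi : i < s.reg 1 := by omega
      obtain ⟨u, hu⟩ := hP.queue i hi
      have r8 : s'.reg 8 = W := by simpa [h8] using hf.reg 8 (by decide)
      have a0 : s'.arr 0 = s.arr 0 := by simpa using hf.arr 0 (by decide)
      have a1 : s'.arr 1 = s.arr 1 := by simpa using hf.arr 1 (by decide)
      have a3 : s'.arr 3 = s.arr 3 := by simpa using hf.arr 3 (by decide)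
      have a4 : s'.arr 4 = s.arr 4 := by simpa using hf.arr 4 (by decide)
      have a7 : s'.arr 7 = s.arr 7 := by simpa using hf.arr 7 (by decide)
      have a9 : s'.arr 9 = s.arr 9 := by simpa using hf.arr 9 (by decide)
      have a13 : s'.arr 13 = s.arr 13 := by simpa using hf.arr 13 (by decide)
      have a14 : s'.arr 14 = s.arr 14 := by simpa using hf.arr 14 (by decide)
      obtain ⟨l, l1, l2, l3, l4⟩ := hbu (ix u)
      have hlm : ∀ e, e ∈ l ↔ e < 2 * s.reg 2 ∧ row e = u := fun e => by
        rw [l3, Finset.mem_range]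
        exact and_congr_right fun he => by rw [hrow e he, hix.eq_iff]
      have hkey : ∀ t : T, Done (j + 1) t ↔ t = u ∨ Done j t := by
        intro t
        rw [hDone, hDone]
        constructor
        · rintro ⟨i', g1, g2, g3⟩
          by_cases he : i' = i
          · subst he
            exact .inl (hix (g3.symm.trans hu))
          · exact .inr ⟨i', by omega, g2, g3⟩
        · rintro (rfl | ⟨i', g1, g2, g3⟩)
          · exact ⟨i, by omega, hi, hu⟩
          · exact ⟨i', by omega, g2, g3⟩
      have hunew : ¬ Done j u := by
        rw [hDone]
        rintro ⟨i', g1, g2, g3⟩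
        have := hP.inj i' g2 i hi (g3.trans hu.symm)
        omega
      have hdisj : Disjoint D l.toFinset := by
        rw [Finset.disjoint_left]
        intro e he hel
        have := h4 e he
        rw [((hlm e).1 (by simpa using hel)).2] at this
        exact hunew this
      have hsub : D ∪ l.toFinset ⊆ Finset.range (2 * s.reg 2) :=
        Finset.union_subset h3 fun e he => ((l3 e).1 (by simpa using he)).1
      have hcu : (D ∪ l.toFinset).card = D.card + l.length := by
        rw [Finset.card_union_of_disjoint hdisj, List.toFinset_card_of_nodup l2]
      have hle := Finset.card_le_card hsub
      rw [hcu, Finset.card_range] at hle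
      have hle1 := Nat.mul_le_mul_left (2 * L + 2) hle
      have hle2 := Nat.mul_le_mul_left (200 * L + 170) hle
      rw [e1] at hle1
      rw [e2] at hle2
      obtain ⟨S₀, hS₀, hSn, hS₀'⟩ : ∃ S, SegTree (s'.arr 15) W (s'.reg 9) L 0
          (s'.arr 16 (ix (Order.pred u))) S ∧ (∀ q ∈ S, q < n) ∧ ∀ y, IsMax y →
            (s.arr 9 (ix y) ∈ S ↔ u ≠ ⊥ ∧ M.CoveredPos (Order.pred u) y) := by
        by_cases hb : u = ⊥
        · subst hb
          refine ⟨∅, ?_, by simp, by simp⟩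
          rw [Order.pred_bot, h7 _ hunew]
          exact SegTree.zero (by simp)
        · obtain ⟨i', g1, g2, g3⟩ := hP.parent_index rfl hi hu (pred_covBy hb)
          obtain ⟨S, g4, g4', g5⟩ := h8' (Order.pred u) ((hDone _ _).2 ⟨i', by omega, g2, g3⟩)
          exact ⟨S, g4, g4', by simpa [hb] using g5⟩
      refine Run.seq (Run.of_wp rfl (by simp; omega) fun hs => ?_)
      simp only [Prog.wp, Expr.eval, Expr.coef, Prog.time, Expr.cost, BinOp.eval]
      refine ⟨by simp, ?_⟩
      refine Run.seq (Run.of_wp rfl (by simp; omega) fun hs => ?_)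
      simp only [Prog.wp, Expr.eval, Expr.coef, Prog.time, Expr.cost]
      refine ⟨by simp, ?_⟩
      refine Run.seq (Run.of_wp rfl (by simp; omega) fun hs => ?_)
      simp only [Prog.wp, Expr.eval, Expr.coef, Prog.time, Expr.cost]
      refine ⟨by simp, ?_⟩
      refine Run.seq (Run.of_wp rfl (by simp; omega) fun hs => ?_)
      simp only [Prog.wp, Expr.eval, Expr.coef, Prog.time, Expr.cost]
      refine ⟨by simp, ?_⟩
      refine Run.then_ (run_applyProg (l := l) (S := S₀) (m := s'.reg 9) (c := s'.arr 15) hW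
        (by simp [r8]) (by simp) (by simp) (by simpa [h1, hi0, a1, hu, a13, a14] using l1)
        (fun e he => ?_) (fun e he => ?_) h2 (by simpa [h1, hi0, a0, a1, hu, hpar] using hS₀)
        (by omega) (by omega)) ?_
      · have := hlay.le_bound (col e)
        simp only [State.setReg_arr, a7, a9, a3, hcol e ((hlm e).1 he).1]
        omega
      · simp only [State.setReg_arr, a4]
        exact hsign e ((hlm e).1 he).1
      rintro s1 k1 hf1 hm1 ⟨g1, g2, g3, g4⟩
      simp only [State.setReg_arr, a3, a4, a7, a9] at g4
      have r4 : s1.reg 4 = i := by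
        have := hf1.reg 4 (by decide)
        simpa [h1, hi0] using this
      have r6 : s1.reg 6 = ix u := by
        have := hf1.reg 6 (by decide)
        simpa [h1, hi0, a1, hu] using this
      have b16 : s1.arr 16 = s'.arr 16 := by
        have := hf1.arr 16 (by decide)
        simpa using this
      refine Run.of_wp rfl (by simp; omega) fun hs => ?_
      simp [r4, r6, b16]
      refine ⟨j + 1, by omega, by omega, h2.mono hWpos g3 (by omega),
        ⟨D ∪ l.toFinset, hsub, fun e he => ?_, ?_, ?_⟩, fun t ht => ?_, fun t ht => ?_⟩
      · rcases Finset.mem_union.1 he with he | he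
        · exact (hkey _).2 (.inr (h4 e he))
        · exact (hkey _).2 (.inl ((hlm e).1 (by simpa using he)).2)
      · rw [hcu, e1, g2]; omega
      · rw [hcu, e2]; omega
      · rw [hkey, not_or] at ht
        rw [Function.update_of_ne (hix.ne ht.1)]
        exact h7 t ht.2
      · rcases (hkey t).1 ht with rfl | ht
        · refine ⟨_, by rw [Function.update_self]; exact g4, fun q hq => ?_, fun y hy => ?_⟩
          · rcases mem_foldl_overwrite (fun e => s.arr 9 (s.arr 3 e))
              (fun e => s.arr 9 (s.arr 3 e) + s.arr 7 (s.arr 3 e)) (fun e => s.arr 4 e = 1) q l S₀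
              with ⟨-, f1⟩ | ⟨l₁, e, l₂, rfl, f1, -⟩
            · exact hSn q (f1.1 hq)
            · have := hlay.le_bound (col e)
              rw [hcol e ((hlm e).1 (by simp)).1] at f1
              omega
          have := mem_foldl_iff_coveredPos hlay hmem hpos (u := t) (l := l) hlm ?_ hS₀' y hy
          · rw [← this]
            refine iff_of_eq (congrArg (s.arr 9 (ix y) ∈ ·) (List.foldl_ext _ _ _ fun S e he => ?_))
            simp only [hcol e ((hlm e).1 he).1]
          · refine l4.imp_of_mem fun {e e'} he he' hr hlt => ?_
            obtain ⟨i₁, f1, f2⟩ := hP.exists_index rfl (col e)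
            obtain ⟨i₂, f3, f4⟩ := hP.exists_index rfl (col e')
            have := hP.index_lt rfl f1 f3 f2 f4 hlt
            beta_reduce at hr
            rw [hcol e ((hlm e).1 he).1, hcol e' ((hlm e').1 he').1, ← f2, ← f4, hrank _ f1,
              hrank _ f3] at hr
            omega
        · have htu : t ≠ u := by
            rintro rfl
            exact hunew ht
          obtain ⟨S, f1, f2, f3⟩ := h8' t ht
          rw [Function.update_of_ne (hix.ne htu)]
          exact ⟨S, f1.mono g3 (by omega), f2, f3⟩
  · refine ⟨0, Nat.zero_le _, by simp, by simpa [h9] using hc,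
      ⟨∅, by simp, by simp, by simp [h9], by simp; omega⟩, fun t _ => by simp [h16], ?_⟩
    intro t ht
    obtain ⟨i, h1, h2, -⟩ := (hDone _ _).1 ht
    omega

end WordRAM

/-! ### Breadth-first search on a graph whose neighbourhoods are stored in segment trees -/

/-- The state of the search: `queue` lists the `tail` vertices found so far, of which the first
`head` have been taken out, `x` being the last one of them; `mark` marks the segment tree nodes that
have been visited, and `stack` holds `sp` segment tree nodes to be visited. -/
structure Bfs {n : ℕ} (G : SimpleGraph (Fin n)) (r : Fin n) (c : ℕ → ℕ) (W m : ℕ)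
    (ver pos : Fin n → ℕ) (head tail sp x : ℕ) (par mark stack queue : ℕ → ℕ) : Prop where
  head_le : head ≤ tail
  tail_pos : 0 < tail
  queue_lt : ∀ i < tail, queue i < n
  queue_inj : ∀ i < tail, ∀ j < tail, queue i = queue j → i = j
  visited : ∀ y : Fin n, par y ≠ n ↔ ∃ i < tail, queue i = y
  queue_zero : queue 0 = r
  par_root : par r = r
  reachable : ∀ y : Fin n, par y ≠ n → G.Reachable r y
  parent : ∀ y : Fin n, par y ≠ n → y ≠ r → ∃ w : Fin n, par y = w ∧ (∃ i < head, queue i = w) ∧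
    G.Adj w y ∧ G.dist r w + 1 = G.dist r y
  sorted : ∀ i j (y z : Fin n), i ≤ j → j < tail → queue i = y → queue j = z →
    G.dist r y ≤ G.dist r z
  finished : ∀ i (y z : Fin n), i + 1 < head → queue i = y → G.Adj y z → par z ≠ n
  current : 0 < head → queue (head - 1) = x
  started : sp ≠ 0 → 0 < head
  mark_zero : mark 0 ≠ 0
  mark_lt : ∀ id, mark id ≠ 0 → id < m
  closed : ∀ id, mark id ≠ 0 → 0 < id → (id < W ∨ 2 * W ≤ id) →
    (mark (c (2 * id)) ≠ 0 ∨ ∃ i < sp, stack i = c (2 * id)) ∧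
    (mark (c (2 * id + 1)) ≠ 0 ∨ ∃ i < sp, stack i = c (2 * id + 1))
  leaf : ∀ y : Fin n, mark (W + pos y) ≠ 0 → par y ≠ n
  version : ∀ z : Fin n, 0 < head → x = z → mark (ver z) ≠ 0 ∨ ∃ i < sp, stack i = ver z
  stack : ∀ i < sp, ∃ l a S, SegTree c W m l a (stack i) S ∧ ∀ q ∈ S, a ≤ q → q < a + 2 ^ l →
    ∃ y z : Fin n, x = z ∧ pos y = q ∧ G.Adj z y

namespace Bfs

variable {n : ℕ} {G : SimpleGraph (Fin n)} {r : Fin n} {c : ℕ → ℕ} {W m : ℕ}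
  {ver pos : Fin n → ℕ} {head tail sp x : ℕ} {par mark stack queue : ℕ → ℕ}

theorem tail_le (h : Bfs G r c W m ver pos head tail sp x par mark stack queue) : tail ≤ n := by
  have : Fintype.card (Fin tail) ≤ Fintype.card (Fin n) :=
    Fintype.card_le_of_injective (fun i => (⟨queue i, h.queue_lt i i.2⟩ : Fin n)) fun i j hij =>
      Fin.ext (h.queue_inj i i.2 j j.2 (by simpa using hij))
  simpa using this

theorem exists_pred {y : Fin n} (hy : G.Reachable r y) (hne : y ≠ r) :
    ∃ z, G.Adj z y ∧ G.Reachable r z ∧ G.dist r z + 1 = G.dist r y := by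
  obtain ⟨p, hp⟩ := hy.exists_walk_length_eq_dist
  obtain ⟨z, q, hz, rfl⟩ : ∃ (z : Fin n) (q : G.Walk r z) (hz : G.Adj z y), p = q.concat hz := by
    cases p with
    | nil => exact (hne rfl).elim
    | cons h p =>
      obtain ⟨z, q, hz, he⟩ := SimpleGraph.Walk.exists_cons_eq_concat h p
      exact ⟨z, q, hz, he⟩
  refine ⟨z, hz, ⟨q⟩, ?_⟩
  rw [SimpleGraph.Walk.length_concat] at hp
  have h1 := SimpleGraph.dist_le q
  obtain ⟨q', hq'⟩ := q.reachable.exists_walk_length_eq_dist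
  have h2 := SimpleGraph.dist_le (q'.concat hz)
  rw [SimpleGraph.Walk.length_concat] at h2
  omega

/-- All vertices that are closer to the root than the current one have been treated. -/
theorem exists_index_of_dist_lt (h : Bfs G r c W m ver pos head tail sp x par mark stack queue)
    (hh : 0 < head) {z : Fin n} (hz : x = z) {y : Fin n} (hy : G.Reachable r y)
    (hd : G.dist r y < G.dist r z) : ∃ i, i + 1 < head ∧ queue i = y := by
  have hcur := h.current hh
  have hle := h.head_le
  have key : ∀ i < tail, ∀ y : Fin n, G.dist r y < G.dist r z → queue i = y → i + 1 < head := by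
    intro i hi y hd hq
    by_contra hlt
    have := h.sorted (head - 1) i z y (by omega) hi (hcur.trans hz) hq
    omega
  obtain ⟨d, hd'⟩ : ∃ d, G.dist r y = d := ⟨_, rfl⟩
  induction d generalizing y with
  | zero =>
    have := (hy.dist_eq_zero_iff).1 hd'
    subst this
    exact ⟨0, key 0 h.tail_pos _ hd h.queue_zero, h.queue_zero⟩
  | succ d ih =>
    have hne : y ≠ r := by
      rintro rfl
      simp at hd'
    obtain ⟨u, hu, hru, hdu⟩ := exists_pred hy hne
    obtain ⟨i, hi, hq⟩ := ih hru (by omega) (by omega)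
    obtain ⟨j, hj, hq'⟩ := (h.visited y).1 (h.finished i u y hi hq hu)
    exact ⟨j, key j hj y hd hq', hq'⟩

theorem current_visited (h : Bfs G r c W m ver pos head tail sp x par mark stack queue)
    (hh : 0 < head) {z : Fin n} (hz : x = z) : par z ≠ n :=
  (h.visited z).2 ⟨head - 1, by have := h.head_le; omega, (h.current hh).trans hz⟩

theorem dist_eq_of_new (h : Bfs G r c W m ver pos head tail sp x par mark stack queue)
    (hh : 0 < head) {z y : Fin n} (hz : x = z) (hy : G.Adj z y) (hn : par y = n) :
    G.dist r z + 1 = G.dist r y := by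
  have hrz := h.reachable z (h.current_visited hh hz)
  have hry : G.Reachable r y := hrz.trans hy.reachable
  have hle : G.dist r y ≤ G.dist r z + 1 := by
    obtain ⟨q, hq⟩ := hrz.exists_walk_length_eq_dist
    have := SimpleGraph.dist_le (q.concat hy)
    rwa [SimpleGraph.Walk.length_concat, hq] at this
  refine le_antisymm ?_ hle
  by_contra hlt
  have hne : y ≠ r := by
    rintro rfl
    rw [h.par_root] at hn
    exact y.2.ne hn
  obtain ⟨u, hu, hru, hdu⟩ := exists_pred hry hne
  obtain ⟨i, hi, hq⟩ := h.exists_index_of_dist_lt hh hz hru (by omega)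
  exact h.finished i u y hi hq hu hn

theorem initial (hr : ∀ y, y < n → par y = if y = r then y else n) (hq : queue 0 = r)
    (hm : ∀ id, mark id ≠ 0 ↔ id = 0) (hm0 : 0 < m) (hW : 0 < W) :
    Bfs G r c W m ver pos 0 1 0 x par mark stack queue where
  head_le := by omega
  tail_pos := by omega
  queue_lt i hi := by
    obtain rfl : i = 0 := by omega
    rw [hq]; exact r.2
  queue_inj i hi j hj _ := by omega
  visited y := by
    rw [hr y y.2]
    constructor
    · intro hy
      split_ifs at hy with h
      · exact ⟨0, by omega, by rw [hq, h]⟩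
      · exact (hy rfl).elim
    · rintro ⟨i, hi, he⟩
      obtain rfl : i = 0 := by omega
      rw [hq] at he
      rw [if_pos he.symm]
      exact y.2.ne
  queue_zero := hq
  par_root := by rw [hr r r.2, if_pos rfl]
  reachable y hy := by
    rw [hr y y.2] at hy
    split_ifs at hy with h
    · rw [Fin.ext h]
    · exact (hy rfl).elim
  parent y hy hne := by
    rw [hr y y.2] at hy
    split_ifs at hy with h
    · exact (hne (Fin.ext h)).elim
    · exact (hy rfl).elim
  sorted i j y z hij hj hy hz := by
    obtain rfl : j = 0 := by omega
    obtain rfl : i = 0 := by omega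
    rw [Fin.ext (hy.symm.trans hz)]
  finished i y z hi := by omega
  current h := by omega
  started h := (h rfl).elim
  mark_zero := (hm 0).2 rfl
  mark_lt id hid := by rw [(hm id).1 hid]; exact hm0
  closed id hid h0 := by rw [(hm id).1 hid] at h0; omega
  leaf y hy := by have := (hm _).1 hy; omega
  version z h := by omega
  stack i hi := by omega

theorem pop_marked (h : Bfs G r c W m ver pos head tail (sp + 1) x par mark stack queue)
    (hm : mark (stack sp) ≠ 0) : Bfs G r c W m ver pos head tail sp x par mark stack queue := by
  have key : ∀ id, (mark id ≠ 0 ∨ ∃ i < sp + 1, stack i = id) →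
      (mark id ≠ 0 ∨ ∃ i < sp, stack i = id) := by
    rintro id (h1 | ⟨i, hi, rfl⟩)
    · exact .inl h1
    · by_cases he : i = sp
      · exact .inl (he ▸ hm)
      · exact .inr ⟨i, by omega, rfl⟩
  exact
    { h with
      started := fun _ => h.started (by omega)
      closed := fun id h1 h2 h3 =>
        ⟨key _ (h.closed id h1 h2 h3).1, key _ (h.closed id h1 h2 h3).2⟩
      version := fun z h1 h2 => key _ (h.version z h1 h2)
      stack := fun i hi => h.stack i (by omega) }

theorem top_lt (h : Bfs G r c W m ver pos head tail (sp + 1) x par mark stack queue) :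
    stack sp < m := by
  obtain ⟨l, a, S, h1, -⟩ := h.stack sp (by omega)
  exact h1.lt (Nat.zero_lt_of_lt (h.mark_lt 0 h.mark_zero))

theorem pop_inner (h : Bfs G r c W m ver pos head tail (sp + 1) x par mark stack queue)
    (hc0 : c 0 = 0) (hc1 : c 1 = 0)
    {id : ℕ} (hid : stack sp = id) (hi : id < W ∨ 2 * W ≤ id) (hm : mark id = 0)
    (hpos : ∀ y, pos y < W) :
    Bfs G r c W m ver pos head tail (sp + 2) x par (Function.update mark id 1)
      (Function.update (Function.update stack sp (c (2 * id))) (sp + 1) (c (2 * id + 1)))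
      queue := by
  obtain ⟨st, hst⟩ : ∃ st, st =
    Function.update (Function.update stack sp (c (2 * id))) (sp + 1) (c (2 * id + 1)) := ⟨_, rfl⟩
  have s1 : ∀ i < sp, st i = stack i := fun i hi => by
    rw [hst, Function.update_of_ne (by omega), Function.update_of_ne (by omega)]
  have s2 : st sp = c (2 * id) := by
    rw [hst, Function.update_of_ne (by omega), Function.update_self]
  have s3 : st (sp + 1) = c (2 * id + 1) := by rw [hst, Function.update_self]
  rw [← hst]
  have mk : ∀ id', Function.update mark id 1 id' ≠ 0 ↔ id' = id ∨ mark id' ≠ 0 := by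
    intro id'
    by_cases he : id' = id
    · simp [he]
    · simp [he]
  have key : ∀ id', (mark id' ≠ 0 ∨ ∃ i < sp + 1, stack i = id') →
      (Function.update mark id 1 id' ≠ 0 ∨ ∃ i < sp + 2, st i = id') := by
    rintro id' (h1 | ⟨i, hi, rfl⟩)
    · exact .inl ((mk _).2 (.inr h1))
    · by_cases he : i = sp
      · exact .inl ((mk _).2 (.inl (by rw [he, hid])))
      · exact .inr ⟨i, by omega, s1 i (by omega)⟩
  have hidm : id < m := hid ▸ h.top_lt
  obtain ⟨l, a, S, h1, h2⟩ := h.stack sp (by omega)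
  rw [hid] at h1
  have hid0 : id ≠ 0 := fun h0 => h.mark_zero (h0 ▸ hm)
  have hl : ∃ l', l = l' + 1 := by
    cases l with
    | zero =>
      exfalso
      rcases h1 with ⟨h3, -⟩ | ⟨h3, -, h5⟩
      · exact hid0 h3
      · obtain ⟨y, z, -, hy, -⟩ := h2 a h5 le_rfl (by simp)
        have := hpos y
        omega
    | succ l => exact ⟨l, rfl⟩
  obtain ⟨l, rfl⟩ := hl
  rw [pow_succ] at h2
  exact
    { h with
      started := fun _ => h.started (by omega)
      mark_zero := (mk 0).2 (.inr h.mark_zero)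
      mark_lt := fun id' h3 => ((mk id').1 h3).elim (fun h4 => h4 ▸ hidm) (h.mark_lt id')
      closed := fun id' h3 h4 h5 => by
        rcases (mk id').1 h3 with rfl | h3
        · exact ⟨.inr ⟨sp, by omega, s2⟩, .inr ⟨sp + 1, by omega, s3⟩⟩
        · exact ⟨key _ (h.closed id' h3 h4 h5).1, key _ (h.closed id' h3 h4 h5).2⟩
      leaf := fun y hy => by
        rcases (mk _).1 hy with h3 | h3
        · have := hpos y
          omega
        · exact h.leaf y h3
      version := fun z h3 h4 => key _ (h.version z h3 h4)
      stack := fun i hi => by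
        by_cases e1 : i < sp
        · rw [s1 i e1]
          exact h.stack i (by omega)
        · by_cases e2 : i = sp
          · rw [e2, s2]
            exact ⟨l, a, S, h1.left hc0, fun q hq h3 h4 => h2 q hq h3 (by omega)⟩
          · rw [show i = sp + 1 by omega, s3]
            exact ⟨l, a + 2 ^ l, S, h1.right hc1, fun q hq h3 h4 => h2 q hq (by omega) (by omega)⟩ }

theorem top_leaf (h : Bfs G r c W m ver pos head tail (sp + 1) x par mark stack queue)
    {id : ℕ} (hid : stack sp = id) (hi : ¬ (id < W ∨ 2 * W ≤ id)) :
    ∃ y z : Fin n, x = z ∧ id = W + pos y ∧ G.Adj z y := by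
  obtain ⟨l, a, S, h1, h2⟩ := h.stack sp (by omega)
  rw [hid] at h1
  cases l with
  | zero =>
    rcases h1 with ⟨h3, -⟩ | ⟨h3, -, h5⟩
    · omega
    · obtain ⟨y, z, hz, hy, ha⟩ := h2 a h5 le_rfl (by simp)
      exact ⟨y, z, hz, by omega, ha⟩
  | succ l =>
    rcases h1 with ⟨h3, -⟩ | ⟨-, -, h3, -⟩
    · omega
    · exact (hi h3).elim

/-- Visiting a leaf of a segment tree that belongs to a vertex found before. -/
theorem pop_leaf (h : Bfs G r c W m ver pos head tail (sp + 1) x par mark stack queue)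
    (hinj : Function.Injective pos)
    {id : ℕ} (hid : stack sp = id) (hi : ¬ (id < W ∨ 2 * W ≤ id)) {y : Fin n}
    (hy : id = W + pos y) (hp : par y ≠ n) :
    Bfs G r c W m ver pos head tail sp x par (Function.update mark id 1) stack queue := by
  have mk : ∀ id', Function.update mark id 1 id' ≠ 0 ↔ id' = id ∨ mark id' ≠ 0 := by
    intro id'
    by_cases he : id' = id
    · simp [he]
    · simp [he]
  have key : ∀ id', (mark id' ≠ 0 ∨ ∃ i < sp + 1, stack i = id') →
      (Function.update mark id 1 id' ≠ 0 ∨ ∃ i < sp, stack i = id') := by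
    rintro id' (h1 | ⟨i, hi, rfl⟩)
    · exact .inl ((mk _).2 (.inr h1))
    · by_cases he : i = sp
      · exact .inl ((mk _).2 (.inl (by rw [he, hid])))
      · exact .inr ⟨i, by omega, rfl⟩
  have hidm : id < m := hid ▸ h.top_lt
  exact
    { h with
      started := fun _ => h.started (by omega)
      mark_zero := (mk 0).2 (.inr h.mark_zero)
      mark_lt := fun id' h3 => ((mk id').1 h3).elim (fun h4 => h4 ▸ hidm) (h.mark_lt id')
      closed := fun id' h3 h4 h5 => by
        rcases (mk id').1 h3 with rfl | h3
        · exact (hi h5).elim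
        · exact ⟨key _ (h.closed id' h3 h4 h5).1, key _ (h.closed id' h3 h4 h5).2⟩
      leaf := fun y' hy' => by
        rcases (mk _).1 hy' with h3 | h3
        · rw [hinj (show pos y' = pos y by omega)]
          exact hp
        · exact h.leaf y' h3
      version := fun z h3 h4 => key _ (h.version z h3 h4)
      stack := fun i hi => h.stack i (by omega) }

/-- A neighbour of the current vertex that has not been found before is added to the queue. -/
theorem push (h : Bfs G r c W m ver pos head tail sp x par mark stack queue) (hh : 0 < head)
    {y z : Fin n} (hz : x = z) (hy : G.Adj z y) (hn : par y = n) :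
    Bfs G r c W m ver pos head (tail + 1) sp x (Function.update par y x) mark stack
      (Function.update queue tail y) := by
  have hle := h.head_le
  have q1 : ∀ i < tail, Function.update queue tail (y : ℕ) i = queue i :=
    fun i hi => Function.update_of_ne (by omega) _ _
  have q2 : Function.update queue tail (y : ℕ) tail = y := Function.update_self _ _ _
  have p1 : ∀ u : Fin n, u ≠ y → Function.update par (y : ℕ) x u = par u :=
    fun u hu => Function.update_of_ne (fun he => hu (Fin.ext he)) _ _
  have p2 : Function.update par (y : ℕ) x y = x := Function.update_self _ _ _
  have hdist := h.dist_eq_of_new hh hz hy hn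
  have hnot : ¬ ∃ i < tail, queue i = y := fun hi => (h.visited y).2 hi hn
  have hmono : ∀ u : Fin n, par u ≠ n → Function.update par (y : ℕ) x u ≠ n := by
    intro u hu
    have : u ≠ y := by rintro rfl; exact hu hn
    rwa [p1 u this]
  have hrz := h.reachable z (h.current_visited hh hz)
  have hyr : y ≠ r := by
    rintro rfl
    exact hnot ⟨0, h.tail_pos, h.queue_zero⟩
  have hfar : ∀ i < tail, ∀ u : Fin n, queue i = u → G.dist r u ≤ G.dist r y := by
    intro i hi u hu
    by_cases hur : u = r
    · subst hur; simp
    · obtain ⟨v, -, ⟨j, hj, hq⟩, -, hd⟩ := h.parent u ((h.visited u).2 ⟨i, hi, hu⟩) hur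
      have := h.sorted j (head - 1) v z (by omega) (by omega) hq ((h.current hh).trans hz)
      omega
  exact
    { h with
      head_le := by omega
      tail_pos := by omega
      queue_lt := fun i hi => by
        by_cases he : i = tail
        · rw [he, q2]; exact y.2
        · rw [q1 i (by omega)]; exact h.queue_lt i (by omega)
      queue_inj := fun i hi j hj hij => by
        by_cases he : i = tail <;> by_cases he' : j = tail
        · omega
        · rw [he, q2, q1 j (by omega)] at hij
          exact (hnot ⟨j, by omega, hij.symm⟩).elim
        · rw [he', q2, q1 i (by omega)] at hij
          exact (hnot ⟨i, by omega, hij⟩).elim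
        · rw [q1 i (by omega), q1 j (by omega)] at hij
          exact h.queue_inj i (by omega) j (by omega) hij
      visited := fun u => by
        by_cases hu : u = y
        · subst hu
          rw [p2]
          exact ⟨fun _ => ⟨tail, by omega, q2⟩, fun _ => hz ▸ z.2.ne⟩
        · rw [p1 u hu, h.visited]
          constructor
          · rintro ⟨i, hi, he⟩
            exact ⟨i, by omega, by rw [q1 i hi, he]⟩
          · rintro ⟨i, hi, he⟩
            by_cases hit : i = tail
            · rw [hit, q2] at he
              exact (hu (Fin.ext he.symm)).elim
            · exact ⟨i, by omega, by rw [← q1 i (by omega), he]⟩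
      queue_zero := by rw [q1 0 h.tail_pos, h.queue_zero]
      par_root := by rw [p1 r hyr.symm, h.par_root]
      reachable := fun u hu => by
        by_cases he : u = y
        · rw [he]; exact hrz.trans hy.reachable
        · rw [p1 u he] at hu; exact h.reachable u hu
      parent := fun u hu hur => by
        by_cases he : u = y
        · subst he
          exact ⟨z, by rw [p2, hz], ⟨head - 1, by omega,
            by rw [q1 _ (by omega), h.current hh, hz]⟩, hy, hdist⟩
        · rw [p1 u he] at hu ⊢
          obtain ⟨v, h1, ⟨i, hi, hq⟩, h3⟩ := h.parent u hu hur
          exact ⟨v, h1, ⟨i, hi, by rw [q1 i (by omega), hq]⟩, h3⟩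
      sorted := fun i j u v hij hj hu hv => by
        by_cases he : j = tail
        · have hvy : v = y := Fin.ext (by rw [← hv, he, q2])
          subst hvy
          by_cases he' : i = tail
          · have : u = v := Fin.ext (by rw [← hu, he', q2])
            rw [this]
          · rw [q1 i (by omega)] at hu
            exact hfar i (by omega) u hu
        · rw [q1 j (by omega)] at hv
          rw [q1 i (by omega)] at hu
          exact h.sorted i j u v hij (by omega) hu hv
      finished := fun i u v hi hu huv => by
        rw [q1 i (by omega)] at hu
        exact hmono v (h.finished i u v hi hu huv)
      current := fun hh => by rw [q1 _ (by omega), h.current hh]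
      leaf := fun u hu => hmono u (h.leaf u hu) }

/-- When the stack is empty, all neighbours of the current vertex have been found. -/
theorem current_finished (h : Bfs G r c W m ver pos head tail 0 x par mark stack queue)
    {L : ℕ} (hpos : ∀ y, pos y < 2 ^ L)
    (hver : ∀ x, ∃ S, SegTree c W m L 0 (ver x) S ∧ (∀ q ∈ S, ∃ y, pos y = q) ∧
      ∀ y, pos y ∈ S ↔ G.Adj x y) (hh : 0 < head) {z y : Fin n} (hz : x = z) (hy : G.Adj z y) :
    par y ≠ n := by
  obtain ⟨S, h1, -, h2⟩ := hver z
  refine h.leaf y (h1.leaf_mem (X := {id | mark id ≠ 0}) (fun id hid h3 h4 => ?_) ?_ _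
    ((h2 y).2 hy) (Nat.zero_le _) (by simpa using hpos y))
  · have := h.closed id hid h3 h4
    simpa using this
  · simpa using h.version z hh hz

theorem finished_of_empty (h : Bfs G r c W m ver pos head tail 0 x par mark stack queue)
    {L : ℕ} (hpos : ∀ y, pos y < 2 ^ L)
    (hver : ∀ x, ∃ S, SegTree c W m L 0 (ver x) S ∧ (∀ q ∈ S, ∃ y, pos y = q) ∧
      ∀ y, pos y ∈ S ↔ G.Adj x y) {i : ℕ} (hi : i < head) {y z : Fin n} (hq : queue i = y)
    (hy : G.Adj y z) : par z ≠ n := by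
  by_cases he : i + 1 < head
  · exact h.finished i y z he hq hy
  · have := h.current (by omega)
    rw [show head - 1 = i by omega, hq] at this
    exact h.current_finished hpos hver (by omega) this.symm hy

/-- The next vertex is taken from the queue. -/
theorem dequeue (h : Bfs G r c W m ver pos head tail 0 x par mark stack queue)
    {L : ℕ} (hpos : ∀ y, pos y < 2 ^ L)
    (hver : ∀ x, ∃ S, SegTree c W m L 0 (ver x) S ∧ (∀ q ∈ S, ∃ y, pos y = q) ∧
      ∀ y, pos y ∈ S ↔ G.Adj x y) (hlt : head < tail) {z : Fin n} (hz : queue head = z) :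
    Bfs G r c W m ver pos (head + 1) tail 1 z par mark (Function.update stack 0 (ver z)) queue :=
  { h with
    head_le := by omega
    parent := fun u hu hur => by
      obtain ⟨v, h1, ⟨i, hi, hq⟩, h3⟩ := h.parent u hu hur
      exact ⟨v, h1, ⟨i, by omega, hq⟩, h3⟩
    finished := fun i u v hi hu huv => h.finished_of_empty hpos hver (by omega) hu huv
    current := fun _ => hz
    started := fun _ => by omega
    closed := fun id h1 h2 h3 => by
      have := h.closed id h1 h2 h3
      simp only [not_lt_zero, false_and, exists_false, or_false] at this
      exact ⟨.inl this.1, .inl this.2⟩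
    version := fun u _ hu => .inr ⟨0, by omega, by rw [Function.update_self, Fin.ext hu]⟩
    stack := fun i hi => by
      obtain rfl : i = 0 := by omega
      obtain ⟨S, h1, h2, h3⟩ := hver z
      refine ⟨L, 0, S, by rwa [Function.update_self], fun q hq _ _ => ?_⟩
      obtain ⟨y, rfl⟩ := h2 q hq
      exact ⟨y, z, rfl, rfl, (h3 y).1 hq⟩ }

theorem exists_tree (h : Bfs G r c W m ver pos head tail 0 x par mark stack queue)
    {L : ℕ} (hpos : ∀ y, pos y < 2 ^ L)
    (hver : ∀ x, ∃ S, SegTree c W m L 0 (ver x) S ∧ (∀ q ∈ S, ∃ y, pos y = q) ∧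
      ∀ y, pos y ∈ S ↔ G.Adj x y) (hlt : head = tail) :
    ∃ H : G.Subgraph, IsShortestPathTree G r H ∧ StoresRootedTree H r par := by
  have hall : ∀ y, G.Reachable r y → par y ≠ n := by
    rintro y ⟨p⟩
    have : ∀ (u v : Fin n) (p : G.Walk u v), par u ≠ n → par v ≠ n := by
      intro u v p
      induction p with
      | nil => exact id
      | cons huv p ih =>
        intro hu
        obtain ⟨i, hi, hq⟩ := (h.visited _).1 hu
        exact ih (h.finished_of_empty hpos hver (hlt ▸ hi) hq huv)
    exact this r y p (by rw [h.par_root]; exact r.2.ne)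
  refine exists_isShortestPathTree h.par_root (fun u hu hur => ?_) fun u hu => ?_
  · obtain ⟨w, h1, -, h3⟩ := h.parent u (hall u hu) hur
    exact ⟨w, h1, h3⟩
  · by_contra hne
    exact hu (h.reachable u hne)

end Bfs

namespace WordRAM

open WordRAM.Expr RootedTree

variable {w B k : ℕ} {s : State}

/-- One step of the search: the segment tree node on top of the stack is visited, or, if the stack
is empty, the next vertex is taken from the queue. -/
def bfsStep : Prog :=
  .ite (var 6) (
    .assign 6 (bin .sub (var 6) (const 1)) ;;
    .assign 10 (load 18 (var 6)) ;;
    .ite (load 17 (var 10)) .skip (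
      .store 17 (var 10) (const 1) ;;
      .ite (bin .add (bin .lt (var 10) (var 8))
          (bin .lt (bin .add (var 8) (var 8)) (bin .add (var 10) (const 1)))) (
        .store 18 (var 6) (load 15 (bin .add (var 10) (var 10))) ;;
        .store 18 (bin .add (var 6) (const 1))
          (load 15 (bin .add (bin .add (var 10) (var 10)) (const 1))) ;;
        .assign 6 (bin .add (var 6) (const 2))) (
        .assign 11 (load 10 (bin .sub (var 10) (var 8))) ;;
        .ite (bin .eq (load 5 (var 11)) (var 0)) (
          .store 5 (var 11) (var 7) ;;
          .store 19 (var 5) (var 11) ;;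
          .assign 5 (bin .add (var 5) (const 1))) .skip))) (
    .assign 7 (load 19 (var 4)) ;;
    .assign 4 (bin .add (var 4) (const 1)) ;;
    .store 18 (const 0) (load 16 (load 1 (var 7))) ;;
    .assign 6 (const 1))

/-- Breadth-first search from the vertex in register `3`. -/
def bfsProg : Prog :=
  .store 5 (var 3) (var 3) ;;
  .store 19 (const 0) (var 3) ;;
  .assign 5 (const 1) ;;
  .assign 4 (const 0) ;;
  .assign 6 (const 0) ;;
  .store 17 (const 0) (const 1) ;;
  .loop (bin .add (var 6) (bin .sub (var 5) (var 4))) bfsStep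

theorem card_unmarked_update {mark : ℕ → ℕ} {m id : ℕ} (hid : id < m) (h : mark id = 0) :
    ((Finset.range m).filter fun i => Function.update mark id 1 i = 0).card + 1 =
      ((Finset.range m).filter fun i => mark i = 0).card := by
  have hmem : id ∈ (Finset.range m).filter fun i => mark i = 0 := by simp [hid, h]
  rw [← Finset.card_erase_add_one hmem]
  congr 2
  ext i
  by_cases hi : i = id <;> simp [hi]

theorem run_bfsProg {n : ℕ} {G : SimpleGraph (Fin n)} {r : Fin n} {W m L : ℕ}
    {ver pos : Fin n → ℕ} (h0 : s.reg 0 = n) (h3 : s.reg 3 = r) (h8 : s.reg 8 = W)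
    (hc : SegStore (s.arr 15) W m) (hW : W = 2 ^ L) (hpos : ∀ y, pos y < W)
    (hinj : Function.Injective pos) (hvtx : ∀ y, s.arr 10 (pos y) = y)
    (hver' : ∀ y : Fin n, s.arr 16 (s.arr 1 y) = ver y)
    (hver : ∀ x, ∃ S, SegTree (s.arr 15) W m L 0 (ver x) S ∧ (∀ q ∈ S, ∃ y, pos y = q) ∧
      ∀ y, pos y ∈ S ↔ G.Adj x y)
    (h5 : ∀ i < n, s.arr 5 i = n) (h17 : ∀ i, s.arr 17 i = 0) (hB : 3 * m + 2 * n + 2 ≤ B)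
    (hk : 100 * (3 * m + 2 * n) + 50 ≤ k) :
    Run w B bfsProg (fun s' _ =>
      ∃ H : G.Subgraph, IsShortestPathTree G r H ∧ StoresRootedTree H r (s'.arr 5)) s k := by
  have hWpos : 0 < W := hW ▸ Nat.two_pow_pos L
  have hmpos : 0 < m := by have := hc.two_mul_le; omega
  refine Run.seq (Run.of_wp rfl (by simp; omega) fun hs => ?_)
  simp only [Prog.wp, Expr.eval, Expr.coef, Prog.time, Expr.cost]
  refine ⟨by simp, ?_⟩
  refine Run.seq (Run.of_wp rfl (by simp; omega) fun hs => ?_)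
  simp only [Prog.wp, Expr.eval, Expr.coef, Prog.time, Expr.cost]
  refine ⟨by simp, ?_⟩
  refine Run.seq (Run.of_wp rfl (by simp; omega) fun hs => ?_)
  simp only [Prog.wp, Expr.eval, Expr.coef, Prog.time, Expr.cost]
  refine ⟨by simp, ?_⟩
  refine Run.seq (Run.of_wp rfl (by simp; omega) fun hs => ?_)
  simp only [Prog.wp, Expr.eval, Expr.coef, Prog.time, Expr.cost]
  refine ⟨by simp, ?_⟩
  refine Run.seq (Run.of_wp rfl (by simp; omega) fun hs => ?_)
  simp only [Prog.wp, Expr.eval, Expr.coef, Prog.time, Expr.cost]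
  refine ⟨by simp, ?_⟩
  refine Run.seq (Run.of_wp rfl (by simp; omega) fun hs => ?_)
  simp only [Prog.wp, Expr.eval, Expr.coef, Prog.time, Expr.cost]
  refine ⟨by simp, ?_⟩
  refine Run.loop (fun s' k' =>
    Bfs G r (s.arr 15) W m ver pos (s'.reg 4) (s'.reg 5) (s'.reg 6) (s'.reg 7) (s'.arr 5)
      (s'.arr 17) (s'.arr 18) (s'.arr 19) ∧
    3 * ((Finset.range m).filter fun i => s'.arr 17 i = 0).card + s'.reg 6 + 2 * (n - s'.reg 4) ≤
      3 * m + 2 * n ∧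
    100 * (3 * ((Finset.range m).filter fun i => s'.arr 17 i = 0).card + s'.reg 6 +
      2 * (n - s'.reg 4)) + 10 ≤ k') rfl ?_ ?_
  · rintro s' k' hf hm ⟨h, hp, hk'⟩
    have r0 : s'.reg 0 = n := by simpa [h0] using hf.reg 0 (by decide)
    have r8 : s'.reg 8 = W := by simpa [h8] using hf.reg 8 (by decide)
    have a1 : s'.arr 1 = s.arr 1 := by simpa using hf.arr 1 (by decide)
    have a10 : s'.arr 10 = s.arr 10 := by simpa using hf.arr 10 (by decide)
    have a15 : s'.arr 15 = s.arr 15 := by simpa using hf.arr 15 (by decide)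
    have a16 : s'.arr 16 = s.arr 16 := by simpa using hf.arr 16 (by decide)
    have hle := h.head_le
    have htail := h.tail_le
    refine ⟨by simp; omega, fun he => ?_, fun he => ?_⟩
    · simp at he
      rw [he.1] at h
      exact h.exists_tree (hW ▸ hpos) hver (by omega)
    · simp at he
      refine Run.of_wp rfl ?_ fun _ => ?_
      · simp [bfsStep]
        omega
      simp only [bfsStep, Prog.wp]
      refine ⟨fun h6 => ?_, fun h6 => ?_⟩
      · obtain ⟨sp, hsp⟩ : ∃ sp, s'.reg 6 = sp + 1 := ⟨s'.reg 6 - 1, by simp at h6; omega⟩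
        obtain ⟨id, hid⟩ : ∃ id, s'.arr 18 sp = id := ⟨_, rfl⟩
        rw [hsp] at h hp hk'
        have hlt := h.top_lt
        rw [hid] at hlt
        simp [hsp, hid, r8, r0, a10, a15, ← two_mul]
        refine ⟨fun hmk => ?_, fun hmk => ⟨?_, ?_⟩⟩
        · exact ⟨h.pop_marked (by rwa [hid]), by omega, by omega⟩
        · intro hi
          have hcard := card_unmarked_update hlt hmk
          have := h.pop_inner hc.zero hc.one hid (by omega) hmk hpos
          exact ⟨by omega, this, by omega, by omega⟩
        · intro h1 h2
          have hcard := card_unmarked_update hlt hmk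
          obtain ⟨y, z, hz, hy, hadj⟩ := h.top_leaf hid (by omega)
          have hpy : s.arr 10 (id - W) = y := by rw [hy, Nat.add_sub_cancel_left, hvtx]
          rw [hpy]
          refine ⟨fun hn => ⟨by omega, ?_, by omega, by omega⟩, fun hn => ⟨?_, by omega, by omega⟩⟩
          · refine (h.push (h.started (by omega)) hz hadj hn).pop_leaf hinj hid (by omega) hy ?_
            rw [Function.update_self, hz]
            exact z.2.ne
          · exact h.pop_leaf hinj hid (by omega) hy hn
      · simp at h6
        simp [h6] at he
        rw [h6] at h
        simp [a16, a1]
        have hlt : s'.reg 4 < s'.reg 5 := by omega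
        obtain ⟨z, hz⟩ : ∃ z : Fin n, s'.arr 19 (s'.reg 4) = z := ⟨⟨_, h.queue_lt _ hlt⟩, rfl⟩
        have := h.dequeue (hW ▸ hpos) hver hlt hz
        rw [hz, hver']
        exact ⟨by omega, this, by omega, by omega⟩
  · have hcard := Finset.card_filter_le (Finset.range m)
      fun x => Function.update (s.arr 17) 0 1 x = 0
    rw [Finset.card_range] at hcard
    simp
    refine ⟨Bfs.initial (fun y hy => ?_) (by simp [h3]) (fun id => ?_) hmpos hWpos, hcard, by omega⟩
    · simp [Function.update_apply, h3, h5 y hy]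
      split_ifs with h
      exacts [h.symm, rfl]
    · simp [Function.update_apply, h17]

end WordRAM

theorem arrayOf_coe {m : ℕ} (f : Fin m → ℕ) (i : Fin m) : arrayOf f i = f i := by
  simp [arrayOf]

theorem arrayOf_le {m B : ℕ} {f : Fin m → ℕ} (h : ∀ i, f i ≤ B) (i : ℕ) : arrayOf f i ≤ B := by
  unfold arrayOf
  split_ifs
  exacts [h _, Nat.zero_le _]

theorem exists_append {α : Type*} (a : α) {p : ℕ} (f g : Fin p → α) :
    ∃ h : ℕ → α, (∀ i : Fin p, h i = f i) ∧ ∀ i : Fin p, h (p + i) = g i :=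
  ⟨fun e => if he : e < p then f ⟨e, he⟩ else if he : e - p < p then g ⟨e - p, he⟩ else a,
    fun i => by simp, fun i => by simp⟩

theorem forall_lt_two_mul {p : ℕ} {q : ℕ → Prop} (h1 : ∀ i : Fin p, q i)
    (h2 : ∀ i : Fin p, q (p + i)) : ∀ e < 2 * p, q e := by
  intro e he
  by_cases hp : e < p
  · exact h1 ⟨e, hp⟩
  · have := h2 ⟨e - p, by omega⟩
    rwa [show p + (e - p) = e by omega] at this

namespace SignedTreeModel.Presentation

variable {T : RootedTree} {M : SignedTreeModel T} {n N p : ℕ} {G : SimpleGraph (Fin n)}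

theorem card_add_one (D : M.Presentation G N p) : N + 1 = 2 * n :=
  RootedTree.card_add_one_of_full M.full D.node D.leaf.toEquiv

theorem card_pairs_le (D : M.Presentation G N p) : p ≤ N * N := by
  have : Fintype.card (Fin p) ≤ Fintype.card (Fin N × Fin N) :=
    Fintype.card_le_of_injective (fun i => (D.node (D.fst i), D.node (D.snd i))) fun i j hij => by
      simp only [Prod.mk.injEq, EmbeddingLike.apply_eq_iff_eq] at hij
      exact D.injective (by simp only [hij.1, hij.2])
  simpa using this

theorem mem_pair (D : M.Presentation G N p) (i : Fin p) : s(D.fst i, D.snd i) ∈ M.neg ∪ M.pos := by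
  cases hs : D.sign i
  · exact .inl ((D.mem_neg _).2 ⟨_, hs, rfl⟩)
  · exact .inr ((D.mem_pos _).2 ⟨_, hs, rfl⟩)

theorem card_pairs_eq_zero (D : M.Presentation G N p) (hn : n = 1) : p = 0 := by
  have hN := D.card_add_one
  obtain rfl : N = 1 := by omega
  have : Subsingleton T := D.node.subsingleton
  by_contra hp
  exact (M.transversal _ _ (D.mem_pair ⟨0, by omega⟩)).1 (Subsingleton.elim _ _).le

theorem mem_pos_iff (D : M.Presentation G N p) (i : Fin p) :
    s(D.fst i, D.snd i) ∈ M.pos ↔ D.sign i = true := by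
  rw [D.mem_pos]
  constructor
  · rintro ⟨j, hj, he⟩
    rwa [← D.injective he]
  · exact fun h => ⟨i, h, rfl⟩

theorem adj_iff (D : M.Presentation G N p) (x y : Fin n) :
    G.Adj x y ↔ M.CoveredPos (D.leaf x).1 (D.leaf y).1 :=
  D.leaf.map_adj_iff.symm

theorem input_le (D : M.Presentation G N p) (v : Fin n) {B : ℕ} (hn : n ≤ B) (hN : N ≤ B)
    (hp : p ≤ B) :
    (∀ x, (D.input v).reg x ≤ B) ∧ ∀ a i, (D.input v).arr a i ≤ B := by
  refine ⟨fun x => ?_, fun a => ?_⟩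
  · match x with
    | 0 => exact hn
    | 1 => exact hN
    | 2 => exact hp
    | 3 => exact v.2.le.trans hn
    | _ + 4 => exact Nat.zero_le _
  · match a with
    | 0 =>
      exact arrayOf_le (f := fun i => (D.node (Order.pred (D.node.symm i)) : ℕ))
        fun i => (Fin.is_lt _).le.trans hN
    | 1 =>
      exact arrayOf_le (f := fun i => (D.node (D.leaf i).1 : ℕ))
        fun i => (Fin.is_lt _).le.trans hN
    | 2 =>
      exact arrayOf_le (f := fun i => (D.node (D.fst i) : ℕ))
        fun i => (Fin.is_lt _).le.trans hN
    | 3 =>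
      exact arrayOf_le (f := fun i => (D.node (D.snd i) : ℕ))
        fun i => (Fin.is_lt _).le.trans hN
    | 4 =>
      refine arrayOf_le (f := fun i => if D.sign i then 1 else 0) fun i => ?_
      have := v.pos
      split_ifs <;> omega
    | _ + 5 => exact fun _ => Nat.zero_le _

end SignedTreeModel.Presentation

namespace WordRAM

open RootedTree

/-- The shortest-path tree algorithm. -/
def shortestPathTreeProg : Prog :=
  initProg ;; peelProg ;; layoutProg ;; vertexProg ;; mirrorProg ;; columnProg ;; rowProg ;;
    heapProg ;; versionProg ;; bfsProg

theorem run_shortestPathTreeProg {T : RootedTree} {M : SignedTreeModel T} {n N p : ℕ}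
    {G : SimpleGraph (Fin n)} (D : M.Presentation G N p) (v : Fin n) {w B k L W : ℕ}
    (hL : L = n.size) (hW : W = 2 ^ L) (hW2 : W ≤ 2 * n)
    (hB : 6 * W + 12 * (L * p) + 12 * p + 2 * n + 2 ≤ B)
    (hk : 2500 * n + 3400 * (L * p) ≤ k) :
    Run w B shortestPathTreeProg (fun s' _ =>
      ∃ H : G.Subgraph, IsShortestPathTree G v H ∧ StoresRootedTree H v (s'.arr 5))
      (D.input v) k := by
  classical
  let : Fintype T := Fintype.ofEquiv _ D.node.symm
  have hN : Fintype.card T = N := by simpa using Fintype.card_congr D.node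
  have hNn := D.card_add_one
  have hn := v.pos
  have hL1 : 1 ≤ L := hL ▸ Nat.size_pos.2 hn
  have hnW : n < W := by rw [hW, hL]; exact Nat.lt_size_self n
  have hp : p ≤ L * p := Nat.le_mul_of_pos_left _ hL1
  have e1 : (200 * L + 170) * (2 * p) = 400 * (L * p) + 340 * p := by ring
  have e2 : (2 * L + 2) * (2 * p) = 4 * (L * p) + 4 * p := by ring
  obtain ⟨ix, hix'⟩ : ∃ ix : T → ℕ, ∀ t, ix t = D.node t := ⟨_, fun _ => rfl⟩
  have hix : Function.Injective ix := fun t u h => by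
    rw [hix', hix'] at h
    exact D.node.injective (Fin.ext h)
  have hpar : ∀ t, (D.input v).arr 0 (ix t) = ix (Order.pred t) := fun t => by
    rw [hix', hix']
    exact (arrayOf_coe (fun i => (D.node (Order.pred (D.node.symm i)) : ℕ)) _).trans (by simp)
  have hleaf : ∀ i : Fin n, (D.input v).arr 1 i = ix (D.leaf i).1 := fun i => by
    rw [hix']
    exact arrayOf_coe (fun i => (D.node (D.leaf i).1 : ℕ)) i
  obtain ⟨row, hrow1, hrow2⟩ := exists_append ⊥ D.fst D.snd
  obtain ⟨col, hcol1, hcol2⟩ := exists_append ⊥ D.snd D.fst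
  have hfst : ∀ i : Fin p, (D.input v).arr 2 i = ix (D.fst i) := fun i => by
    rw [hix']
    exact arrayOf_coe (fun i => (D.node (D.fst i) : ℕ)) i
  have hsnd : ∀ i : Fin p, (D.input v).arr 3 i = ix (D.snd i) := fun i => by
    rw [hix']
    exact arrayOf_coe (fun i => (D.node (D.snd i) : ℕ)) i
  have hsgn : ∀ i : Fin p, (D.input v).arr 4 i = if D.sign i then 1 else 0 := fun i =>
    arrayOf_coe (fun i => if D.sign i then 1 else 0) i
  refine Run.then_ (run_initProg (fun _ => rfl) (by change 20 * n + 10 ≤ k; omega)) ?_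
  rintro s1 k1 f1 m1 ⟨c1, p1, p2, p3⟩
  have z0 : (D.input v).reg 0 = n := rfl
  have z1 : (D.input v).reg 1 = N := rfl
  have z2 : (D.input v).reg 2 = p := rfl
  have z3 : (D.input v).reg 3 = v := rfl
  have g0 : s1.reg 0 = n := f1.reg 0 (by decide)
  have g1 : s1.reg 1 = N := f1.reg 1 (by decide)
  rw [z0] at c1 p1 p2 p3
  have hmax : ∀ t, (∃ i < n, (D.input v).arr 1 i = ix t) ↔ IsMax t := fun t => by
    constructor
    · rintro ⟨i, hi, he⟩
      rw [hleaf ⟨i, hi⟩] at he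
      exact hix he ▸ (D.leaf ⟨i, hi⟩).2
    · intro ht
      exact ⟨D.leaf.symm ⟨t, ht⟩, (D.leaf.symm ⟨t, ht⟩).2, by rw [hleaf, RelIso.apply_symm_apply]⟩
  have a10 : s1.arr 0 = (D.input v).arr 0 := f1.arr 0 (by decide)
  have a11 : s1.arr 1 = (D.input v).arr 1 := f1.arr 1 (by decide)
  have a16 : s1.arr 6 = fun _ => 0 := f1.arr 6 (by decide)
  have P1 : Peel ix (s1.reg 0) 0 (s1.reg 0) (s1.arr 1) (s1.arr 6) (s1.arr 7) (s1.arr 8) := by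
    rw [g0, a11, a16]
    refine Peel.initial hix D.leaf.toEquiv hleaf (fun _ => rfl) fun t => ?_
    split_ifs with h
    · exact p1 _ ((hmax t).2 h)
    · exact p2 _ fun h' => h ((hmax t).1 h')
  refine Run.then_ (run_peelProg M.full hix (fun t => by rw [a10, hpar]) (by rw [g1, hN]) (by omega)
    P1 (by rw [g1]; omega)) ?_
  rintro s2 k2 f2 m2 ⟨c2, P2, p4⟩
  rw [g0, g1] at P2
  rw [g0] at p4
  rw [g1] at c2
  have g2 : s2.reg 1 = N := (f2.reg 1 (by decide)).trans g1
  have hpar2 : ∀ t, s2.arr 0 (ix t) = ix (Order.pred t) := fun t => by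
    rw [f2.arr 0 (by decide), a10, hpar]
  have hleaf2 : ∀ i : Fin n, s2.arr 1 i = ix (D.leaf i).1 := fun i => by
    rw [p4 i i.2, a11, hleaf]
  refine Run.then_ (run_layoutProg (n := n) hix hpar2 (by omega) (by rwa [g2])
    (by rw [g2]; omega)) ?_
  rintro s3 k3 f3 m3 ⟨c3, hlay⟩
  rw [g2] at c3
  have a31 : s3.arr 1 = s2.arr 1 := f3.arr 1 (by decide)
  have g3 : s3.reg 0 = n := by rw [f3.reg 0 (by decide), f2.reg 0 (by decide), g0]
  obtain ⟨pos, hpos⟩ : ∃ pos : Fin n → ℕ, ∀ i, pos i = s3.arr 9 (ix (D.leaf i).1) :=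
    ⟨_, fun _ => rfl⟩
  have hpos_inj : Function.Injective pos := fun i j hij => by
    rw [hpos, hpos] at hij
    exact D.leaf.injective (Subtype.ext (hlay.lo_inj (D.leaf i).2 (D.leaf j).2 hij))
  have hpos_lt : ∀ i, pos i < n := fun i => by
    rw [hpos]
    exact hlay.lo_lt (D.leaf i).2
  have hpos_surj : ∀ q < n, ∃ i, pos i = q := fun q hq => by
    obtain ⟨i, hi⟩ := (Finite.injective_iff_surjective
      (f := fun i => (⟨pos i, hpos_lt i⟩ : Fin n))).1
      (fun i j hij => hpos_inj (by simpa using hij)) ⟨q, hq⟩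
    exact ⟨i, by simpa using hi⟩
  have hpos3 : ∀ i : Fin n, s3.arr 9 (s3.arr 1 i) = pos i := fun i => by
    rw [a31, hleaf2, hpos]
  refine Run.then_ (run_vertexProg (fun i hi j hj hij => ?_) (by rw [g3]; omega)) ?_
  · rw [g3] at hi hj
    have := hpos_inj ((hpos3 ⟨i, hi⟩).symm.trans (hij.trans (hpos3 ⟨j, hj⟩)))
    simpa using this
  rintro s4 k4 f4 m4 ⟨c4, p5⟩
  rw [g3] at c4 p5
  have g4 : s4.reg 2 = p := by
    rw [f4.reg 2 (by decide), f3.reg 2 (by decide), f2.reg 2 (by decide), f1.reg 2 (by decide), z2]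
  have a4 : ∀ a ∈ [2, 3, 4], s4.arr a = (D.input v).arr a := by
    intro a ha
    fin_cases ha <;> rw [f4.arr _ (by decide), f3.arr _ (by decide), f2.arr _ (by decide),
      f1.arr _ (by decide)]
  refine Run.then_ (run_mirrorProg (by rw [g4]; omega)) ?_
  rintro s5 k5 f5 m5 ⟨c5, p6⟩
  rw [g4, a4 2 (by decide), a4 3 (by decide), a4 4 (by decide)] at p6
  rw [g4] at c5
  have g5 : s5.reg 2 = p := (f5.reg 2 (by decide)).trans g4
  have hrow5 : ∀ e < 2 * p, s5.arr 2 e = ix (row e) :=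
    forall_lt_two_mul (fun i => by rw [(p6 i i.2).1, hfst, hrow1])
      fun i => by rw [(p6 i i.2).2.2.2.1, hsnd, hrow2]
  have hcol5 : ∀ e < 2 * p, s5.arr 3 e = ix (col e) :=
    forall_lt_two_mul (fun i => by rw [(p6 i i.2).2.1, hsnd, hcol1])
      fun i => by rw [(p6 i i.2).2.2.2.2.1, hfst, hcol2]
  have hsgn5 : ∀ e < 2 * p, s5.arr 4 e ≤ 1 :=
    forall_lt_two_mul (fun i => by rw [(p6 i i.2).2.2.1, hsgn]; split_ifs <;> simp)
      fun i => by rw [(p6 i i.2).2.2.2.2.2, hsgn]; split_ifs <;> simp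
  have hsp5 : ∀ e < 2 * p, s(row e, col e) ∈ M.pos ↔ s5.arr 4 e = 1 :=
    forall_lt_two_mul
      (fun i => by rw [(p6 i i.2).2.2.1, hsgn, hrow1, hcol1, D.mem_pos_iff]; simp)
      fun i => by
        rw [(p6 i i.2).2.2.2.2.2, hsgn, hrow2, hcol2, Sym2.eq_swap, D.mem_pos_iff]; simp
  have hmem : ∀ x y, s(x, y) ∈ M.neg ∪ M.pos ↔ ∃ e < 2 * p, row e = x ∧ col e = y := by
    intro x y
    constructor
    · intro h
      obtain ⟨i, hi⟩ : ∃ i, s(D.fst i, D.snd i) = s(x, y) := by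
        rcases h with h | h
        · obtain ⟨i, -, hi⟩ := (D.mem_neg _).1 h
          exact ⟨i, hi⟩
        · obtain ⟨i, -, hi⟩ := (D.mem_pos _).1 h
          exact ⟨i, hi⟩
      rcases Sym2.eq_iff.1 hi with ⟨h1, h2⟩ | ⟨h1, h2⟩
      · exact ⟨i, by omega, by rw [hrow1, h1], by rw [hcol1, h2]⟩
      · exact ⟨p + i, by omega, by rw [hrow2, h2], by rw [hcol2, h1]⟩
    · rintro ⟨e, he, rfl, rfl⟩
      revert e
      refine forall_lt_two_mul (fun i => ?_) fun i => ?_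
      · rw [hrow1, hcol1]
        exact D.mem_pair i
      · rw [hrow2, hcol2, Sym2.eq_swap]
        exact D.mem_pair i
  have a511 : s5.arr 11 = fun _ => 0 := by
    rw [f5.arr 11 (by decide), f4.arr 11 (by decide), f3.arr 11 (by decide),
      f2.arr 11 (by decide), f1.arr 11 (by decide)]
    rfl
  refine Run.then_ (run_columnProg (fun _ => by rw [a511]) (by rw [g5]; omega)
    (by rw [g5]; omega)) ?_
  rintro s6 k6 f6 m6 ⟨c6, b6⟩
  rw [g5] at c6 b6
  have g6 : s6.reg 2 = p := (f6.reg 2 (by decide)).trans g5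
  have g61 : s6.reg 1 = N := by
    rw [f6.reg 1 (by decide), f5.reg 1 (by decide), f4.reg 1 (by decide), f3.reg 1 (by decide), g2]
  have a61 : s6.arr 1 = s2.arr 1 := by
    rw [f6.arr 1 (by decide), f5.arr 1 (by decide), f4.arr 1 (by decide), a31]
  have a62 : s6.arr 2 = s5.arr 2 := f6.arr 2 (by decide)
  have a63 : s6.arr 3 = s5.arr 3 := f6.arr 3 (by decide)
  have a613 : s6.arr 13 = fun _ => 0 := by
    rw [f6.arr 13 (by decide), f5.arr 13 (by decide), f4.arr 13 (by decide),
      f3.arr 13 (by decide), f2.arr 13 (by decide), f1.arr 13 (by decide)]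
    rfl
  obtain ⟨rank, hrank⟩ : ∃ rank : ℕ → ℕ, ∀ j < N, rank (s2.arr 1 j) = j :=
    ⟨Function.invFunOn (s2.arr 1) (Set.Iio N), fun j hj =>
      Set.InjOn.leftInvOn_invFunOn (fun i hi j hj hij => P2.inj i hi j hj hij) hj⟩
  refine Run.then_ (run_rowProg (rank := rank) (rk := fun _ => 0) (fun _ => by rw [a613])
    (by rwa [g61, a61]) (fun e he => ?_) (by rwa [a63, g6]) (by rw [g6, g61]; omega)) ?_
  · rw [g6] at he
    rw [g61, a61, a63, hcol5 e he]
    exact P2.exists_index rfl _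
  rintro s7 k7 f7 m7 ⟨c7, b7⟩
  rw [a62, a63, g6] at b7
  rw [g6, g61] at c7
  have g7 : s7.reg 0 = n := by
    rw [f7.reg 0 (by decide), f6.reg 0 (by decide), f5.reg 0 (by decide), f4.reg 0 (by decide), g3]
  have a715 : s7.arr 15 = fun _ => 0 := by
    rw [f7.arr 15 (by decide), f6.arr 15 (by decide), f5.arr 15 (by decide), f4.arr 15 (by decide),
      f3.arr 15 (by decide), f2.arr 15 (by decide), f1.arr 15 (by decide)]
    rfl
  refine Run.then_ (run_heapProg (W := W) (by rw [g7, hW, hL]) (fun _ => by rw [a715]) (by omega)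
    (by omega)) ?_
  rintro s8 k8 f8 m8 ⟨c8, r8, r9, q0, q1, q2⟩
  have g81 : s8.reg 1 = N := by rw [f8.reg 1 (by decide), f7.reg 1 (by decide), g61]
  have g82 : s8.reg 2 = p := by rw [f8.reg 2 (by decide), f7.reg 2 (by decide), g6]
  have a80 : s8.arr 0 = s2.arr 0 := by
    rw [f8.arr 0 (by decide), f7.arr 0 (by decide), f6.arr 0 (by decide), f5.arr 0 (by decide),
      f4.arr 0 (by decide), f3.arr 0 (by decide)]
  have a81 : s8.arr 1 = s2.arr 1 := by rw [f8.arr 1 (by decide), f7.arr 1 (by decide), a61]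
  have a82 : s8.arr 2 = s5.arr 2 := by rw [f8.arr 2 (by decide), f7.arr 2 (by decide), a62]
  have a83 : s8.arr 3 = s5.arr 3 := by rw [f8.arr 3 (by decide), f7.arr 3 (by decide), a63]
  have a84 : s8.arr 4 = s5.arr 4 := by
    rw [f8.arr 4 (by decide), f7.arr 4 (by decide), f6.arr 4 (by decide)]
  have a87 : s8.arr 7 = s2.arr 7 := by
    rw [f8.arr 7 (by decide), f7.arr 7 (by decide), f6.arr 7 (by decide), f5.arr 7 (by decide),
      f4.arr 7 (by decide), f3.arr 7 (by decide)]
  have a89 : s8.arr 9 = s3.arr 9 := by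
    rw [f8.arr 9 (by decide), f7.arr 9 (by decide), f6.arr 9 (by decide), f5.arr 9 (by decide),
      f4.arr 9 (by decide)]
  have a816 : s8.arr 16 = fun _ => 0 := by
    rw [f8.arr 16 (by decide), f7.arr 16 (by decide), f6.arr 16 (by decide), f5.arr 16 (by decide),
      f4.arr 16 (by decide), f3.arr 16 (by decide), f2.arr 16 (by decide), f1.arr 16 (by decide)]
    rfl
  refine Run.then_ (run_versionProg (M := M) (n := n) (L := L) (W := W) (m := 2 * W) (rank := rank)
    (row := row) (col := col) hix (fun t => by rw [a80, hpar2]) (by rw [g81, a81]; exact P2)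
    (by rw [a89, a87]; exact hlay) (by rwa [g82, a82]) (by rwa [g82, a83]) (by rwa [g82, a84])
    (by rwa [g82]) (by rwa [g82, a84]) (by rwa [g81, a81])
    (by rw [a82, a83, g82, f8.arr 14 (by decide), f8.arr 13 (by decide)]; exact b7) hW r8 hnW r9
    ⟨q0, q1, le_rfl, q2⟩ (fun _ => by rw [a816]) (by rw [g82, e2]; omega)
    (by rw [g81, g82, e1]; omega)) ?_
  rintro s9 k9 f9 m9 ⟨c9, r99, hstore, hver⟩
  rw [g81, g82, e1] at c9
  rw [g82, e2] at r99
  have a91 : s9.arr 1 = s2.arr 1 := by rw [f9.arr 1 (by decide), a81]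
  have a95 : s9.arr 5 = s1.arr 5 := by
    rw [f9.arr 5 (by decide), f8.arr 5 (by decide), f7.arr 5 (by decide), f6.arr 5 (by decide),
      f5.arr 5 (by decide), f4.arr 5 (by decide), f3.arr 5 (by decide), f2.arr 5 (by decide)]
  have a910 : s9.arr 10 = s4.arr 10 := by
    rw [f9.arr 10 (by decide), f8.arr 10 (by decide), f7.arr 10 (by decide), f6.arr 10 (by decide),
      f5.arr 10 (by decide)]
  have a917 : s9.arr 17 = fun _ => 0 := by
    rw [f9.arr 17 (by decide), f8.arr 17 (by decide), f7.arr 17 (by decide), f6.arr 17 (by decide),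
      f5.arr 17 (by decide), f4.arr 17 (by decide), f3.arr 17 (by decide), f2.arr 17 (by decide),
      f1.arr 17 (by decide)]
    rfl
  refine run_bfsProg (W := W) (m := s9.reg 9) (L := L) (pos := pos)
    (ver := fun x => s9.arr 16 (ix (D.leaf x).1)) ?_ ?_ ?_ hstore hW
    (fun y => (hpos_lt y).trans hnW)
    hpos_inj (fun y => ?_) (fun y => ?_) (fun x => ?_) (fun i hi => ?_) (fun _ => by rw [a917])
    (by omega) (by omega)
  · rw [f9.reg 0 (by decide), f8.reg 0 (by decide), g7]
  · rw [f9.reg 3 (by decide), f8.reg 3 (by decide), f7.reg 3 (by decide), f6.reg 3 (by decide),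
      f5.reg 3 (by decide), f4.reg 3 (by decide), f3.reg 3 (by decide), f2.reg 3 (by decide),
      f1.reg 3 (by decide), z3]
  · rw [f9.reg 8 (by decide), r8]
  · rw [a910, ← hpos3, p5 y y.2]
  · rw [a91, hleaf2]
  · obtain ⟨S, h1, h2, h3⟩ := hver (D.leaf x).1
    refine ⟨S, h1, fun q hq => hpos_surj q (h2 q hq), fun y => ?_⟩
    rw [hpos, D.adj_iff, ← h3 _ (D.leaf y).2, a89]
  · rw [a95, p3 i hi]

end WordRAM

theorem size_le_two_mul_logb {n : ℕ} (hn : 2 ≤ n) : (n.size : ℝ) ≤ 2 * Real.logb 2 n := by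
  have h1 : 1 ≤ n.size - 1 := by
    have := Nat.size_le_size hn
    have : Nat.size 2 = 2 := by decide
    omega
  have h2 : 2 ^ (n.size - 1) ≤ n := Nat.lt_size.1 (by omega)
  have h3 : ((n.size - 1 : ℕ) : ℝ) ≤ Real.logb 2 n := by
    rw [Real.le_logb_iff_rpow_le (by norm_num) (by positivity), Real.rpow_natCast]
    exact_mod_cast h2
  have h4 : (n.size : ℝ) ≤ 2 * ((n.size - 1 : ℕ) : ℝ) := by exact_mod_cast (by omega)
  linarith

/-- There is one program that, on a machine whose word length is a constant times the bit length
of the number `n` of vertices, computes (as parent pointers, in array `5`) a shortest-path tree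
rooted at the source in time `O(n + p log n)`. -/
theorem theorem2 :
    ∃ (P : WordRAM.Prog) (K C : ℕ),
      ∀ (T : RootedTree) (M : SignedTreeModel T) (n N p : ℕ) (G : SimpleGraph (Fin n))
        (D : M.Presentation G N p) (v : Fin n),
        ∃ (s : WordRAM.State) (t : ℕ),
          WordRAM.Exec (K * Nat.size n) P (D.input v) s t ∧
          (t : ℝ) ≤ C * (n + p * Real.logb 2 n) ∧
          ∃ H : G.Subgraph, IsShortestPathTree G v H ∧ StoresRootedTree H v (s.arr 5) := by
  refine ⟨WordRAM.shortestPathTreeProg, 20, 6800, fun T M n N p G D v => ?_⟩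
  obtain ⟨L, hL⟩ : ∃ L, L = n.size := ⟨_, rfl⟩
  obtain ⟨W, hW⟩ : ∃ W, W = 2 ^ L := ⟨_, rfl⟩
  have hn := v.pos
  have hL1 : 1 ≤ L := hL ▸ Nat.size_pos.2 hn
  have hnW : n < W := by rw [hW, hL]; exact Nat.lt_size_self n
  have hLW : L ≤ W := hW ▸ Nat.lt_two_pow_self.le
  have hW2 : W ≤ 2 * n := by
    have : 2 ^ (L - 1) ≤ n := Nat.lt_size.1 (by omega)
    rw [hW, show L = L - 1 + 1 by omega, pow_succ]
    omega
  have hNn := D.card_add_one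
  have hp := D.card_pairs_le
  have hpW : p ≤ 4 * W ^ 2 := by nlinarith
  have hLp : L * p ≤ 4 * W ^ 3 := by
    calc L * p ≤ W * (4 * W ^ 2) := Nat.mul_le_mul hLW hpW
      _ = 4 * W ^ 3 := by ring
  have hW1 : 2 ≤ W := by omega
  have h23 : W ^ 2 ≤ W ^ 3 := Nat.pow_le_pow_right (by omega) (by omega)
  have h13 : W ≤ W ^ 2 := Nat.le_self_pow (by omega) W
  have hB : 128 * W ^ 3 ≤ W ^ 12 := by
    calc 128 * W ^ 3 = 2 ^ 7 * W ^ 3 := by norm_num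
      _ ≤ W ^ 7 * W ^ 3 := Nat.mul_le_mul_right _ (Nat.pow_le_pow_left hW1 7)
      _ = W ^ 10 := by ring
      _ ≤ W ^ 12 := Nat.pow_le_pow_right (by omega) (by omega)
  have hroom : 16 * W ^ 12 < 2 ^ (20 * n.size) := by
    calc 16 * W ^ 12 = 2 ^ 4 * W ^ 12 := by norm_num
      _ ≤ W ^ 4 * W ^ 12 := Nat.mul_le_mul_right _ (Nat.pow_le_pow_left hW1 4)
      _ = W ^ 16 := by ring
      _ < W ^ 20 := Nat.pow_lt_pow_right (by omega) (by omega)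
      _ = 2 ^ (20 * n.size) := by rw [hW, hL, ← pow_mul, mul_comm]
  have hin := D.input_le v (B := W ^ 12) (by omega) (by omega) (by omega)
  obtain ⟨s, t, k, he, ht, -, hs⟩ := WordRAM.run_shortestPathTreeProg D v (w := 20 * n.size)
    (B := W ^ 12) hL hW hW2 (by omega) le_rfl ⟨by omega, hroom, hin.1, hin.2⟩
  refine ⟨s, t, he, ?_, hs⟩
  have h1 : (t : ℝ) ≤ 2500 * n + 3400 * (L * p) := by exact_mod_cast (by omega)
  have h2 : (L * p : ℝ) ≤ 2 * (p * Real.logb 2 n) := by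
    by_cases hn1 : n = 1
    · rw [D.card_pairs_eq_zero hn1]
      simp
    · have := mul_le_mul_of_nonneg_right (size_le_two_mul_logb (n := n) (by omega))
        (Nat.cast_nonneg (α := ℝ) p)
      rw [hL]
      linarith
  have h3 : (0 : ℝ) ≤ n := Nat.cast_nonneg n
  push_cast
  linarith
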